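/- Let $\beta>0$ and let $\overset{\circ}{U}_\beta=(\overset{\circ}{U}_\beta(t))_{0\le t\le 1}$ be the Ornstein–Uhlenbeck process starting at zero, i.e. a (jointly measurable) zero-mean Gaussian process on $[0,1]$ with covariance function $$G(t,s)=\frac1{2\beta}\Big(e^{-\beta|t-s|}-e^{-\beta(t+s)}\Big),\qquad t,s\in[0,1].$$ Let $\overline{\overset{\circ}{U}_\beta}(t)=\overset{\circ}{U}_\beta(t)-\int_0^1\overset{\circ}{U}_\beta(s)\,ds$ be the demeaned process, let $\overline G$ be its covariance function, and let $\|\cdot\|$ be the norm of $L_2[0,1]$. Then the integral equation $\int_0^1\overline G(t,s)u(s)\,ds=\mu u(t)$, $u\in L_2[0,1]$, has infinitely many positive eigenvalues, which can be listed in non-increasing order with their multiplicities as $\mu_1\ge\mu_2\ge\dots>0$, and $$\prod_{k=1}^\infty\frac{(\pi k)^{-2}}{\mu_k}=e^{\beta}.$$ Moreover, as $\varepsilon\to0^+$, $$\mathbb P\big\{\|\overline{\overset{\circ}{U}_\beta}\|\le\varepsilon\big\}\sim e^{\beta/2}\,\mathbb P\big\{\|B\|\le\varepsilon\big\}\sim\Big(\frac{8e^\beta}{\pi}\Big)^{1/2}\exp\Big(-\frac18\,\varepsilon^{-2}\Big),$$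 where $B$ is the (jointly measurable) Brownian bridge on $[0,1]$, i.e. the zero-mean Gaussian process with covariance function $\min(t,s)-ts$. -/

import Mathlib

open MeasureTheory ProbabilityTheory Filter Topology Asymptotics

noncomputable section

/-- `X` is a zero-mean Gaussian process on `[0,1]` with covariance function `K`, jointly measurable
in time and chance (up to a null set), so that its path integrals make sense. -/
structure IsCenteredGaussianProcess {Ω : Type*} [MeasurableSpace Ω]
    (K : unitInterval → unitInterval → ℝ) (X : unitInterval → Ω → ℝ) (P : Measure Ω) : Prop where
  gaussian : IsGaussianProcess X P
  aemeasurable : AEMeasurable (fun p : unitInterval × Ω => X p.1 p.2) (volume.prod P)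
  mean_zero : ∀ t, ∫ ω, X t ω ∂P = 0
  covariance : ∀ t s, cov[X t, X s; P] = K t s

/-- Covariance function of the Ornstein–Uhlenbeck process started at zero. -/
def ouZeroKernel (β : ℝ) (t s : unitInterval) : ℝ :=
  1 / (2 * β) * (Real.exp (-β * |(t : ℝ) - s|) - Real.exp (-β * ((t : ℝ) + s)))

/-- Covariance function of the Brownian bridge. -/
def bridgeKernel (t s : unitInterval) : ℝ := min (t : ℝ) s - (t : ℝ) * s

/-- The demeaned (centered) process `X(t) - ∫₀¹ X(s) ds`. -/
def demean {Ω : Type*} (X : unitInterval → Ω → ℝ) (t : unitInterval) (ω : Ω) : ℝ :=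
  X t ω - ∫ s, X s ω

/-- The `L₂[0,1]` norm of a path. -/
def pathNorm {Ω : Type*} (X : unitInterval → Ω → ℝ) (ω : Ω) : ℝ :=
  Real.sqrt (∫ t, X t ω ^ 2)

/-- The small ball probability `P{‖X‖ ≤ ε}`. -/
def smallBall {Ω : Type*} [MeasurableSpace Ω] (X : unitInterval → Ω → ℝ) (P : Measure Ω)
    (ε : ℝ) : ℝ :=
  P.real {ω | pathNorm X ω ≤ ε}

/-- The solutions `u ∈ L₂[0,1]` of the integral equation `∫₀¹ K(t,s) u(s) ds = m u(t)`, `t ∈ [0,1]`.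
For `m ≠ 0` the equation selects one function in each class of almost everywhere equal solutions,
so this is the eigenspace of the integral operator with kernel `K` in `L₂[0,1]`. -/
def kernelEigenspace (K : unitInterval → unitInterval → ℝ) (m : ℝ) :
    Submodule ℝ (unitInterval → ℝ) where
  carrier := {u | MemLp u 2 volume ∧
    ∀ t, Integrable (fun s => K t s * u s) volume ∧ ∫ s, K t s * u s = m * u t}
  zero_mem' := by
    refine ⟨MemLp.zero, fun t => ?_⟩
    simp
  add_mem' := by
    rintro u v ⟨hu, hu'⟩ ⟨hv, hv'⟩
    refine ⟨hu.add hv, fun t => ?_⟩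
    simp only [Pi.add_apply, mul_add]
    refine ⟨(hu' t).1.add (hv' t).1, ?_⟩
    rw [integral_add (hu' t).1 (hv' t).1, (hu' t).2, (hv' t).2]
  smul_mem' := by
    rintro c u ⟨hu, hu'⟩
    refine ⟨hu.const_smul c, fun t => ?_⟩
    simp only [Pi.smul_apply, smul_eq_mul, mul_left_comm _ c]
    refine ⟨(hu' t).1.const_mul c, ?_⟩
    rw [integral_const_mul, (hu' t).2]

/-- `μ 0 ≥ μ 1 ≥ …` is the list of all positive eigenvalues of the integral operator with kernel
`K`, in non-increasing order, each repeated according to its multiplicity. -/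
structure IsEigenvalueSequence (K : unitInterval → unitInterval → ℝ) (μ : ℕ → ℝ) : Prop where
  pos : ∀ k, 0 < μ k
  antitone : Antitone μ
  multiplicity : ∀ m : ℝ, 0 < m →
    Cardinal.mk {k : ℕ // μ k = m} = Module.rank ℝ (kernelEigenspace K m)

end

/-!
The covariance operator of the demeaned process is inverted by a second order differential operator,
so its eigenvalues are `1 / (ω² + β²)` for the positive zeros `ω` of an elementary function
`ouCharFun β`. There is one zero `ω k` between `π (k + 1)` and `π (k + 2)` for each `k`, and a
partial fraction (secular equation) argument evaluates `∏ ((ω k)² + y²) / (π (k + 1))²` in closed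
form; at `y = β` the value is `e^β`. The logarithmic derivative of this product at `y = β` gives
`∑ ((ω k)² + β²)⁻¹`, which equals the trace of the operator, so that no eigenvalue is missed.

By the Karhunen–Loève expansion the squared norms are weighted sums of independent `χ²` variables.
The inverse eigenvalues of the two processes differ by a bounded amount, whence the ratio of the
small ball probabilities tends to the square root of the product of the eigenvalue ratios. For the
bridge, the Laplace transform `(sinh y / y)^(-1/2)` of the squared norm is expanded in powers of
`exp (-2y)` and inverted term by term; the first term dominates near zero.
-/

section Secular

open Polynomial

variable {a d : ℕ → ℝ} {n k : ℕ}

/-- The numerator of the secular function `1 - ∑ k < n, d k / (w - a k)` over the common denominator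
`∏ k < n, (w - a k)`. -/
noncomputable def secularPolynomial (a d : ℕ → ℝ) (n : ℕ) : ℝ[X] :=
  Lagrange.nodal (Finset.range n) a -
    ∑ k ∈ Finset.range n, C (d k) * Lagrange.nodal ((Finset.range n).erase k) a

theorem degree_sum_C_mul_nodal_erase_lt (a d : ℕ → ℝ) (n : ℕ) :
    (∑ k ∈ Finset.range n, C (d k) * Lagrange.nodal ((Finset.range n).erase k) a).degree < n := by
  refine (degree_sum_le _ _).trans_lt ((Finset.sup_lt_iff (WithBot.bot_lt_coe n)).2 fun k hk => ?_)
  rw [← smul_eq_C_mul]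
  refine (degree_smul_le _ _).trans_lt ?_
  rw [Lagrange.degree_nodal]
  exact WithBot.coe_lt_coe.2 ((Finset.card_erase_lt_of_mem hk).trans_eq (Finset.card_range n))

theorem secularPolynomial_monic (a d : ℕ → ℝ) (n : ℕ) : (secularPolynomial a d n).Monic :=
  Lagrange.nodal_monic.sub_of_left <| by
    simpa only [Lagrange.degree_nodal, Finset.card_range] using
      degree_sum_C_mul_nodal_erase_lt a d n

theorem degree_secularPolynomial (a d : ℕ → ℝ) (n : ℕ) : (secularPolynomial a d n).degree = n := by
  have hnodal : (Lagrange.nodal (Finset.range n) a).degree = n := by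
    rw [Lagrange.degree_nodal, Finset.card_range]
  rw [secularPolynomial, degree_sub_eq_left_of_degree_lt, hnodal]
  exact hnodal.symm ▸ degree_sum_C_mul_nodal_erase_lt a d n

theorem eval_secularPolynomial_div {w : ℝ} (hw : ∀ k < n, w ≠ a k) :
    (secularPolynomial a d n).eval w / ∏ k ∈ Finset.range n, (w - a k) =
      1 - ∑ k ∈ Finset.range n, d k / (w - a k) := by
  have hne : ∀ k ∈ Finset.range n, w - a k ≠ 0 := fun k hk =>
    sub_ne_zero.2 (hw k (Finset.mem_range.1 hk))
  rw [secularPolynomial, eval_sub, eval_finsetSum, Lagrange.eval_nodal, sub_div,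
    div_self (Finset.prod_ne_zero_iff.2 hne), Finset.sum_div]
  congr 1
  refine Finset.sum_congr rfl fun k hk => ?_
  rw [eval_mul, eval_C, Lagrange.eval_nodal, ← Finset.mul_prod_erase _ _ hk,
    mul_div_mul_right _ _
      (Finset.prod_ne_zero_iff.2 fun j hj => hne j (Finset.mem_of_mem_erase hj))]

theorem eval_secularPolynomial_pole (hk : k < n) : (secularPolynomial a d n).eval (a k) =
    -(d k * ∏ j ∈ (Finset.range n).erase k, (a k - a j)) := by
  have hk' := Finset.mem_range.2 hk
  rw [secularPolynomial, eval_sub, Lagrange.eval_nodal_at_node hk', zero_sub, eval_finsetSum,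
    Finset.sum_eq_single_of_mem k hk', eval_mul, eval_C, Lagrange.eval_nodal]
  intro j _ hjk
  rw [eval_mul, Lagrange.eval_nodal_at_node (Finset.mem_erase.2 ⟨hjk.symm, hk'⟩), mul_zero]

theorem eval_secularPolynomial_pole_mul_succ_neg (ha : StrictMono a) (hd : ∀ k, 0 < d k)
    (hk : k + 1 < n) :
    (secularPolynomial a d n).eval (a k) * (secularPolynomial a d n).eval (a (k + 1)) < 0 := by
  set E := ((Finset.range n).erase (k + 1)).erase k
  have hlt : 0 < a (k + 1) - a k := sub_pos.2 (ha k.lt_succ_self)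
  have hsame : 0 < ∏ j ∈ E, (a k - a j) * (a (k + 1) - a j) := by
    refine Finset.prod_pos fun j hj => ?_
    simp only [E, Finset.mem_erase, Finset.mem_range] at hj
    rcases lt_or_gt_of_ne hj.1 with h | h
    · exact mul_pos (sub_pos.2 (ha h)) (sub_pos.2 (ha (h.trans k.lt_succ_self)))
    · exact mul_pos_of_neg_of_neg (sub_neg.2 (ha h)) (sub_neg.2 (ha (by lia)))
  rw [Finset.prod_mul_distrib] at hsame
  rw [eval_secularPolynomial_pole (by lia), eval_secularPolynomial_pole hk,
    ← Finset.mul_prod_erase ((Finset.range n).erase k) _ (a := k + 1) (by simp [hk]),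
    ← Finset.mul_prod_erase ((Finset.range n).erase (k + 1)) _ (a := k) (by simp; lia),
    Finset.erase_right_comm]
  linarith [mul_pos (mul_pos (mul_pos (hd k) (hd (k + 1))) (pow_pos hlt 2)) hsame]

theorem exists_secularPolynomial_root_between (ha : StrictMono a) (hd : ∀ k, 0 < d k)
    (hk : k + 1 < n) : ∃ r ∈ Set.Ioo (a k) (a (k + 1)), (secularPolynomial a d n).eval r = 0 := by
  have hle := (ha k.lt_succ_self).le
  have hcont := (secularPolynomial a d n).continuous.continuousOn (s := Set.Icc (a k) (a (k + 1)))
  rcases mul_neg_iff.1 (eval_secularPolynomial_pole_mul_succ_neg ha hd hk) with h | h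
  · exact intermediate_value_Ioo' hle hcont h.symm
  · exact intermediate_value_Ioo hle hcont h

theorem exists_secularPolynomial_root_gt_last (ha : StrictMono a) (hd : ∀ k, 0 < d k) (n : ℕ) :
    ∃ r > a n, (secularPolynomial a d (n + 1)).eval r = 0 := by
  set p := secularPolynomial a d (n + 1)
  have hneg : p.eval (a n) < 0 := by
    rw [eval_secularPolynomial_pole n.lt_succ_self, neg_lt_zero]
    refine mul_pos (hd n) (Finset.prod_pos fun j hj => sub_pos.2 (ha ?_))
    simp only [Finset.mem_erase, Finset.mem_range] at hj
    lia
  have htop : Tendsto (fun x => p.eval x) atTop atTop :=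
    p.tendsto_atTop_of_leadingCoeff_nonneg
      (by rw [degree_secularPolynomial]; exact_mod_cast n.succ_pos)
      (by rw [(secularPolynomial_monic a d _).leadingCoeff]; exact zero_le_one)
  obtain ⟨x, hx, hnx⟩ := ((htop.eventually_gt_atTop 0).and (eventually_gt_atTop (a n))).exists
  obtain ⟨r, hr, hr0⟩ := intermediate_value_Ioo hnx.le p.continuous.continuousOn ⟨hneg, hx⟩
  exact ⟨r, hr.1, hr0⟩

/-- `r 0, …, r (n - 1)` are the zeros of the secular function `1 - ∑ k < n, d k / (w - a k)`, each
one to the right of the pole with the same index and before the next one; the values `r k` for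
`n ≤ k` are irrelevant. -/
structure IsSecularRoots (a d : ℕ → ℝ) (n : ℕ) (r : ℕ → ℝ) : Prop where
  pole_lt : ∀ k < n, a k < r k
  lt_next_pole : ∀ k, k + 1 < n → r k < a (k + 1)
  one_sub_sum_eq_prod : ∀ w, (∀ k < n, w ≠ a k) →
    1 - ∑ k ∈ Finset.range n, d k / (w - a k) = ∏ k ∈ Finset.range n, (w - r k) / (w - a k)

theorem exists_isSecularRoots (ha : StrictMono a) (hd : ∀ k, 0 < d k) (n : ℕ) :
    ∃ r, IsSecularRoots a d n r := by
  have hroot : ∀ k < n, ∃ r, a k < r ∧ (k + 1 < n → r < a (k + 1)) ∧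
      (secularPolynomial a d n).eval r = 0 := by
    intro k hk
    rcases (Nat.succ_le_of_lt hk).lt_or_eq with h | rfl
    · obtain ⟨r, hr, hr0⟩ := exists_secularPolynomial_root_between ha hd h
      exact ⟨r, hr.1, fun _ => hr.2, hr0⟩
    · obtain ⟨r, hr, hr0⟩ := exists_secularPolynomial_root_gt_last ha hd k
      exact ⟨r, hr, fun h => absurd h (lt_irrefl _), hr0⟩
  choose! r hr hr' hr0 using hroot
  have hmono : StrictMonoOn r (Finset.range n) := by
    intro i hi j hj hij
    simp only [Finset.coe_range, Set.mem_Iio] at hi hj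
    calc r i < a (i + 1) := hr' i hi (by lia)
      _ ≤ a j := ha.monotone hij
      _ < r j := hr j hj
  have hfactor : secularPolynomial a d n = Lagrange.nodal (Finset.range n) r := by
    refine eq_of_degree_sub_lt_of_eval_finset_eq ((Finset.range n).image r) ?_ ?_
    · rw [Finset.card_image_of_injOn hmono.injOn, Finset.card_range, ← degree_secularPolynomial a d]
      exact degree_sub_lt_left (by rw [degree_secularPolynomial, Lagrange.degree_nodal,
        Finset.card_range]) (secularPolynomial_monic a d n).ne_zero
        (by rw [(secularPolynomial_monic a d n).leadingCoeff, Lagrange.nodal_monic.leadingCoeff])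
    · simp only [Finset.forall_mem_image]
      intro k hk
      rw [hr0 k (Finset.mem_range.1 hk), Lagrange.eval_nodal_at_node hk]
  refine ⟨r, hr, fun k hk => hr' k (by lia) hk, fun w hw => ?_⟩
  rw [← eval_secularPolynomial_div hw, hfactor, Lagrange.eval_nodal, Finset.prod_div_distrib]

end Secular

section InterlacingProduct

variable {a d : ℕ → ℝ} {k n : ℕ}

theorem div_sub_lt_div_sub {a d v w : ℝ} (hd : 0 < d) (hvw : v < w) (h : a < v ∨ w < a) :
    d / (w - a) < d / (v - a) := by
  rcases h with h | h
  · exact div_lt_div_of_pos_left hd (by linarith) (by linarith)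
  · rw [← neg_lt_neg_iff, ← div_neg, ← div_neg]
    exact div_lt_div_of_pos_left hd (by linarith) (by linarith)

theorem lt_or_lt_of_gap {v w : ℝ} (ha : StrictMono a) (hv : a k < v) (hw : w < a (k + 1)) (j : ℕ) :
    a j < v ∨ w < a j := by
  rcases le_or_gt j k with h | h
  · exact .inl ((ha.monotone h).trans_lt hv)
  · exact .inr (hw.trans_le (ha.monotone h))

theorem summable_div_sub (hlim : Tendsto a atTop atTop) (hd : ∀ k, 0 ≤ d k)
    (hs : Summable fun k => d k / a k) (w : ℝ) : Summable fun k => d k / (w - a k) := by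
  refine (hs.mul_left 2).of_norm_bounded_eventually_nat ?_
  filter_upwards [hlim.eventually_gt_atTop (2 * |w|)] with k hk
  have hhalf : a k / 2 ≤ |w - a k| := by
    rw [abs_sub_comm]
    exact le_trans (by linarith [le_abs_self w]) (le_abs_self _)
  have hpos : 0 < a k := lt_of_le_of_lt (by positivity) hk
  rw [norm_div, Real.norm_of_nonneg (hd k), Real.norm_eq_abs]
  calc d k / |w - a k| ≤ d k / (a k / 2) :=
        div_le_div_of_nonneg_left (hd k) (by positivity) hhalf
    _ = 2 * (d k / a k) := by ring

theorem summable_div_add (hpos : ∀ k, 0 < a k) (hd : ∀ k, 0 ≤ d k)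
    (hs : Summable fun k => d k / a k) {s : ℝ} (hs0 : 0 ≤ s) :
    Summable fun k => d k / (a k + s) :=
  hs.of_nonneg_of_le (fun k => div_nonneg (hd k) (by linarith [hpos k]))
    fun k => div_le_div_of_nonneg_left (hd k) (hpos k) (by linarith)

theorem tsum_div_sub_strictAnti (ha : StrictMono a) (hd : ∀ k, 0 < d k)
    (hs : ∀ w, Summable fun k => d k / (w - a k)) :
    StrictAntiOn (fun w => ∑' j, d j / (w - a j)) (Set.Ioo (a k) (a (k + 1))) :=
  fun _ hv _ hw hvw => Summable.tsum_lt_tsum (i := 0)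
    (fun j => (div_sub_lt_div_sub (hd j) hvw (lt_or_lt_of_gap ha hv.1 hw.2 j)).le)
    (div_sub_lt_div_sub (hd 0) hvw (lt_or_lt_of_gap ha hv.1 hw.2 0)) (hs _) (hs _)

theorem sum_div_sub_strictAnti (ha : StrictMono a) (hd : ∀ k, 0 < d k) (hk : k < n) :
    StrictAntiOn (fun w => ∑ j ∈ Finset.range n, d j / (w - a j)) (Set.Ioo (a k) (a (k + 1))) :=
  fun _ hv _ hw hvw => Finset.sum_lt_sum_of_nonempty (Finset.nonempty_range_iff.2 (by lia))
    fun j _ => div_sub_lt_div_sub (hd j) hvw (lt_or_lt_of_gap ha hv.1 hw.2 j)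

theorem tendsto_tsum_div_add_atTop (hpos : ∀ k, 0 < a k) (hd : ∀ k, 0 ≤ d k)
    (hs : Summable fun k => d k / a k) :
    Tendsto (fun T => ∑' k, d k / (a k + T)) atTop (𝓝 0) := by
  rw [← tsum_zero (α := ℝ) (β := ℕ)]
  refine tendsto_tsum_of_dominated_convergence hs (fun k => ?_) ?_
  · exact (tendsto_atTop_add_const_left _ _ tendsto_id).const_div_atTop _
  · filter_upwards [eventually_ge_atTop 0] with T hT k
    rw [Real.norm_of_nonneg (div_nonneg (hd k) (by linarith [hpos k]))]
    exact div_le_div_of_nonneg_left (hd k) (hpos k) (by linarith)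

theorem one_add_sum_le_prod_one_add {ι : Type*} (s : Finset ι) {f : ι → ℝ}
    (hf : ∀ i ∈ s, 0 ≤ f i) : 1 + ∑ i ∈ s, f i ≤ ∏ i ∈ s, (1 + f i) := by
  classical
  induction s using Finset.induction_on with
  | empty => simp
  | insert i s hi ih =>
    rw [Finset.forall_mem_insert] at hf
    rw [Finset.sum_insert hi, Finset.prod_insert hi]
    nlinarith [ih hf.2, Finset.sum_nonneg hf.2, hf.1]

namespace IsSecularRoots

variable {r : ℕ → ℝ}

theorem sum_eq_one (hr : IsSecularRoots a d n r) (ha : StrictMono a) (hk : k < n) :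
    ∑ j ∈ Finset.range n, d j / (r k - a j) = 1 := by
  have hne : ∀ j < n, r k ≠ a j := by
    intro j hj
    rcases le_or_gt j k with h | h
    · exact ((ha.monotone h).trans_lt (hr.pole_lt k hk)).ne'
    · exact ((hr.lt_next_pole k (by lia)).trans_le (ha.monotone h)).ne
  have hprod := hr.one_sub_sum_eq_prod _ hne
  rw [Finset.prod_eq_zero (Finset.mem_range.2 hk) (by rw [sub_self, zero_div])] at hprod
  linarith

theorem prod_add_div (hr : IsSecularRoots a d n r) (hpos : ∀ k, 0 < a k) {s : ℝ} (hs : 0 ≤ s) :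
    ∏ k ∈ Finset.range n, (r k + s) / (a k + s) =
      1 + ∑ k ∈ Finset.range n, d k / (a k + s) := by
  have h := hr.one_sub_sum_eq_prod (-s) fun k _ => by linarith [hpos k]
  simp_rw [← neg_add', neg_div_neg_eq, div_neg, Finset.sum_neg_distrib, sub_neg_eq_add] at h
  simpa only [add_comm s] using h.symm

theorem sum_gap_div_le (hr : IsSecularRoots a d n r) (hpos : ∀ k, 0 < a k) {s : ℝ} (hs : 0 ≤ s) :
    ∑ k ∈ Finset.range n, (r k - a k) / (a k + s) ≤ ∑ k ∈ Finset.range n, d k / (a k + s) := by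
  have hle := one_add_sum_le_prod_one_add (Finset.range n) (f := fun k => (r k - a k) / (a k + s))
    fun k hk => div_nonneg (sub_nonneg.2 (hr.pole_lt k (Finset.mem_range.1 hk)).le)
      (by linarith [hpos k])
  have hfactor : ∀ k, 1 + (r k - a k) / (a k + s) = (r k + s) / (a k + s) := fun k => by
    have : a k + s ≠ 0 := by linarith [hpos k]
    field_simp
    ring
  simp_rw [hfactor, hr.prod_add_div hpos hs] at hle
  linarith

theorem root_le (hr : IsSecularRoots a d n r) (ha : StrictMono a) (hd : ∀ k, 0 < d k)
    (hs : ∀ w, Summable fun k => d k / (w - a k)) {w : ℝ} (hw : w ∈ Set.Ioo (a k) (a (k + 1)))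
    (hw1 : ∑' j, d j / (w - a j) = 1) (hk : k < n) : w ≤ r k := by
  by_contra! hlt
  have hgap : r k ∈ Set.Ioo (a k) (a (k + 1)) := ⟨hr.pole_lt k hk, hlt.trans hw.2⟩
  have htail : ∑' j, d j / (r k - a j) ≤ ∑ j ∈ Finset.range n, d j / (r k - a j) := by
    rw [← (hs (r k)).sum_add_tsum_nat_add n, add_le_iff_nonpos_right]
    refine tsum_nonpos fun j => div_nonpos_of_nonneg_of_nonpos (hd _).le (sub_nonpos.2 ?_)
    exact hgap.2.le.trans (ha.monotone (by lia))
  have hlt' := tsum_div_sub_strictAnti ha hd hs hgap hw hlt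
  simp only [hw1] at hlt'
  linarith [hr.sum_eq_one ha hk]

end IsSecularRoots

theorem tendsto_secularRoot (ha : StrictMono a) (hd : ∀ k, 0 < d k)
    (hs : ∀ w, Summable fun k => d k / (w - a k)) {r : ℕ → ℕ → ℝ}
    (hr : ∀ n, IsSecularRoots a d n (r n)) {w : ℝ} (hw : w ∈ Set.Ioo (a k) (a (k + 1)))
    (hw1 : ∑' j, d j / (w - a j) = 1) : Tendsto (fun n => r n k) atTop (𝓝 w) := by
  refine tendsto_order.2 ⟨fun v hv => ?_, fun v hv => ?_⟩
  · filter_upwards [eventually_gt_atTop k] with n hn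
    exact hv.trans_le ((hr n).root_le ha hd hs hw hw1 hn)
  · obtain ⟨u, hwu, hu⟩ := exists_between (lt_min hv hw.2)
    rw [lt_min_iff] at hu
    have hugap : u ∈ Set.Ioo (a k) (a (k + 1)) := ⟨hw.1.trans hwu, hu.2⟩
    have hu1 : ∑' j, d j / (u - a j) < 1 :=
      hw1 ▸ tsum_div_sub_strictAnti ha hd hs hw hugap hwu
    filter_upwards [(hs u).hasSum.tendsto_sum_nat.eventually_lt_const hu1,
      eventually_gt_atTop (k + 1)] with n hn hkn
    refine lt_of_not_ge fun hle => ?_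
    have hanti := (sum_div_sub_strictAnti ha hd (n := n) (by lia)).antitoneOn hugap
      ⟨(hr n).pole_lt k (by lia), (hr n).lt_next_pole k hkn⟩ (hu.1.le.trans hle)
    simp only [(hr n).sum_eq_one ha (k := k) (by lia)] at hanti
    linarith

/- No mass escapes to infinity: for `s ≤ T ≤ a k` the weights `1 / (a k + s)` and `1 / (a k + T)`
differ at most by a factor `2`, and `∑ d k / (a k + T)` is small for large `T`. -/
theorem exists_sum_Ico_gap_div_le (hpos : ∀ k, 0 < a k) (hlim : Tendsto a atTop atTop)
    (hd : ∀ k, 0 < d k) (hs : Summable fun k => d k / a k) {r : ℕ → ℕ → ℝ}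
    (hr : ∀ n, IsSecularRoots a d n (r n)) {s ε : ℝ} (hs0 : 0 ≤ s) (hε : 0 < ε) :
    ∃ m, ∀ n, ∑ k ∈ Finset.Ico m n, (r n k - a k) / (a k + s) ≤ ε := by
  have hlim0 := tendsto_tsum_div_add_atTop hpos (fun k => (hd k).le) hs
  obtain ⟨T, hTε, hT⟩ :=
    ((hlim0.eventually_lt_const (half_pos hε)).and (eventually_ge_atTop 0)).exists
  obtain ⟨m, hm⟩ := eventually_atTop.1 (hlim.eventually_ge_atTop T)
  have hsummable := summable_div_add hpos (fun k => (hd k).le) hs hT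
  refine ⟨m, fun n => ?_⟩
  have hgap : ∀ k ∈ Finset.range n, 0 ≤ r n k - a k := fun k hk =>
    sub_nonneg.2 ((hr n).pole_lt k (Finset.mem_range.1 hk)).le
  have hsub : Finset.Ico m n ⊆ Finset.range n := fun k hk =>
    Finset.mem_range.2 (Finset.mem_Ico.1 hk).2
  calc ∑ k ∈ Finset.Ico m n, (r n k - a k) / (a k + s)
      ≤ ∑ k ∈ Finset.Ico m n, 2 * ((r n k - a k) / (a k + T)) := by
        refine Finset.sum_le_sum fun k hk => ?_
        have hTk := hm k (Finset.mem_Ico.1 hk).1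
        have hk0 := hpos k
        rw [← mul_div_assoc, div_le_div_iff₀ (by positivity) (by positivity), mul_comm 2, mul_assoc]
        exact mul_le_mul_of_nonneg_left (by linarith) (hgap k (hsub hk))
    _ ≤ ∑ k ∈ Finset.range n, 2 * ((r n k - a k) / (a k + T)) :=
        Finset.sum_le_sum_of_subset_of_nonneg hsub fun k hk _ =>
          mul_nonneg zero_le_two (div_nonneg (hgap k hk) (by linarith [hpos k]))
    _ = 2 * ∑ k ∈ Finset.range n, (r n k - a k) / (a k + T) := (Finset.mul_sum _ _ _).symm
    _ ≤ 2 * ∑' k, d k / (a k + T) := by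
        gcongr
        exact ((hr n).sum_gap_div_le hpos hT).trans (hsummable.sum_le_tsum _ fun k _ =>
          div_nonneg (hd k).le (by linarith [hpos k]))
    _ ≤ ε := by linarith

theorem one_add_tsum_le_exp_mul_prod (ha : StrictMono a) (hpos : ∀ k, 0 < a k)
    (hlim : Tendsto a atTop atTop) (hd : ∀ k, 0 < d k) (hs : Summable fun k => d k / a k)
    {w : ℕ → ℝ} (hw : ∀ k, w k ∈ Set.Ioo (a k) (a (k + 1)))
    (hw1 : ∀ k, ∑' j, d j / (w k - a j) = 1) {s ε : ℝ} (hs0 : 0 ≤ s) (hε : 0 < ε) :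
    ∃ m, 1 + ∑' k, d k / (a k + s) ≤
      Real.exp ε * ∏ k ∈ Finset.range m, (w k + s) / (a k + s) := by
  choose r hr using exists_isSecularRoots ha hd
  have hs' := summable_div_sub hlim (fun k => (hd k).le) hs
  obtain ⟨m, hm⟩ := exists_sum_Ico_gap_div_le hpos hlim hd hs hr hs0 hε
  have hsum : Tendsto (fun n => 1 + ∑ k ∈ Finset.range n, d k / (a k + s)) atTop
      (𝓝 (1 + ∑' k, d k / (a k + s))) :=
    (summable_div_add hpos (fun k => (hd k).le) hs hs0).hasSum.tendsto_sum_nat.const_add 1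
  have hprod : Tendsto (fun n => Real.exp ε * ∏ k ∈ Finset.range m, (r n k + s) / (a k + s)) atTop
      (𝓝 (Real.exp ε * ∏ k ∈ Finset.range m, (w k + s) / (a k + s))) :=
    (tendsto_finsetProd _ fun k _ =>
      ((tendsto_secularRoot ha hd hs' hr (hw k) (hw1 k)).add_const s).div_const _).const_mul _
  refine ⟨m, le_of_tendsto_of_tendsto hsum hprod ?_⟩
  filter_upwards [eventually_ge_atTop m] with n hn
  have hpos' : ∀ k, 0 < a k + s := fun k => by linarith [hpos k]
  have hgap : ∀ k < n, 0 < r n k - a k := fun k hk => sub_pos.2 ((hr n).pole_lt k hk)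
  have htail : ∏ k ∈ Finset.Ico m n, (r n k + s) / (a k + s) ≤ Real.exp ε := by
    refine le_trans ?_ (Real.exp_le_exp.2 (hm n))
    rw [Real.exp_sum]
    refine Finset.prod_le_prod (fun k hk => ?_) fun k _ => ?_
    · exact div_nonneg (by linarith [hgap k (Finset.mem_Ico.1 hk).2, hpos k]) (hpos' k).le
    · refine le_trans (le_of_eq ?_) (Real.add_one_le_exp _)
      rw [div_add_one (hpos' k).ne', ← add_assoc, sub_add_cancel]
  rw [← (hr n).prod_add_div hpos hs0, ← Finset.prod_range_mul_prod_Ico _ hn, mul_comm]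
  refine mul_le_mul_of_nonneg_right htail (Finset.prod_nonneg fun k hk => ?_)
  have hkn := (Finset.mem_range.1 hk).trans_le hn
  exact div_nonneg (by linarith [hgap k hkn, hpos k]) (hpos' k).le

theorem tendsto_prod_add_div (ha : StrictMono a) (hpos : ∀ k, 0 < a k)
    (hlim : Tendsto a atTop atTop) (hd : ∀ k, 0 < d k) (hs : Summable fun k => d k / a k)
    {w : ℕ → ℝ} (hw : ∀ k, w k ∈ Set.Ioo (a k) (a (k + 1)))
    (hw1 : ∀ k, ∑' j, d j / (w k - a j) = 1) {s : ℝ} (hs0 : 0 ≤ s) :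
    Tendsto (fun n => ∏ k ∈ Finset.range n, (w k + s) / (a k + s)) atTop
      (𝓝 (1 + ∑' k, d k / (a k + s))) := by
  set p : ℕ → ℝ := fun n => ∏ k ∈ Finset.range n, (w k + s) / (a k + s)
  set L := 1 + ∑' k, d k / (a k + s)
  have hpos' : ∀ k, 0 < a k + s := fun k => by linarith [hpos k]
  have hs' := summable_div_sub hlim (fun k => (hd k).le) hs
  have hone : ∀ k, 1 ≤ (w k + s) / (a k + s) := fun k =>
    (one_le_div (hpos' k)).2 (by linarith [(hw k).1])
  have hmono : Monotone p := monotone_nat_of_le_succ fun n => by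
    simp only [p, Finset.prod_range_succ]
    exact le_mul_of_one_le_right (Finset.prod_nonneg fun k _ => zero_le_one.trans (hone k)) (hone n)
  have hle : ∀ n, p n ≤ L := fun n => by
    obtain ⟨r, hr⟩ := exists_isSecularRoots ha hd n
    have hsummable := summable_div_add hpos (fun k => (hd k).le) hs hs0
    calc p n ≤ ∏ k ∈ Finset.range n, (r k + s) / (a k + s) := by
          refine Finset.prod_le_prod (fun k _ => zero_le_one.trans (hone k)) fun k hk => ?_
          have := hr.root_le ha hd hs' (hw k) (hw1 k) (Finset.mem_range.1 hk)
          exact div_le_div_of_nonneg_right (by linarith) (hpos' k).le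
      _ = 1 + ∑ k ∈ Finset.range n, d k / (a k + s) := hr.prod_add_div hpos hs0
      _ ≤ L := by
          exact add_le_add le_rfl
            (hsummable.sum_le_tsum _ fun k _ => div_nonneg (hd k).le (hpos' k).le)
  refine tendsto_order.2 ⟨fun v hv => ?_, fun v hv => .of_forall fun n => (hle n).trans_lt hv⟩
  have hexp : Tendsto (fun ε => Real.exp (-ε) * L) (𝓝[>] 0) (𝓝 L) := by
    have : Continuous fun ε => Real.exp (-ε) * L := by fun_prop
    simpa using this.continuousWithinAt (s := Set.Ioi 0) (x := 0) |>.tendsto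
  obtain ⟨ε, hvε, hε⟩ := ((hexp.eventually_const_lt hv).and self_mem_nhdsWithin).exists
  obtain ⟨m, hm⟩ := one_add_tsum_le_exp_mul_prod ha hpos hlim hd hs hw hw1 hs0 hε
  filter_upwards [eventually_ge_atTop m] with n hn
  calc v < Real.exp (-ε) * L := hvε
    _ ≤ Real.exp (-ε) * (Real.exp ε * p m) := by gcongr
    _ = p m := by rw [← mul_assoc, ← Real.exp_add, neg_add_cancel, Real.exp_zero, one_mul]
    _ ≤ p n := hmono hn

end InterlacingProduct

section DirichletEigenvalue

/-- The eigenvalues `(π (k + 1))²` of the Dirichlet problem for `-u''` on `[0,1]`. Their inverses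
are the eigenvalues of the covariance operator of the Brownian bridge. -/
noncomputable def dirichletEigenvalue (k : ℕ) : ℝ := (Real.pi * (k + 1)) ^ 2

theorem dirichletEigenvalue_pos (k : ℕ) : 0 < dirichletEigenvalue k := by
  unfold dirichletEigenvalue; positivity

theorem dirichletEigenvalue_strictMono : StrictMono dirichletEigenvalue := by
  intro i j hij
  unfold dirichletEigenvalue
  gcongr

theorem dirichletEigenvalue_two_mul_add_one (k : ℕ) :
    dirichletEigenvalue (2 * k + 1) = 4 * dirichletEigenvalue k := by
  unfold dirichletEigenvalue; push_cast; ring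

theorem hasSum_inv_dirichletEigenvalue : HasSum (fun k => (dirichletEigenvalue k)⁻¹) (1 / 6) := by
  have hzeta := ((hasSum_nat_add_iff' 1).2 hasSum_zeta_two).mul_left (Real.pi ^ 2)⁻¹
  convert! hzeta using 1
  · funext k
    simp only [dirichletEigenvalue, mul_pow, mul_inv, one_div]
    push_cast
    rfl
  · simp only [Finset.range_one, Finset.sum_singleton, Nat.cast_zero, ne_eq, OfNat.ofNat_ne_zero,
      not_false_eq_true, zero_pow, div_zero, sub_zero]
    field_simp

theorem summable_inv_dirichletEigenvalue : Summable fun k => (dirichletEigenvalue k)⁻¹ :=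
  hasSum_inv_dirichletEigenvalue.summable

theorem tendsto_dirichletEigenvalue : Tendsto dirichletEigenvalue atTop atTop := by
  have hinv : Tendsto (fun k => (dirichletEigenvalue k)⁻¹) atTop (𝓝[>] 0) :=
    tendsto_nhdsWithin_iff.2 ⟨summable_inv_dirichletEigenvalue.tendsto_atTop_zero,
      .of_forall fun k => inv_pos.2 (dirichletEigenvalue_pos k)⟩
  exact hinv.inv_tendsto_nhdsGT_zero.congr fun k => inv_inv _

theorem sq_ne_dirichletEigenvalue {t : ℝ} (ht : Real.sin t ≠ 0) (k : ℕ) :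
    t ^ 2 ≠ dirichletEigenvalue k := by
  have hsin : Real.sin (Real.pi * (k + 1)) = 0 := by
    rw [mul_comm]; exact_mod_cast Real.sin_nat_mul_pi (k + 1)
  intro h
  rcases sq_eq_sq_iff_eq_or_eq_neg.1 h with h | h <;> exact ht (by simp [h, hsin])

theorem cot_sub_inv_div_eq_tsum {z : ℂ} (hz : Complex.sin z ≠ 0) :
    (Complex.cos z / Complex.sin z - 1 / z) / (2 * z) =
      ∑' k, 1 / (z ^ 2 - (dirichletEigenvalue k : ℂ)) := by
  have hpi : (Real.pi : ℂ) ≠ 0 := Complex.ofReal_ne_zero.2 Real.pi_ne_zero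
  have hz0 : z ≠ 0 := by rintro rfl; simp at hz
  have hsin : ∀ n : ℤ, z ≠ n * Real.pi := fun n h => hz (Complex.sin_eq_zero_iff.2 ⟨n, h⟩)
  have hx : z / Real.pi ∈ Complex.integerComplement := by
    rintro ⟨n, hn⟩
    exact hsin n ((eq_div_iff hpi).1 hn).symm
  have hcot := cot_series_rep' hx
  rw [mul_div_cancel₀ _ hpi, Complex.cot] at hcot
  have hinv : (Real.pi : ℂ) * (1 / z) = 1 / (z / Real.pi) := by field_simp
  rw [div_eq_iff (by simp [hz0]), ← mul_right_inj' hpi, mul_sub, hinv, hcot, ← tsum_mul_right,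
    ← tsum_mul_left]
  refine tsum_congr fun k => ?_
  have hsub : z - Real.pi * (k + 1) ≠ 0 := fun h =>
    hsin (k + 1) (by push_cast; linear_combination h)
  have hadd : z + Real.pi * (k + 1) ≠ 0 := fun h =>
    hsin (-(k + 1)) (by push_cast; linear_combination h)
  have hfactor : z ^ 2 - (dirichletEigenvalue k : ℂ) =
      (z - Real.pi * (k + 1)) * (z + Real.pi * (k + 1)) := by
    simp only [dirichletEigenvalue]; push_cast; ring
  have hsub' : z / Real.pi - (k + 1) = (z - Real.pi * (k + 1)) / Real.pi := by field_simp
  have hadd' : z / Real.pi + (k + 1) = (z + Real.pi * (k + 1)) / Real.pi := by field_simp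
  rw [hfactor, hsub', hadd']
  field_simp
  ring

theorem tsum_inv_sq_sub_dirichletEigenvalue {t : ℝ} (ht : Real.sin t ≠ 0) :
    ∑' k, 1 / (t ^ 2 - dirichletEigenvalue k) =
      (Real.cos t / Real.sin t - 1 / t) / (2 * t) := by
  exact_mod_cast (cot_sub_inv_div_eq_tsum (z := t) (by exact_mod_cast ht)).symm

theorem tsum_inv_neg_sq_sub_dirichletEigenvalue {y : ℝ} (hy : y ≠ 0) :
    ∑' k, 1 / (-y ^ 2 - dirichletEigenvalue k) =
      -(Real.cosh y / Real.sinh y - 1 / y) / (2 * y) := by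
  have hs : Complex.sinh y ≠ 0 := by
    rw [← Complex.ofReal_sinh]
    exact_mod_cast Real.sinh_ne_zero.2 hy
  have hy' : (y : ℂ) ≠ 0 := by exact_mod_cast hy
  have hcot := cot_sub_inv_div_eq_tsum (z := y * Complex.I) (by
    rw [Complex.sin_mul_I]; exact mul_ne_zero hs Complex.I_ne_zero)
  have hyp : (Complex.cosh y / (Complex.sinh y * Complex.I) - 1 / (y * Complex.I)) /
      (2 * (y * Complex.I)) = -(Complex.cosh y / Complex.sinh y - 1 / y) / (2 * y) := by
    field_simp
    rw [Complex.I_sq]; ring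
  rw [Complex.sin_mul_I, Complex.cos_mul_I, mul_pow, Complex.I_sq, mul_neg_one, hyp] at hcot
  exact_mod_cast hcot.symm

theorem tendsto_prod_one_add_div_dirichletEigenvalue {y : ℝ} (hy : y ≠ 0) :
    Tendsto (fun n => ∏ k ∈ Finset.range n, (1 + y ^ 2 / dirichletEigenvalue k)) atTop
      (𝓝 (Real.sinh y / y)) := by
  have hpi : (Real.pi : ℂ) ≠ 0 := Complex.ofReal_ne_zero.2 Real.pi_ne_zero
  have hyI : (y : ℂ) * Complex.I ≠ 0 := mul_ne_zero (by exact_mod_cast hy) Complex.I_ne_zero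
  have heuler := (Complex.tendsto_euler_sin_prod (y * Complex.I / Real.pi)).div_const
    (y * Complex.I)
  rw [mul_div_cancel₀ _ hpi, Complex.sin_mul_I, mul_div_mul_right _ _ Complex.I_ne_zero,
    ← Complex.ofReal_sinh, ← Complex.ofReal_div] at heuler
  rw [← tendsto_ofReal_iff]
  refine heuler.congr fun n => ?_
  rw [mul_div_cancel_left₀ _ hyI]
  push_cast
  refine Finset.prod_congr rfl fun k _ => ?_
  have hk : (k : ℂ) + 1 ≠ 0 := by exact_mod_cast k.succ_ne_zero
  rw [div_pow, mul_pow, Complex.I_sq]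
  unfold dirichletEigenvalue
  push_cast
  field_simp
  ring

end DirichletEigenvalue

section OUFrequency

variable {β : ℝ}

/-- The characteristic function of the demeaned Ornstein–Uhlenbeck process: its positive zeros `ω`
give the eigenvalues `1 / (ω² + β²)` of the covariance operator. -/
noncomputable def ouCharFun (β ω : ℝ) : ℝ :=
  (ω ^ 2 + β ^ 2) * (Real.sin ω + 2 * β * (1 - Real.cos ω) / ω) -
    β ^ 2 * (ω * Real.cos ω + β * Real.sin ω)

/-- The function `ouCharFun β` on the imaginary axis, normalized so as to be the limit of
`∏ (ω k ^ 2 + y ^ 2) / dirichletEigenvalue k` over the positive zeros `ω k`. -/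
noncomputable def ouDet (β y : ℝ) : ℝ :=
  ((y ^ 2 - β ^ 2) * (Real.sinh y + 2 * β * (Real.cosh y - 1) / y) +
    β ^ 2 * (y * Real.cosh y + β * Real.sinh y)) / y ^ 3

/-- The residues, up to sign, of `ouCharFun β t / (t ^ 2 * sin t)` as a function of `t ^ 2`. -/
noncomputable def ouWeight (β : ℝ) (k : ℕ) : ℝ :=
  2 * β ^ 2 + 4 * β * (1 + (-1) ^ k) * (1 + β ^ 2 * (dirichletEigenvalue k)⁻¹)

theorem ouWeight_pos (hβ : 0 < β) (k : ℕ) : 0 < ouWeight β k := by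
  have hparity : (0 : ℝ) ≤ 1 + (-1) ^ k := by
    rcases neg_one_pow_eq_or ℝ k with h | h <;> simp [h]
  have := inv_pos.2 (dirichletEigenvalue_pos k)
  unfold ouWeight
  positivity

theorem hasSum_one_add_neg_one_pow_mul {f : ℕ → ℝ} (hf : Summable f) :
    HasSum (fun k => (1 + (-1) ^ k) * f k) (2 * (∑' k, f k - ∑' k, f (2 * k + 1))) := by
  have hfe : Summable fun k => f (2 * k) := hf.comp_injective (mul_right_injective₀ two_ne_zero)
  have hfo : Summable fun k => f (2 * k + 1) := hf.comp_injective fun i j h => by simpa using h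
  rw [← tsum_even_add_odd hfe hfo, add_sub_cancel_right]
  have heven : HasSum (fun k => (1 + (-1) ^ (2 * k)) * f (2 * k)) (2 * ∑' k, f (2 * k)) := by
    simpa only [even_two_mul, Even.neg_pow, one_pow, one_add_one_eq_two] using
      hfe.hasSum.mul_left 2
  have hodd : HasSum (fun k => (1 + (-1) ^ (2 * k + 1)) * f (2 * k + 1)) 0 := by
    simpa only [(odd_two_mul_add_one _).neg_one_pow, add_neg_cancel, zero_mul] using
      (hasSum_zero : HasSum (fun _ : ℕ => (0 : ℝ)) 0)
  simpa only [add_zero] using HasSum.even_add_odd (f := fun k => (1 + (-1) ^ k) * f k) heven hodd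

theorem summable_ouWeight_div (β : ℝ) : Summable fun k => ouWeight β k / dirichletEigenvalue k := by
  have hsq : Summable fun k => (dirichletEigenvalue k)⁻¹ * (dirichletEigenvalue k)⁻¹ :=
    summable_inv_dirichletEigenvalue.norm.mul_tendsto_const
      summable_inv_dirichletEigenvalue.tendsto_cofinite_zero
  have hsum := (summable_inv_dirichletEigenvalue.mul_left (2 * β ^ 2)).add
    ((hasSum_one_add_neg_one_pow_mul
      (summable_inv_dirichletEigenvalue.add (hsq.mul_left (β ^ 2)))).summable.mul_left (4 * β))
  refine hsum.congr fun k => ?_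
  unfold ouWeight
  ring

theorem tsum_ouWeight_div {w : ℝ} (hw : w ≠ 0) (hwk : ∀ k, w ≠ dirichletEigenvalue k) :
    ∑' k, ouWeight β k / (w - dirichletEigenvalue k) =
      2 * β ^ 2 * ∑' k, 1 / (w - dirichletEigenvalue k) +
      (4 * β + 4 * β ^ 3 / w) * (2 * (∑' k, 1 / (w - dirichletEigenvalue k) -
        (∑' k, 1 / (w / 4 - dirichletEigenvalue k)) / 4)) + β ^ 3 / w := by
  have hS : Summable fun k => 1 / (w - dirichletEigenvalue k) :=
    summable_div_sub tendsto_dirichletEigenvalue (fun _ => zero_le_one)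
      (by simpa only [one_div] using summable_inv_dirichletEigenvalue) w
  have hpole := hasSum_one_add_neg_one_pow_mul hS
  have hinv := hasSum_one_add_neg_one_pow_mul summable_inv_dirichletEigenvalue
  have hpole_odd : ∑' k, 1 / (w - dirichletEigenvalue (2 * k + 1)) =
      (∑' k, 1 / (w / 4 - dirichletEigenvalue k)) / 4 := by
    rw [← tsum_div_const]
    refine tsum_congr fun k => ?_
    rw [dirichletEigenvalue_two_mul_add_one, div_div]; congr 1; ring
  have hinv_odd : ∑' k, (dirichletEigenvalue (2 * k + 1))⁻¹ = 1 / 24 := by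
    simp_rw [dirichletEigenvalue_two_mul_add_one, mul_inv]
    rw [tsum_mul_left, hasSum_inv_dirichletEigenvalue.tsum_eq]; norm_num
  rw [hpole_odd] at hpole
  rw [hinv_odd, hasSum_inv_dirichletEigenvalue.tsum_eq] at hinv
  have hsum := ((hS.hasSum.mul_left (2 * β ^ 2)).add
    (hpole.mul_left (4 * β + 4 * β ^ 3 / w))).add (hinv.mul_left (4 * β ^ 3 / w))
  rw [show 4 * β ^ 3 / w * (2 * (1 / 6 - 1 / 24)) = β ^ 3 / w by ring] at hsum
  rw [← hsum.tsum_eq]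
  refine tsum_congr fun k => ?_
  have hk := sub_ne_zero.2 (hwk k)
  have hk0 := (dirichletEigenvalue_pos k).ne'
  unfold ouWeight
  field_simp
  ring

theorem one_sub_tsum_ouWeight_div_mul {t : ℝ} (ht : Real.sin t ≠ 0) :
    (1 - ∑' k, ouWeight β k / (t ^ 2 - dirichletEigenvalue k)) * (t ^ 2 * Real.sin t) =
      ouCharFun β t := by
  have ht0 : t ≠ 0 := by rintro rfl; simp at ht
  have hsin : Real.sin t = 2 * Real.sin (t / 2) * Real.cos (t / 2) := by
    rw [← Real.sin_two_mul, mul_div_cancel₀ t two_ne_zero]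
  have hcos : Real.cos t = 2 * Real.cos (t / 2) ^ 2 - 1 := by
    rw [← Real.cos_two_mul, mul_div_cancel₀ t two_ne_zero]
  have hs : Real.sin (t / 2) ≠ 0 := fun h => ht (by simp [hsin, h])
  have hc : Real.cos (t / 2) ≠ 0 := fun h => ht (by simp [hsin, h])
  have hcot : Real.cos (t / 2) / Real.sin (t / 2) = (1 + Real.cos t) / Real.sin t := by
    rw [hsin, hcos]; field_simp; ring
  have hquarter : t ^ 2 / 4 = (t / 2) ^ 2 := by ring
  rw [tsum_ouWeight_div (pow_ne_zero 2 ht0) (sq_ne_dirichletEigenvalue ht), hquarter,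
    tsum_inv_sq_sub_dirichletEigenvalue ht, tsum_inv_sq_sub_dirichletEigenvalue hs, hcot, ouCharFun]
  field_simp
  ring

theorem one_add_tsum_ouWeight_div_mul {y : ℝ} (hy : y ≠ 0) :
    (1 + ∑' k, ouWeight β k / (dirichletEigenvalue k + y ^ 2)) * (Real.sinh y / y) =
      ouDet β y := by
  have hsinh : Real.sinh y = 2 * Real.sinh (y / 2) * Real.cosh (y / 2) := by
    rw [← Real.sinh_two_mul, mul_div_cancel₀ y two_ne_zero]
  have hcosh : Real.cosh y = 2 * Real.cosh (y / 2) ^ 2 - 1 := by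
    have := Real.cosh_two_mul (y / 2)
    rw [Real.sinh_sq, mul_div_cancel₀ _ two_ne_zero] at this
    rw [this]; ring
  have hhalf : y / 2 ≠ 0 := div_ne_zero hy two_ne_zero
  have hs := Real.sinh_ne_zero.2 hhalf
  have hs' := Real.sinh_ne_zero.2 hy
  have hc := (Real.cosh_pos (y / 2)).ne'
  have hcoth : Real.cosh (y / 2) / Real.sinh (y / 2) = (1 + Real.cosh y) / Real.sinh y := by
    rw [hsinh, hcosh]; field_simp; ring
  have hne : ∀ k, -y ^ 2 ≠ dirichletEigenvalue k := fun k =>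
    ((neg_nonpos.2 (sq_nonneg y)).trans_lt (dirichletEigenvalue_pos k)).ne
  have hquarter : -y ^ 2 / 4 = -(y / 2) ^ 2 := by ring
  have hneg : ∑' k, ouWeight β k / (dirichletEigenvalue k + y ^ 2) =
      -∑' k, ouWeight β k / (-y ^ 2 - dirichletEigenvalue k) := by
    rw [← tsum_neg]
    refine tsum_congr fun k => ?_
    rw [← div_neg]; congr 1; ring
  rw [hneg, tsum_ouWeight_div (neg_ne_zero.2 (pow_ne_zero 2 hy)) hne, hquarter,
    tsum_inv_neg_sq_sub_dirichletEigenvalue hy, tsum_inv_neg_sq_sub_dirichletEigenvalue hhalf,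
    hcoth, ouDet]
  field_simp
  ring

/-- One zero of the characteristic function in each gap between consecutive zeros of the sine. These
are all its positive zeros when `0 < β`. -/
structure IsOUFrequencySequence (β : ℝ) (ω : ℕ → ℝ) : Prop where
  mem_Ioo : ∀ k : ℕ, ω k ∈ Set.Ioo (Real.pi * (k + 1)) (Real.pi * (k + 2))
  ouCharFun_eq_zero : ∀ k, ouCharFun β (ω k) = 0

theorem ouCharFun_pi_mul_add_one (β : ℝ) (n : ℕ) :
    ouCharFun β (Real.pi * (n + 1)) = ((Real.pi * (n + 1)) ^ 2 + β ^ 2) *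
      (2 * β * (1 + (-1) ^ n) / (Real.pi * (n + 1))) + β ^ 2 * (Real.pi * (n + 1)) * (-1) ^ n := by
  have hsin : Real.sin (Real.pi * (n + 1)) = 0 := by
    rw [mul_comm]; exact_mod_cast Real.sin_nat_mul_pi (n + 1)
  have hcos : Real.cos (Real.pi * (n + 1)) = -(-1) ^ n := by
    rw [mul_comm, add_mul, one_mul, Real.cos_add_pi, Real.cos_nat_mul_pi]
  rw [ouCharFun, hsin, hcos]; ring

theorem ouCharFun_pi_mul_add_one_pos (hβ : 0 < β) {n : ℕ} (hn : Even n) :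
    0 < ouCharFun β (Real.pi * (n + 1)) := by
  rw [ouCharFun_pi_mul_add_one, hn.neg_one_pow]
  positivity

theorem ouCharFun_pi_mul_add_one_neg (hβ : 0 < β) {n : ℕ} (hn : Odd n) :
    ouCharFun β (Real.pi * (n + 1)) < 0 := by
  have hpos : 0 < β ^ 2 * (Real.pi * (n + 1)) := by positivity
  rw [ouCharFun_pi_mul_add_one, hn.neg_one_pow, add_neg_cancel, mul_zero, zero_div, mul_zero]
  linarith

theorem exists_mem_Ioo_ouCharFun_eq_zero (hβ : 0 < β) (n : ℕ) :
    ∃ t ∈ Set.Ioo (Real.pi * (n + 1)) (Real.pi * (n + 2)), ouCharFun β t = 0 := by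
  have hle : Real.pi * (n + 1) ≤ Real.pi * (n + 2) := by gcongr; norm_num
  have hcont : ContinuousOn (ouCharFun β) (Set.Icc (Real.pi * (n + 1)) (Real.pi * (n + 2))) := by
    unfold ouCharFun
    have hne : ∀ x ∈ Set.Icc (Real.pi * (n + 1)) (Real.pi * (n + 2)), x ≠ 0 := fun x hx =>
      (lt_of_lt_of_le (by positivity) hx.1).ne'
    fun_prop (disch := assumption)
  have hright : Real.pi * ((n : ℝ) + 2) = Real.pi * ((n + 1 : ℕ) + 1) := by push_cast; ring
  rcases Nat.even_or_odd n with h | h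
  · exact intermediate_value_Ioo' hle hcont
      ⟨hright ▸ ouCharFun_pi_mul_add_one_neg hβ h.add_one, ouCharFun_pi_mul_add_one_pos hβ h⟩
  · exact intermediate_value_Ioo hle hcont
      ⟨ouCharFun_pi_mul_add_one_neg hβ h, hright ▸ ouCharFun_pi_mul_add_one_pos hβ h.add_one⟩

theorem exists_isOUFrequencySequence (hβ : 0 < β) : ∃ ω, IsOUFrequencySequence β ω := by
  choose ω hmem hzero using exists_mem_Ioo_ouCharFun_eq_zero hβ
  exact ⟨ω, hmem, hzero⟩

theorem exists_phase_of_ouCharFun_eq_zero {n : ℕ} {t : ℝ} (ht : Real.pi * (n + 1) < t)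
    (h0 : ouCharFun β t = 0) :
    ∃ σ : ℝ, -1 ≤ σ ∧ (t ^ 2 + β ^ 2) * (t * Real.sin (t - Real.pi * (n + 1)) +
        2 * β * (σ - Real.cos (t - Real.pi * (n + 1)))) =
      β ^ 2 * t * (t * Real.cos (t - Real.pi * (n + 1)) +
        β * Real.sin (t - Real.pi * (n + 1))) := by
  have ht0 : t ≠ 0 := (lt_trans (by positivity) ht).ne'
  have hphase : t - Real.pi * (n + 1) = t - (n + 1 : ℕ) * Real.pi := by push_cast; ring
  rw [hphase, Real.sin_sub_nat_mul_pi, Real.cos_sub_nat_mul_pi]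
  rw [ouCharFun] at h0
  field_simp at h0
  rcases neg_one_pow_eq_or ℝ (n + 1) with hσ | hσ <;> rw [hσ]
  · exact ⟨1, by norm_num, by linear_combination h0⟩
  · exact ⟨-1, le_rfl, by linear_combination -h0⟩

theorem cos_nonneg_of_phase_eq (hβ : 0 < β) {t S c σ : ℝ} (ht : 0 < t)
    (hlarge : 16 * β ^ 2 + 2 * β ^ 3 ≤ t ^ 2) (hS : 0 < S) (hSc : S ^ 2 + c ^ 2 = 1) (hσ : -1 ≤ σ)
    (h : (t ^ 2 + β ^ 2) * (t * S + 2 * β * (σ - c)) = β ^ 2 * t * (t * c + β * S)) :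
    0 ≤ c := by
  by_contra! hc
  have ht4 : 4 * β ≤ t := by
    refine le_of_sq_le_sq ?_ ht.le
    nlinarith [pow_pos hβ 3]
  have : S ≤ 1 := by nlinarith
  have hcS : -S ≤ σ - c := by nlinarith
  have hleft : (t ^ 2 + β ^ 2) * (t * S / 2) ≤ (t ^ 2 + β ^ 2) * (t * S + 2 * β * (σ - c)) := by
    gcongr
    nlinarith
  have hright : β ^ 2 * t * (t * c + β * S) < β ^ 3 * (t * S) := by
    have : β ^ 2 * t ^ 2 * c < 0 := mul_neg_of_pos_of_neg (by positivity) hc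
    linarith
  have hdom : β ^ 3 * (t * S) ≤ (t ^ 2 + β ^ 2) * (t * S / 2) := by
    have : 0 < t * S := by positivity
    nlinarith
  linarith

theorem mul_sin_le_of_phase_eq (hβ : 0 < β) {t S c σ : ℝ} (ht : 0 < t)
    (hlarge : 16 * β ^ 2 + 2 * β ^ 3 ≤ t ^ 2) (hS : 0 < S) (hSc : S ^ 2 + c ^ 2 = 1) (hσ : -1 ≤ σ)
    (h : (t ^ 2 + β ^ 2) * (t * S + 2 * β * (σ - c)) = β ^ 2 * t * (t * c + β * S)) :
    t * S ≤ 2 * β ^ 2 + 16 * β := by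
  have hc1 : c ≤ 1 := by nlinarith
  have := pow_pos hβ 3
  have : 0 < t * S := by positivity
  have hbound : t * S * (t ^ 2 + β ^ 2 - β ^ 3) ≤ β ^ 2 * t ^ 2 + 4 * β * (t ^ 2 + β ^ 2) := by
    have h1 : β ^ 2 * t ^ 2 * c ≤ β ^ 2 * t ^ 2 * 1 := by gcongr
    have h2 : (t ^ 2 + β ^ 2) * (2 * β * (-2)) ≤ (t ^ 2 + β ^ 2) * (2 * β * (σ - c)) := by
      gcongr
      linarith
    linarith
  have hhalf : t * S * (t ^ 2 / 2) ≤ t * S * (t ^ 2 + β ^ 2 - β ^ 3) := by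
    gcongr
    nlinarith
  have hβt : β ^ 2 ≤ t ^ 2 := by nlinarith
  have hβt' : 4 * β * β ^ 2 ≤ 4 * β * t ^ 2 := by gcongr
  have ht2 : 0 < t ^ 2 / 2 := by positivity
  refine le_of_mul_le_mul_right ?_ ht2
  linarith

/-- For large `t = π (n + 1) + θ` the terms of the characteristic function cannot cancel unless
`θ ≤ π / 2`, and then `t * sin θ` is bounded. -/
theorem sq_sub_dirichletEigenvalue_le (hβ : 0 < β) {n : ℕ} {t : ℝ}
    (ht : t ∈ Set.Ioo (Real.pi * (n + 1)) (Real.pi * (n + 2))) (h0 : ouCharFun β t = 0) :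
    t ^ 2 - dirichletEigenvalue n ≤
      16 * β ^ 2 + 2 * β ^ 3 + Real.pi * (2 * β ^ 2 + 16 * β) := by
  have ht0 : 0 < t := lt_trans (by positivity) ht.1
  rcases le_total (t ^ 2) (16 * β ^ 2 + 2 * β ^ 3) with hsmall | hlarge
  · have : 0 ≤ Real.pi * (2 * β ^ 2 + 16 * β) := by positivity
    linarith [dirichletEigenvalue_pos n]
  obtain ⟨σ, hσ, hphase⟩ := exists_phase_of_ouCharFun_eq_zero ht.1 h0
  set θ := t - Real.pi * (n + 1) with hθ
  have hθ0 : 0 < θ := by linarith [ht.1]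
  have hS : 0 < Real.sin θ := Real.sin_pos_of_pos_of_lt_pi hθ0 (by linarith [ht.2])
  have hsq := Real.sin_sq_add_cos_sq θ
  have hθ2 : θ ≤ Real.pi / 2 := by
    by_contra! h
    exact (Real.cos_neg_of_pi_div_two_lt_of_lt h (by linarith [ht.2])).not_ge
      (cos_nonneg_of_phase_eq hβ ht0 hlarge hS hsq hσ hphase)
  have hθt : θ ≤ t := sub_le_self t (by positivity)
  have hjordan := Real.mul_le_sin hθ0.le hθ2
  have hθS : θ ≤ Real.pi / 2 * Real.sin θ := by
    have := mul_le_mul_of_nonneg_left hjordan (by positivity : 0 ≤ Real.pi / 2)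
    field_simp at this ⊢
    linarith
  calc t ^ 2 - dirichletEigenvalue n = θ * (2 * t - θ) := by rw [dirichletEigenvalue, hθ]; ring
    _ ≤ Real.pi / 2 * Real.sin θ * (2 * t) := by gcongr <;> linarith
    _ = Real.pi * (t * Real.sin θ) := by ring
    _ ≤ Real.pi * (2 * β ^ 2 + 16 * β) := by
        gcongr
        exact mul_sin_le_of_phase_eq hβ ht0 hlarge hS hsq hσ hphase
    _ ≤ _ := le_add_of_nonneg_left (by positivity)

namespace IsOUFrequencySequence

variable {ω : ℕ → ℝ}

theorem pos (hω : IsOUFrequencySequence β ω) (k : ℕ) : 0 < ω k :=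
  lt_trans (by positivity) (hω.mem_Ioo k).1

theorem strictMono (hω : IsOUFrequencySequence β ω) : StrictMono ω :=
  strictMono_nat_of_lt_succ fun k => (hω.mem_Ioo k).2.trans <| by
    simpa [add_assoc, one_add_one_eq_two] using (hω.mem_Ioo (k + 1)).1

theorem sin_ne_zero (hω : IsOUFrequencySequence β ω) (k : ℕ) : Real.sin (ω k) ≠ 0 := by
  have hpos : 0 < Real.sin (ω k - (k + 1 : ℕ) * Real.pi) := by
    have := hω.mem_Ioo k
    apply Real.sin_pos_of_pos_of_lt_pi <;> push_cast <;> linarith [this.1, this.2]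
  rw [Real.sin_sub_nat_mul_pi] at hpos
  exact right_ne_zero_of_mul hpos.ne'

theorem sq_mem_Ioo (hω : IsOUFrequencySequence β ω) (k : ℕ) :
    ω k ^ 2 ∈ Set.Ioo (dirichletEigenvalue k) (dirichletEigenvalue (k + 1)) := by
  refine ⟨pow_lt_pow_left₀ (hω.mem_Ioo k).1 (by positivity) two_ne_zero,
    pow_lt_pow_left₀ ?_ (hω.pos k).le two_ne_zero⟩
  simpa [add_assoc, one_add_one_eq_two] using (hω.mem_Ioo k).2

theorem tsum_ouWeight_div_eq_one (hω : IsOUFrequencySequence β ω) (k : ℕ) :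
    ∑' j, ouWeight β j / (ω k ^ 2 - dirichletEigenvalue j) = 1 := by
  have hzero := one_sub_tsum_ouWeight_div_mul (β := β) (hω.sin_ne_zero k)
  rw [hω.ouCharFun_eq_zero k] at hzero
  exact (sub_eq_zero.1 ((mul_eq_zero.1 hzero).resolve_right
    (mul_ne_zero (pow_ne_zero 2 (hω.pos k).ne') (hω.sin_ne_zero k)))).symm

theorem tendsto_prod (hω : IsOUFrequencySequence β ω) (hβ : 0 < β) {y : ℝ} (hy : y ≠ 0) :
    Tendsto (fun n => ∏ k ∈ Finset.range n, (ω k ^ 2 + y ^ 2) / dirichletEigenvalue k) atTop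
      (𝓝 (ouDet β y)) := by
  have hratio := tendsto_prod_add_div dirichletEigenvalue_strictMono dirichletEigenvalue_pos
    tendsto_dirichletEigenvalue (ouWeight_pos hβ) (summable_ouWeight_div β) hω.sq_mem_Ioo
    hω.tsum_ouWeight_div_eq_one (sq_nonneg y)
  have hprod := hratio.mul (tendsto_prod_one_add_div_dirichletEigenvalue hy)
  rw [one_add_tsum_ouWeight_div_mul hy] at hprod
  refine hprod.congr fun n => ?_
  rw [← Finset.prod_mul_distrib]
  refine Finset.prod_congr rfl fun k _ => ?_
  have := dirichletEigenvalue_pos k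
  field_simp

theorem summable_inv_sq_add_sq (hω : IsOUFrequencySequence β ω) :
    Summable fun k => (ω k ^ 2 + β ^ 2)⁻¹ :=
  summable_inv_dirichletEigenvalue.of_nonneg_of_le (fun k => by positivity) fun k =>
    inv_anti₀ (dirichletEigenvalue_pos k)
      ((hω.sq_mem_Ioo k).1.le.trans (le_add_of_nonneg_right (sq_nonneg β)))

theorem abs_sq_add_sq_sub_dirichletEigenvalue_le (hω : IsOUFrequencySequence β ω) (hβ : 0 < β)
    (k : ℕ) : |ω k ^ 2 + β ^ 2 - dirichletEigenvalue k| ≤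
      17 * β ^ 2 + 2 * β ^ 3 + Real.pi * (2 * β ^ 2 + 16 * β) := by
  have hle := sq_sub_dirichletEigenvalue_le hβ (hω.mem_Ioo k) (hω.ouCharFun_eq_zero k)
  rw [abs_of_nonneg (by linarith [(hω.sq_mem_Ioo k).1, sq_nonneg β])]
  linarith

end IsOUFrequencySequence

end OUFrequency

section Trace

variable {β : ℝ}

/-- The trace of the covariance operator of the demeaned Ornstein–Uhlenbeck process. -/
noncomputable def ouTrace (β : ℝ) : ℝ :=
  1 / (2 * β) * (1 - (1 - Real.exp (-(2 * β))) / (2 * β) -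
    (2 / β - 2 * (1 - Real.exp (-β)) / β ^ 2 - (1 - Real.exp (-β)) ^ 2 / β ^ 2))

theorem exp_neg_two_mul (x : ℝ) : Real.exp (-(2 * x)) = Real.exp (-x) ^ 2 := by
  rw [← Real.exp_nat_mul]; congr 1; push_cast; ring

theorem ouDet_self (hβ : β ≠ 0) : ouDet β β = Real.exp β := by
  rw [ouDet, ← Real.cosh_add_sinh]
  field_simp
  ring

theorem hasDerivAt_ouDet (hβ : β ≠ 0) :
    HasDerivAt (ouDet β) (Real.exp β * (2 * β * ouTrace β)) β := by
  have hsq : HasDerivAt (fun y : ℝ => y ^ 2 - β ^ 2) (2 * β) β := by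
    simpa using (hasDerivAt_pow 2 β).sub_const (β ^ 2)
  have hquot := (((Real.hasDerivAt_cosh β).sub_const 1).const_mul (2 * β)).div (hasDerivAt_id β) hβ
  have hleft := hsq.mul ((Real.hasDerivAt_sinh β).add hquot)
  have hright := (((hasDerivAt_id β).mul (Real.hasDerivAt_cosh β)).add
    ((Real.hasDerivAt_sinh β).const_mul β)).const_mul (β ^ 2)
  refine ((hleft.add hright).div (hasDerivAt_pow 3 β) (pow_ne_zero 3 hβ)).congr_deriv ?_
  simp only [Pi.add_apply, Pi.mul_apply, Pi.div_apply, id, Real.cosh_eq, Real.sinh_eq]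
  rw [ouTrace, exp_neg_two_mul, Real.exp_neg]
  have := (Real.exp_pos β).ne'
  field_simp
  ring

theorem IsOUFrequencySequence.ouDet_le_exp_mul {ω : ℕ → ℝ} (hω : IsOUFrequencySequence β ω)
    (hβ : 0 < β) {y : ℝ} (hy : β ≤ y) :
    ouDet β y ≤ Real.exp β * Real.exp ((y ^ 2 - β ^ 2) * ∑' k, (ω k ^ 2 + β ^ 2)⁻¹) := by
  have hself := hω.tendsto_prod hβ hβ.ne'
  rw [ouDet_self hβ.ne'] at hself
  refine le_of_tendsto_of_tendsto' (hω.tendsto_prod hβ (hβ.trans_le hy).ne')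
    (hself.mul_const (Real.exp ((y ^ 2 - β ^ 2) * ∑' k, (ω k ^ 2 + β ^ 2)⁻¹))) fun n => ?_
  have hyβ : 0 ≤ y ^ 2 - β ^ 2 := sub_nonneg.2 (by gcongr)
  have hfactor : ∀ k, (ω k ^ 2 + y ^ 2) / dirichletEigenvalue k =
      (ω k ^ 2 + β ^ 2) / dirichletEigenvalue k *
        (1 + (y ^ 2 - β ^ 2) * (ω k ^ 2 + β ^ 2)⁻¹) := by
    intro k
    have := dirichletEigenvalue_pos k
    field_simp
    ring
  simp_rw [hfactor]
  rw [Finset.prod_mul_distrib]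
  refine mul_le_mul_of_nonneg_left ?_ (Finset.prod_nonneg fun k _ =>
    div_nonneg (by positivity) (dirichletEigenvalue_pos k).le)
  refine (Real.prod_one_add_le_exp_sum _ fun k => by positivity).trans ?_
  rw [← Finset.mul_sum]
  gcongr
  exact hω.summable_inv_sq_add_sq.sum_le_tsum _ fun k _ => by positivity

/-- `ouDet β y` is at most `exp β * exp ((y² - β²) ∑ (ω k² + β²)⁻¹)` for `β ≤ y`, with equality at
`y = β`; compare the derivatives there. -/
theorem IsOUFrequencySequence.ouTrace_le_tsum {ω : ℕ → ℝ} (hω : IsOUFrequencySequence β ω)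
    (hβ : 0 < β) : ouTrace β ≤ ∑' k, (ω k ^ 2 + β ^ 2)⁻¹ := by
  set S := ∑' k, (ω k ^ 2 + β ^ 2)⁻¹
  have hexponent : HasDerivAt (fun y : ℝ => (y ^ 2 - β ^ 2) * S) (2 * β * S) β := by
    simpa using ((hasDerivAt_pow 2 β).sub_const (β ^ 2)).mul_const S
  have hdiff := (hexponent.exp.const_mul (Real.exp β)).sub (hasDerivAt_ouDet hβ.ne')
  have hmin : IsMinOn (fun y => Real.exp β * Real.exp ((y ^ 2 - β ^ 2) * S) - ouDet β y)
      (Set.Ici β) β := fun y hy => by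
    simpa [ouDet_self hβ.ne'] using hω.ouDet_le_exp_mul hβ hy
  have hderiv := hmin.localize.hasFDerivWithinAt_nonneg hdiff.hasFDerivAt.hasFDerivWithinAt
    (mem_posTangentConeAt_of_segment_subset (y := (1 : ℝ)) (by
      rw [segment_eq_Icc (by linarith)]; exact Set.Icc_subset_Ici_self))
  have hpos : 0 < Real.exp β * (2 * β) := by positivity
  have hmul : 0 ≤ Real.exp β * (2 * β) * (S - ouTrace β) := by
    simp only [sub_self, zero_mul, Real.exp_zero, one_mul,
      ContinuousLinearMap.toSpanSingleton_apply, smul_eq_mul] at hderiv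
    linarith
  linarith [nonneg_of_mul_nonneg_right hmul hpos]

end Trace

section GreenFunction

variable {v v' v'' : ℝ → ℝ}

theorem integral_unitInterval (f : ℝ → ℝ) :
    ∫ t : unitInterval, f t = ∫ t in (0 : ℝ)..1, f t := by
  rw [intervalIntegral.integral_of_le zero_le_one, ← integral_Icc_eq_integral_Ioc]
  exact integral_subtype_comap measurableSet_Icc f

theorem hasDerivAt_sin_mul (c s : ℝ) :
    HasDerivAt (fun s => Real.sin (c * s)) (c * Real.cos (c * s)) s := by
  simpa [mul_comm] using ((hasDerivAt_id s).const_mul c).sin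

theorem hasDerivAt_cos_mul (c s : ℝ) :
    HasDerivAt (fun s => Real.cos (c * s)) (-(c * Real.sin (c * s))) s := by
  simpa [mul_comm] using ((hasDerivAt_id s).const_mul c).cos

theorem hasDerivAt_sinh_mul (c s : ℝ) :
    HasDerivAt (fun s => Real.sinh (c * s)) (c * Real.cosh (c * s)) s := by
  simpa [mul_comm] using ((hasDerivAt_id s).const_mul c).sinh

theorem hasDerivAt_cosh_mul (c s : ℝ) :
    HasDerivAt (fun s => Real.cosh (c * s)) (c * Real.sinh (c * s)) s := by
  simpa [mul_comm] using ((hasDerivAt_id s).const_mul c).cosh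

theorem hasDerivAt_exp_mul (c s : ℝ) :
    HasDerivAt (fun s => Real.exp (c * s)) (c * Real.exp (c * s)) s := by
  simpa [mul_comm] using ((hasDerivAt_id s).const_mul c).exp

theorem integral_mul_sub_deriv_two {k k' : ℝ → ℝ} {q : ℝ}
    (hk : ∀ s, HasDerivAt k (k' s) s) (hk' : ∀ s, HasDerivAt k' (q * k s) s)
    (hv : ∀ s, HasDerivAt v (v' s) s) (hv' : ∀ s, HasDerivAt v' (v'' s) s)
    (hv'' : Continuous v'') (a b : ℝ) :
    ∫ s in a..b, k s * (q * v s - v'' s) =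
      (k' b * v b - k b * v' b) - (k' a * v a - k a * v' a) := by
  have hkc : Continuous k := continuous_iff_continuousAt.2 fun s => (hk s).continuousAt
  have hvc : Continuous v := continuous_iff_continuousAt.2 fun s => (hv s).continuousAt
  refine intervalIntegral.integral_eq_sub_of_hasDerivAt
    (f := fun s => k' s * v s - k s * v' s) (fun s _ => ?_)
    (Continuous.intervalIntegrable (by fun_prop) _ _)
  refine (((hk' s).mul (hv s)).sub ((hk s).mul (hv' s))).congr_deriv ?_
  ring

/-- Green's formula for a kernel `K` whose derivative jumps by `-1` at `t`. -/
theorem integral_mul_sub_deriv_two_of_jump {K k₁ k₁' k₂ k₂' : ℝ → ℝ} {q t : ℝ}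
    (ht : t ∈ unitInterval) (hK₁ : ∀ s ≤ t, K s = k₁ s) (hK₂ : ∀ s, t ≤ s → K s = k₂ s)
    (hk₁ : ∀ s, HasDerivAt k₁ (k₁' s) s) (hk₁' : ∀ s, HasDerivAt k₁' (q * k₁ s) s)
    (hk₂ : ∀ s, HasDerivAt k₂ (k₂' s) s) (hk₂' : ∀ s, HasDerivAt k₂' (q * k₂ s) s)
    (hjump : k₁' t - k₂' t = 1)
    (hv : ∀ s, HasDerivAt v (v' s) s) (hv' : ∀ s, HasDerivAt v' (v'' s) s)
    (hv'' : Continuous v'') :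
    ∫ s : unitInterval, K s * (q * v s - v'' s) =
      v t + (k₂' 1 * v 1 - k₂ 1 * v' 1) - (k₁' 0 * v 0 - k₁ 0 * v' 0) := by
  have hvc : Continuous v := continuous_iff_continuousAt.2 fun s => (hv s).continuousAt
  have hk₁c : Continuous k₁ := continuous_iff_continuousAt.2 fun s => (hk₁ s).continuousAt
  have hk₂c : Continuous k₂ := continuous_iff_continuousAt.2 fun s => (hk₂ s).continuousAt
  have hk : k₁ t = k₂ t := (hK₁ t le_rfl).symm.trans (hK₂ t le_rfl)
  have heq₁ : Set.EqOn (fun s => k₁ s * (q * v s - v'' s)) (fun s => K s * (q * v s - v'' s))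
      (Set.uIcc 0 t) := fun s hs => by
    rw [Set.uIcc_of_le ht.1] at hs
    simp only [hK₁ s hs.2]
  have heq₂ : Set.EqOn (fun s => k₂ s * (q * v s - v'' s)) (fun s => K s * (q * v s - v'' s))
      (Set.uIcc t 1) := fun s hs => by
    rw [Set.uIcc_of_le ht.2] at hs
    simp only [hK₂ s hs.1]
  have h_int₁ : IntervalIntegrable (fun s => K s * (q * v s - v'' s)) volume 0 t :=
    (Continuous.intervalIntegrable (by fun_prop) _ _).congr (heq₁.mono Set.uIoc_subset_uIcc)
  have h_int₂ : IntervalIntegrable (fun s => K s * (q * v s - v'' s)) volume t 1 :=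
    (Continuous.intervalIntegrable (by fun_prop) _ _).congr (heq₂.mono Set.uIoc_subset_uIcc)
  rw [integral_unitInterval fun s => K s * (q * v s - v'' s),
    ← intervalIntegral.integral_add_adjacent_intervals h_int₁ h_int₂,
    ← intervalIntegral.integral_congr heq₁, ← intervalIntegral.integral_congr heq₂,
    integral_mul_sub_deriv_two hk₁ hk₁' hv hv' hv'',
    integral_mul_sub_deriv_two hk₂ hk₂' hv hv' hv'']
  linear_combination v t * hjump - v' t * hk

theorem integral_ouZeroKernel_mul {β : ℝ} (hβ : β ≠ 0)
    (hv : ∀ s, HasDerivAt v (v' s) s) (hv' : ∀ s, HasDerivAt v' (v'' s) s)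
    (hv'' : Continuous v'') (h0 : v 0 = 0) (h1 : v' 1 + β * v 1 = 0) (t : unitInterval) :
    ∫ s : unitInterval, ouZeroKernel β t s * (β ^ 2 * v s - v'' s) = v t := by
  obtain ⟨t, ht⟩ := t
  simp only [ouZeroKernel]
  rw [integral_mul_sub_deriv_two_of_jump (v' := v') ht
    (K := fun s => 1 / (2 * β) * (Real.exp (-β * |t - s|) - Real.exp (-β * (t + s))))
    (k₁ := fun s => Real.exp (-(β * t)) * Real.sinh (β * s) / β)
    (k₁' := fun s => Real.exp (-(β * t)) * Real.cosh (β * s))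
    (k₂ := fun s => Real.sinh (β * t) * Real.exp (-β * s) / β)
    (k₂' := fun s => -(Real.sinh (β * t) * Real.exp (-β * s)))
    (fun s hs => ?_) (fun s hs => ?_)
    (fun s => (((hasDerivAt_sinh_mul β s).const_mul _).div_const β).congr_deriv (by field_simp))
    (fun s => ((hasDerivAt_cosh_mul β s).const_mul _).congr_deriv (by field_simp))
    (fun s => (((hasDerivAt_exp_mul (-β) s).const_mul _).div_const β).congr_deriv
      (by field_simp))
    (fun s => ((hasDerivAt_exp_mul (-β) s).const_mul _).neg.congr_deriv (by field_simp))
    ?_ hv hv' hv'', h0, eq_neg_of_add_eq_zero_left h1]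
  · simp only [mul_zero, Real.sinh_zero, zero_div, zero_mul, sub_zero]
    field_simp
    ring
  · rw [sub_neg_eq_add, neg_mul, mul_comm (Real.sinh _), ← mul_add, Real.cosh_add_sinh,
      ← Real.exp_add, neg_add_cancel, Real.exp_zero]
  · rw [abs_of_nonneg (sub_nonneg.2 hs), Real.sinh_eq]
    field_simp
    simp only [mul_sub, ← Real.exp_add]
    ring_nf
  · rw [abs_of_nonpos (sub_nonpos.2 hs), Real.sinh_eq]
    field_simp
    simp only [sub_mul, ← Real.exp_add]
    ring_nf

theorem integral_bridgeKernel_mul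
    (hv : ∀ s, HasDerivAt v (v' s) s) (hv' : ∀ s, HasDerivAt v' (v'' s) s)
    (hv'' : Continuous v'') (h0 : v 0 = 0) (h1 : v 1 = 0) (t : unitInterval) :
    ∫ s : unitInterval, bridgeKernel t s * -v'' s = v t := by
  obtain ⟨t, ht⟩ := t
  have hgreen := integral_mul_sub_deriv_two_of_jump (q := 0) ht (K := fun s => min t s - t * s)
    (k₁ := fun s => (1 - t) * s) (k₁' := fun _ => 1 - t)
    (k₂ := fun s => t + -t * s) (k₂' := fun _ => -t)
    (fun s hs => by rw [min_eq_right hs]; ring) (fun s hs => by rw [min_eq_left hs]; ring)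
    (fun s => ((hasDerivAt_id s).const_mul (1 - t)).congr_deriv (mul_one _))
    (fun s => (hasDerivAt_const _ _).congr_deriv (zero_mul _).symm)
    (fun s => (((hasDerivAt_id s).const_mul (-t)).const_add t).congr_deriv (mul_one _))
    (fun s => (hasDerivAt_const _ _).congr_deriv (zero_mul _).symm)
    (by ring) hv hv' hv''
  simp only [h0, h1, zero_mul, zero_sub] at hgreen
  simp only [bridgeKernel]
  rw [hgreen]
  ring

theorem integral_bridgeKernel_mul_sin (k : ℕ) (t : unitInterval) :
    ∫ s : unitInterval, bridgeKernel t s * Real.sin (Real.pi * (k + 1) * s) =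
      (dirichletEigenvalue k)⁻¹ * Real.sin (Real.pi * (k + 1) * t) := by
  have hsin : Real.sin (Real.pi * (k + 1)) = 0 := by
    rw [mul_comm]; exact_mod_cast Real.sin_nat_mul_pi (k + 1)
  have hgreen := integral_bridgeKernel_mul
    (fun s => (hasDerivAt_sin_mul (Real.pi * (k + 1)) s).const_mul (dirichletEigenvalue k)⁻¹)
    (fun s => ((hasDerivAt_cos_mul (Real.pi * (k + 1)) s).const_mul (Real.pi * (k + 1))).const_mul
      (dirichletEigenvalue k)⁻¹)
    (by fun_prop) (by simp) (by simp [hsin]) t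
  rw [← hgreen]
  refine integral_congr_ae (.of_forall fun s => ?_)
  simp only [dirichletEigenvalue]
  field_simp

theorem integral_bridgeKernel_diag : ∫ t : unitInterval, bridgeKernel t t = 1 / 6 := by
  simp only [bridgeKernel, min_self]
  rw [integral_unitInterval fun t => t - t * t]
  simp_rw [← sq]
  rw [intervalIntegral.integral_sub intervalIntegral.intervalIntegrable_id
    (intervalIntegral.intervalIntegrable_pow 2), integral_id, integral_pow]
  norm_num

end GreenFunction

section CenterKernel

variable {K : unitInterval → unitInterval → ℝ}

theorem integrable_of_continuous {X : Type*} [TopologicalSpace X] [CompactSpace X]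
    [MeasurableSpace X] [OpensMeasurableSpace X] {μ : Measure X} [IsFiniteMeasureOnCompacts μ]
    {f : X → ℝ} (hf : Continuous f) : Integrable f μ :=
  hf.integrable_of_hasCompactSupport (.of_compactSpace f)

theorem continuous_integral_right
    (hK : Continuous fun p : unitInterval × unitInterval => K p.1 p.2) :
    Continuous fun t => ∫ s, K t s := by
  simpa only [setIntegral_univ] using
    continuous_parametric_integral_of_continuous (μ := volume) hK (s := Set.univ) isCompact_univ

/-- Covariance function of the demeaned process in terms of that of the process. -/
noncomputable def centerKernel (K : unitInterval → unitInterval → ℝ) (t s : unitInterval) : ℝ :=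
  K t s - (∫ r, K t r) - (∫ r, K s r) + ∫ r, ∫ q, K r q

theorem continuous_centerKernel
    (hK : Continuous fun p : unitInterval × unitInterval => K p.1 p.2) :
    Continuous fun p : unitInterval × unitInterval => centerKernel K p.1 p.2 := by
  have h_int := continuous_integral_right hK
  exact ((hK.sub (h_int.comp continuous_fst)).sub (h_int.comp continuous_snd)).add continuous_const

theorem integral_centerKernel_diag
    (hK : Continuous fun p : unitInterval × unitInterval => K p.1 p.2) :
    ∫ t, centerKernel K t t = (∫ t, K t t) - ∫ t, ∫ s, K t s := by
  have h_int := continuous_integral_right hK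
  have : Continuous fun t => K t t := hK.comp (by fun_prop : Continuous fun t => (t, t))
  simp only [centerKernel]
  rw [integral_add, integral_sub, integral_sub, integral_const, probReal_univ, one_smul]
  · ring
  all_goals exact integrable_of_continuous (by fun_prop)

theorem integral_integral_mul_of_eigen
    (hK : Continuous fun p : unitInterval × unitInterval => K p.1 p.2)
    (hsymm : ∀ t s, K t s = K s t) {u : unitInterval → ℝ} (hu : Continuous u)
    (hu0 : ∫ t, u t = 0) {m c : ℝ} (hKu : ∀ t, ∫ s, K t s * u s = m * u t + c) :
    ∫ s, (∫ r, K s r) * u s = c := by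
  calc ∫ s, (∫ r, K s r) * u s = ∫ s, ∫ r, K s r * u s := by simp_rw [integral_mul_const]
    _ = ∫ r, ∫ s, K r s * u s := by
        rw [integral_integral_swap (integrable_of_continuous
          (by unfold Function.uncurry; fun_prop))]
        simp_rw [hsymm]
    _ = c := by
        simp_rw [hKu]
        rw [integral_add ((integrable_of_continuous hu).const_mul m) (integrable_const c),
          integral_const_mul, hu0, integral_const, probReal_univ, mul_zero, zero_add, one_smul]

theorem integral_centerKernel_mul
    (hK : Continuous fun p : unitInterval × unitInterval => K p.1 p.2)
    (hsymm : ∀ t s, K t s = K s t) {u : unitInterval → ℝ} (hu : Continuous u)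
    (hu0 : ∫ t, u t = 0) {m c : ℝ} (hKu : ∀ t, ∫ s, K t s * u s = m * u t + c)
    (t : unitInterval) :
    ∫ s, centerKernel K t s * u s = m * u t := by
  have h_int := continuous_integral_right hK
  have hKt : Continuous fun s => K t s := hK.comp (by fun_prop : Continuous fun s => (t, s))
  have hexpand : ∀ s, centerKernel K t s * u s = K t s * u s - (∫ r, K t r) * u s -
      (∫ r, K s r) * u s + (∫ r, ∫ q, K r q) * u s := fun s => by
    unfold centerKernel; ring
  simp_rw [hexpand]
  rw [integral_add, integral_sub, integral_sub, integral_const_mul, integral_const_mul, hu0, hKu,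
    integral_integral_mul_of_eigen hK hsymm hu hu0 hKu]
  · ring
  all_goals exact integrable_of_continuous (by fun_prop)

theorem continuous_ouZeroKernel (β : ℝ) :
    Continuous fun p : unitInterval × unitInterval => ouZeroKernel β p.1 p.2 := by
  unfold ouZeroKernel; fun_prop

theorem continuous_bridgeKernel :
    Continuous fun p : unitInterval × unitInterval => bridgeKernel p.1 p.2 := by
  unfold bridgeKernel; fun_prop

theorem ouZeroKernel_comm (β : ℝ) (t s : unitInterval) :
    ouZeroKernel β t s = ouZeroKernel β s t := by
  unfold ouZeroKernel; rw [abs_sub_comm, add_comm (t : ℝ)]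

end CenterKernel

section OUEigenfunction

variable {β ω : ℝ}

/-- The solution of `u'' = -ω² (u + β² (1 - cos ω))`, up to scaling, which has zero mean; when
`ouCharFun β ω = 0` it is an eigenfunction of the covariance operator of the demeaned
Ornstein–Uhlenbeck process. -/
noncomputable def ouEigenfunction (β ω t : ℝ) : ℝ :=
  (1 - Real.cos ω) * (ω ^ 2 + β ^ 2) * Real.cos (ω * t) +
    (β ^ 2 * ω - (ω ^ 2 + β ^ 2) * Real.sin ω) * Real.sin (ω * t) - β ^ 2 * (1 - Real.cos ω)

theorem continuous_ouEigenfunction (β ω : ℝ) : Continuous (ouEigenfunction β ω) := by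
  unfold ouEigenfunction; fun_prop

theorem ouEigenfunction_zero (β ω : ℝ) : ouEigenfunction β ω 0 = ω ^ 2 * (1 - Real.cos ω) := by
  simp only [ouEigenfunction, mul_zero, Real.cos_zero, Real.sin_zero]; ring

theorem hasDerivAt_ouEigenfunction (β ω t : ℝ) :
    HasDerivAt (ouEigenfunction β ω)
      (ω * ((β ^ 2 * ω - (ω ^ 2 + β ^ 2) * Real.sin ω) * Real.cos (ω * t) -
        (1 - Real.cos ω) * (ω ^ 2 + β ^ 2) * Real.sin (ω * t))) t := by
  refine ((((hasDerivAt_cos_mul ω t).const_mul _).add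
    ((hasDerivAt_sin_mul ω t).const_mul _)).sub_const _).congr_deriv ?_
  ring

theorem hasDerivAt_deriv_ouEigenfunction (β ω t : ℝ) :
    HasDerivAt (fun t => ω * ((β ^ 2 * ω - (ω ^ 2 + β ^ 2) * Real.sin ω) * Real.cos (ω * t) -
        (1 - Real.cos ω) * (ω ^ 2 + β ^ 2) * Real.sin (ω * t)))
      (-ω ^ 2 * (ouEigenfunction β ω t + β ^ 2 * (1 - Real.cos ω))) t := by
  refine ((((hasDerivAt_cos_mul ω t).const_mul _).sub
    ((hasDerivAt_sin_mul ω t).const_mul _)).const_mul ω).congr_deriv ?_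
  unfold ouEigenfunction
  ring

theorem integral_ouEigenfunction (hω : ω ≠ 0) :
    ∫ t : unitInterval, ouEigenfunction β ω t = 0 := by
  rw [integral_unitInterval, intervalIntegral.integral_eq_sub_of_hasDerivAt
    (f := fun t => (1 - Real.cos ω) * (ω ^ 2 + β ^ 2) / ω * Real.sin (ω * t) -
      (β ^ 2 * ω - (ω ^ 2 + β ^ 2) * Real.sin ω) / ω * Real.cos (ω * t) -
      β ^ 2 * (1 - Real.cos ω) * t) (fun t _ => ?_)
    ((continuous_ouEigenfunction β ω).intervalIntegrable _ _)]
  · simp only [mul_one, mul_zero, Real.sin_zero, Real.cos_zero]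
    field_simp
    ring
  · refine ((((hasDerivAt_sin_mul ω t).const_mul _).sub
      ((hasDerivAt_cos_mul ω t).const_mul _)).sub ((hasDerivAt_id t).const_mul _)).congr_deriv ?_
    unfold ouEigenfunction
    field_simp
    ring

theorem ouEigenfunction_robin (hω : ω ≠ 0) (hF : ouCharFun β ω = 0) :
    ω * ((β ^ 2 * ω - (ω ^ 2 + β ^ 2) * Real.sin ω) * Real.cos ω -
        (1 - Real.cos ω) * (ω ^ 2 + β ^ 2) * Real.sin ω) +
      β * (ouEigenfunction β ω 1 - ω ^ 2 * (1 - Real.cos ω)) = 0 := by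
  simp only [ouEigenfunction, mul_one]
  rw [ouCharFun] at hF
  field_simp at hF
  linear_combination -(1 : ℝ) * hF - (ω ^ 2 + β ^ 2) * β * Real.sin_sq_add_cos_sq ω

theorem integral_ouZeroKernel_mul_ouEigenfunction (hβ : β ≠ 0) (hω : ω ≠ 0)
    (hF : ouCharFun β ω = 0) (t : unitInterval) :
    ∫ s : unitInterval, ouZeroKernel β t s * ouEigenfunction β ω s =
      (ω ^ 2 + β ^ 2)⁻¹ * ouEigenfunction β ω t +
        -((ω ^ 2 + β ^ 2)⁻¹ * (ω ^ 2 * (1 - Real.cos ω))) := by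
  have hcont := continuous_ouEigenfunction β ω
  rw [← sub_eq_add_neg, ← mul_sub, ← integral_ouZeroKernel_mul hβ
    (v := fun t => (ω ^ 2 + β ^ 2)⁻¹ * (ouEigenfunction β ω t - ω ^ 2 * (1 - Real.cos ω)))
    (fun s => ((hasDerivAt_ouEigenfunction β ω s).sub_const _).const_mul _)
    (fun s => (hasDerivAt_deriv_ouEigenfunction β ω s).const_mul _) (by fun_prop)
    (by rw [ouEigenfunction_zero, sub_self, mul_zero]) ?_ t]
  · refine integral_congr_ae (.of_forall fun s => ?_)
    field_simp
    ring
  · simp only [mul_one]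
    linear_combination (ω ^ 2 + β ^ 2)⁻¹ * ouEigenfunction_robin hω hF

theorem integral_centerKernel_mul_ouEigenfunction (hβ : β ≠ 0) (hω : ω ≠ 0)
    (hF : ouCharFun β ω = 0) (t : unitInterval) :
    ∫ s : unitInterval, centerKernel (ouZeroKernel β) t s * ouEigenfunction β ω s =
      (ω ^ 2 + β ^ 2)⁻¹ * ouEigenfunction β ω t :=
  integral_centerKernel_mul (continuous_ouZeroKernel β) (ouZeroKernel_comm β)
    ((continuous_ouEigenfunction β ω).comp continuous_subtype_val) (integral_ouEigenfunction hω)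
    (integral_ouZeroKernel_mul_ouEigenfunction hβ hω hF) t

theorem ouEigenfunction_ne_zero (hω : Real.sin ω ≠ 0) :
    (fun t : unitInterval => ouEigenfunction β ω t) ≠ 0 := by
  intro h
  have hzero : ω ^ 2 * (1 - Real.cos ω) = 0 :=
    (ouEigenfunction_zero β ω).symm.trans (congrFun h 0)
  have hω0 : ω ≠ 0 := by rintro rfl; simp at hω
  have hcos : Real.cos ω = 1 :=
    (sub_eq_zero.1 ((mul_eq_zero.1 hzero).resolve_left (pow_ne_zero 2 hω0))).symm
  exact hω (Real.sin_eq_zero_iff_cos_eq.2 (.inl hcos))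

end OUEigenfunction

section OUTrace

variable {β : ℝ}

theorem integral_ouZeroKernel (hβ : β ≠ 0) (t : unitInterval) :
    ∫ s, ouZeroKernel β t s =
      (1 - Real.exp (-β * t) - Real.exp (-β) * Real.sinh (β * t)) / β ^ 2 := by
  rw [← integral_ouZeroKernel_mul hβ
    (v := fun t => (1 - Real.exp (-β * t) - Real.exp (-β) * Real.sinh (β * t)) / β ^ 2)
    (fun s => (((hasDerivAt_exp_mul (-β) s).const_sub 1).sub
      ((hasDerivAt_sinh_mul β s).const_mul (Real.exp (-β)))).div_const _)
    (fun s => (((hasDerivAt_exp_mul (-β) s).const_mul (-β)).neg.sub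
      (((hasDerivAt_cosh_mul β s).const_mul β).const_mul (Real.exp (-β)))).div_const _)
    (by fun_prop) (by simp) ?_ t]
  · refine integral_congr_ae (.of_forall fun s => ?_)
    field_simp
    ring
  · simp only [mul_one, Real.sinh_eq, Real.cosh_eq, Real.exp_neg]
    have := Real.exp_ne_zero β
    field_simp
    ring

theorem integral_integral_ouZeroKernel (hβ : β ≠ 0) :
    ∫ t, ∫ s, ouZeroKernel β t s =
      (1 - (1 - Real.exp (-β)) / β - Real.exp (-β) * (Real.cosh β - 1) / β) / β ^ 2 := by
  simp_rw [integral_ouZeroKernel hβ]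
  rw [integral_unitInterval fun t =>
      (1 - Real.exp (-β * t) - Real.exp (-β) * Real.sinh (β * t)) / β ^ 2,
    intervalIntegral.integral_eq_sub_of_hasDerivAt
      (f := fun t => (t + Real.exp (-β * t) / β - Real.exp (-β) * Real.cosh (β * t) / β) / β ^ 2)
      (fun s _ => ?_) (Continuous.intervalIntegrable (by fun_prop) _ _)]
  · simp only [mul_one, mul_zero, Real.exp_zero, Real.cosh_zero]
    ring
  · refine ((((hasDerivAt_id s).add ((hasDerivAt_exp_mul (-β) s).div_const β)).sub
      (((hasDerivAt_cosh_mul β s).const_mul _).div_const β)).div_const _).congr_deriv ?_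
    field_simp
    ring

theorem integral_ouZeroKernel_diag (hβ : β ≠ 0) :
    ∫ t, ouZeroKernel β t t = 1 / (2 * β) * (1 - (1 - Real.exp (-(2 * β))) / (2 * β)) := by
  have hdiag : ∀ t : unitInterval,
      ouZeroKernel β t t = 1 / (2 * β) * (1 - Real.exp (-(2 * β) * t)) := fun t => by
    rw [ouZeroKernel, sub_self, abs_zero, mul_zero, Real.exp_zero]; ring_nf
  simp_rw [hdiag]
  rw [integral_unitInterval fun t => 1 / (2 * β) * (1 - Real.exp (-(2 * β) * t)),
    intervalIntegral.integral_eq_sub_of_hasDerivAt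
      (f := fun t => 1 / (2 * β) * (t + Real.exp (-(2 * β) * t) / (2 * β)))
      (fun s _ => ?_) (Continuous.intervalIntegrable (by fun_prop) _ _)]
  · simp only [mul_one, mul_zero, Real.exp_zero]
    ring
  · refine (((hasDerivAt_id s).add ((hasDerivAt_exp_mul (-(2 * β)) s).div_const _)).const_mul
      _).congr_deriv ?_
    field_simp
    ring

theorem integral_centerKernel_ouZeroKernel_diag (hβ : β ≠ 0) :
    ∫ t, centerKernel (ouZeroKernel β) t t = ouTrace β := by
  rw [integral_centerKernel_diag (continuous_ouZeroKernel β), integral_ouZeroKernel_diag hβ,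
    integral_integral_ouZeroKernel hβ, ouTrace, exp_neg_two_mul, Real.cosh_eq, Real.exp_neg]
  have := Real.exp_ne_zero β
  field_simp
  ring

end OUTrace

section GaussianHilbertSpace

variable {Ω T ι : Type*} [MeasurableSpace Ω] {P : Measure Ω}

theorem sq_integral_le_integral_sq [IsProbabilityMeasure P] {g : Ω → ℝ} (hg : MemLp g 2 P) :
    (∫ ω, g ω ∂P) ^ 2 ≤ ∫ ω, g ω ^ 2 ∂P := by
  have := variance_nonneg g P
  rw [variance_eq_sub hg] at this
  simpa using this

theorem integral_mul_eq_inner (Y Z : Lp ℝ 2 P) : ∫ ω, Y ω * Z ω ∂P = inner ℝ Y Z := by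
  rw [L2.inner_def]
  refine integral_congr_ae (.of_forall fun ω => ?_)
  simp [mul_comm]

theorem integral_sq_eq_norm_sq (Y : Lp ℝ 2 P) : ∫ ω, Y ω ^ 2 ∂P = ‖Y‖ ^ 2 := by
  rw [← real_inner_self_eq_norm_sq, ← integral_mul_eq_inner]
  simp_rw [sq]

theorem coeFn_sum_smul [Fintype ι] (c : ι → ℝ) {y : ι → Lp ℝ 2 P} {Y : ι → Ω → ℝ}
    (hY : ∀ i, Y i =ᵐ[P] y i) :
    (∑ i, c i • y i : Lp ℝ 2 P) =ᵐ[P] fun ω => ∑ i, c i * Y i ω := by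
  have hsmul : ∀ᵐ ω ∂P, ∀ i, (c i • y i : Lp ℝ 2 P) ω = c i * Y i ω := by
    rw [ae_all_iff]
    intro i
    filter_upwards [Lp.coeFn_smul (c i) (y i), hY i] with ω hω hYω
    rw [hω, Pi.smul_apply, hYω, smul_eq_mul]
  filter_upwards [Lp.coeFn_finsetSum Finset.univ fun i => c i • y i, hsmul] with ω hω hsmulω
  rw [hω, Finset.sum_apply]
  exact Finset.sum_congr rfl fun i _ => hsmulω i

theorem norm_exp_mul_I_sub_exp_mul_I_le (a b : ℝ) :
    ‖Complex.exp (a * Complex.I) - Complex.exp (b * Complex.I)‖ ≤ |a - b| := by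
  have hfactor : Complex.exp (a * Complex.I) - Complex.exp (b * Complex.I) =
      Complex.exp (b * Complex.I) * (Complex.exp (Complex.I * (a - b : ℝ)) - 1) := by
    rw [mul_sub, ← Complex.exp_add, mul_one]
    congr 2
    push_cast; ring
  rw [hfactor, norm_mul, Complex.norm_exp_ofReal_mul_I, one_mul]
  exact Real.norm_exp_I_mul_ofReal_sub_one_le

theorem integrable_exp_mul_I [IsFiniteMeasure P] {Y : Ω → ℝ} (hY : AEStronglyMeasurable Y P) :
    Integrable (fun ω => Complex.exp (Y ω * Complex.I)) P := by
  have hcont : Continuous fun x : ℝ => Complex.exp (x * Complex.I) := by fun_prop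
  exact .of_bound (C := 1) (hcont.comp_aestronglyMeasurable hY)
    (.of_forall fun ω => (Complex.norm_exp_ofReal_mul_I _).le)

theorem continuous_integral_exp_mul_I [IsProbabilityMeasure P] :
    Continuous fun Y : Lp ℝ 2 P => ∫ ω, Complex.exp (Y ω * Complex.I) ∂P := by
  refine LipschitzWith.continuous (K := 1) (LipschitzWith.of_dist_le_mul fun Y Z => ?_)
  have hY := Lp.memLp Y
  have hZ := Lp.memLp Z
  have habs : MemLp (fun ω => |(Y - Z : Lp ℝ 2 P) ω|) 2 P := (Lp.memLp (Y - Z)).abs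
  have hL1 : ∫ ω, |(Y - Z : Lp ℝ 2 P) ω| ∂P ≤ ‖Y - Z‖ := by
    refine le_of_sq_le_sq ?_ (norm_nonneg _)
    simpa only [sq_abs, integral_sq_eq_norm_sq] using sq_integral_le_integral_sq habs
  rw [dist_eq_norm, ← integral_sub (integrable_exp_mul_I hY.1) (integrable_exp_mul_I hZ.1),
    NNReal.coe_one, one_mul, dist_eq_norm]
  refine (norm_integral_le_integral_norm _).trans (le_trans ?_ hL1)
  refine integral_mono_of_nonneg (.of_forall fun _ => norm_nonneg _)
    (habs.integrable one_le_two) ?_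
  filter_upwards [Lp.coeFn_sub Y Z] with ω hω
  rw [hω]
  exact norm_exp_mul_I_sub_exp_mul_I_le _ _

/-- A space of centered Gaussian random variables, expressed through characteristic functions. -/
def IsGaussianHilbertSpace (W : Submodule ℝ (Lp ℝ 2 P)) : Prop :=
  ∀ Y ∈ W, ∫ ω, Complex.exp (Y ω * Complex.I) ∂P = Complex.exp (-((‖Y‖ ^ 2 / 2 : ℝ) : ℂ))

theorem IsGaussianHilbertSpace.topologicalClosure [IsProbabilityMeasure P]
    {W : Submodule ℝ (Lp ℝ 2 P)} (hW : IsGaussianHilbertSpace W) :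
    IsGaussianHilbertSpace W.topologicalClosure := fun _ hY =>
  closure_minimal hW (isClosed_eq continuous_integral_exp_mul_I (by fun_prop)) hY

theorem integral_exp_mul_I_of_hasGaussianLaw {Y : Lp ℝ 2 P} (hY : HasGaussianLaw Y P)
    (hmean : ∫ ω, Y ω ∂P = 0) :
    ∫ ω, Complex.exp (Y ω * Complex.I) ∂P = Complex.exp (-((‖Y‖ ^ 2 / 2 : ℝ) : ℂ)) := by
  have hvar : Var[Y; P] = ‖Y‖ ^ 2 := by
    rw [variance_eq_integral hY.aemeasurable, hmean, ← integral_sq_eq_norm_sq]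
    simp only [sub_zero]
  have hlaw := hY.map_eq_gaussianReal
  rw [hmean, hvar] at hlaw
  have hchar := charFun_gaussianReal (μ := 0) (v := (‖Y‖ ^ 2).toNNReal) 1
  rw [← hlaw, charFun_apply_real, integral_map hY.aemeasurable (by fun_prop)] at hchar
  simp only [Complex.ofReal_one, one_mul, Complex.ofReal_zero, mul_zero, zero_mul, zero_sub,
    one_pow, mul_one, Real.coe_toNNReal _ (sq_nonneg ‖Y‖)] at hchar
  rw [hchar]
  push_cast
  rfl

/-- The closed subspace of `L²(P)` spanned by the process `X`. -/
noncomputable def gaussianSpace (X : T → Ω → ℝ) (P : Measure Ω) : Submodule ℝ (Lp ℝ 2 P) :=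
  (Submodule.span ℝ {Y : Lp ℝ 2 P | ∃ t, Y =ᵐ[P] X t}).topologicalClosure

theorem isGaussianHilbertSpace_gaussianSpace [IsProbabilityMeasure P] {X : T → Ω → ℝ}
    (hX : IsGaussianProcess X P) (h0 : ∀ t, ∫ ω, X t ω ∂P = 0) :
    IsGaussianHilbertSpace (gaussianSpace X P) := by
  refine IsGaussianHilbertSpace.topologicalClosure fun Y hY => ?_
  obtain ⟨n, c, g, rfl⟩ := Submodule.mem_span_set'.1 hY
  choose t ht using fun i => (g i).2
  have hae := coeFn_sum_smul c fun i => (ht i).symm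
  have hlaw : HasGaussianLaw (fun ω => ∑ i, c i * X (t i) ω) P := by
    simpa using ((hX.comp_right t).smul c).hasGaussianLaw_fun_sum (I := Finset.univ)
  refine integral_exp_mul_I_of_hasGaussianLaw (hlaw.congr hae.symm) ?_
  rw [integral_congr_ae hae,
    integral_finsetSum _ fun i _ => ((hX.hasGaussianLaw_eval (t i)).integrable).const_mul _]
  exact Finset.sum_eq_zero fun i _ => by rw [integral_const_mul, h0, mul_zero]

theorem norm_sq_sum_smul_of_orthogonal [Fintype ι] {y : ι → Lp ℝ 2 P} {v : ι → ℝ} [DecidableEq ι]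
    (hy : ∀ i j, inner ℝ (y i) (y j) = if i = j then v i else 0) (c : ι → ℝ) :
    ‖∑ i, c i • y i‖ ^ 2 = ∑ i, c i ^ 2 * v i := by
  rw [← real_inner_self_eq_norm_sq, sum_inner]
  refine Finset.sum_congr rfl fun i _ => ?_
  simp only [inner_sum, real_inner_smul_left, real_inner_smul_right, hy, mul_ite, mul_zero,
    Finset.sum_ite_eq, Finset.mem_univ, if_true]
  ring

/-- The joint characteristic function factorizes. -/
theorem IsGaussianHilbertSpace.map_eq_pi_gaussianReal [IsProbabilityMeasure P]
    {W : Submodule ℝ (Lp ℝ 2 P)} (hW : IsGaussianHilbertSpace W) [Fintype ι] [DecidableEq ι]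
    {Y : ι → Ω → ℝ} {y : ι → Lp ℝ 2 P} (hy : ∀ i, y i ∈ W) (hyY : ∀ i, Y i =ᵐ[P] y i)
    {v : ι → ℝ} (hv : ∀ i, 0 ≤ v i)
    (hcov : ∀ i j, ∫ ω, Y i ω * Y j ω ∂P = if i = j then v i else 0) :
    P.map (fun ω i => Y i ω) = Measure.pi fun i => gaussianReal 0 (v i).toNNReal := by
  have hYm : AEMeasurable (fun ω i => Y i ω) P := aemeasurable_pi_lambda _ fun i =>
    (Lp.aestronglyMeasurable (y i)).aemeasurable.congr (hyY i).symm
  have : IsProbabilityMeasure (P.map fun ω i => Y i ω) := Measure.isProbabilityMeasure_map hYm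
  have hinner : ∀ i j, inner ℝ (y i) (y j) = if i = j then v i else 0 := fun i j => by
    rw [← hcov i j, ← integral_mul_eq_inner]
    exact integral_congr_ae (((hyY i).mul (hyY j)).symm)
  rw [← charFun_eq_pi_iff]
  intro t
  have htoLp : Measurable (WithLp.toLp 2 : (ι → ℝ) → PiLp 2 fun _ : ι => ℝ) := by fun_prop
  rw [charFun_apply, integral_map htoLp.aemeasurable (by fun_prop), integral_map hYm (by fun_prop)]
  calc ∫ ω, Complex.exp (inner ℝ (WithLp.toLp 2 fun i => Y i ω) t * Complex.I) ∂P
      = ∫ ω, Complex.exp ((∑ i, t i • y i : Lp ℝ 2 P) ω * Complex.I) ∂P := by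
        refine integral_congr_ae ?_
        filter_upwards [coeFn_sum_smul t hyY] with ω hω
        rw [hω, PiLp.inner_apply]
        simp
    _ = Complex.exp (-((∑ i, t i ^ 2 * v i) / 2 : ℝ)) := by
        rw [hW _ (Submodule.sum_mem _ fun i _ => Submodule.smul_mem _ _ (hy i)),
          norm_sq_sum_smul_of_orthogonal hinner]
    _ = ∏ i, charFun (gaussianReal 0 (v i).toNNReal) (t i) := by
        simp_rw [charFun_gaussianReal, Real.coe_toNNReal _ (hv _)]
        rw [← Complex.exp_sum]
        congr 1
        push_cast
        rw [Finset.sum_div, ← Finset.sum_neg_distrib]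
        exact Finset.sum_congr rfl fun i _ => by ring

end GaussianHilbertSpace

section PathCoordinates

variable {Ω : Type*} [MeasurableSpace Ω] {P : Measure Ω} {W : Submodule ℝ (Lp ℝ 2 P)}
  {K : unitInterval → unitInterval → ℝ} {Z : unitInterval → Ω → ℝ} {f : unitInterval → ℝ}

/-- A jointly measurable process on `[0,1]` with values in the closed subspace `W` of `L²(P)`, whose
second moments are given by the continuous kernel `K`. -/
structure IsProcessIn (W : Submodule ℝ (Lp ℝ 2 P)) (K : unitInterval → unitInterval → ℝ)
    (Z : unitInterval → Ω → ℝ) : Prop where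
  isClosed : IsClosed (W : Set (Lp ℝ 2 P))
  aemeasurable : AEMeasurable (fun p : unitInterval × Ω => Z p.1 p.2) (volume.prod P)
  mem : ∀ t, ∃ y ∈ W, Z t =ᵐ[P] y
  continuous_kernel : Continuous fun p : unitInterval × unitInterval => K p.1 p.2
  integral_mul : ∀ t s, ∫ ω, Z t ω * Z s ω ∂P = K t s

/-- The coordinate `∫₀¹ Z(s) f(s) ds` of a path of `Z` along `f`. -/
noncomputable def pathCoord (Z : unitInterval → Ω → ℝ) (f : unitInterval → ℝ) (ω : Ω) : ℝ :=
  ∫ s, Z s ω * f s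

theorem exists_forall_abs_le_of_continuous {X : Type*} [TopologicalSpace X] [CompactSpace X]
    {g : X → ℝ} (hg : Continuous g) : ∃ C, 0 ≤ C ∧ ∀ x, |g x| ≤ C :=
  ⟨_, norm_nonneg _, ContinuousMap.norm_coe_le_norm (⟨g, hg⟩ : C(X, ℝ))⟩

theorem memLp_two_of_continuous (hf : Continuous f) :
    MemLp f 2 (volume : Measure unitInterval) :=
  hf.memLp_of_hasCompactSupport (.of_compactSpace f)

namespace IsProcessIn

theorem memLp (hZ : IsProcessIn W K Z) (t : unitInterval) : MemLp (Z t) 2 P := by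
  obtain ⟨y, _, hy⟩ := hZ.mem t
  exact (Lp.memLp y).ae_eq hy.symm

theorem kernel_comm (hZ : IsProcessIn W K Z) (t s : unitInterval) : K t s = K s t := by
  simp_rw [← hZ.integral_mul, mul_comm]

variable [IsProbabilityMeasure P]

theorem integrable_sq (hZ : IsProcessIn W K Z) :
    Integrable (fun p : unitInterval × Ω => Z p.1 p.2 ^ 2) (volume.prod P) := by
  have hm : AEStronglyMeasurable (fun p : unitInterval × Ω => Z p.1 p.2 ^ 2) (volume.prod P) :=
    (hZ.aemeasurable.pow_const 2).aestronglyMeasurable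
  rw [integrable_prod_iff hm]
  refine ⟨.of_forall fun t => (hZ.memLp t).integrable_sq, ?_⟩
  have hdiag : ∀ t, ∫ ω, ‖Z t ω ^ 2‖ ∂P = K t t := fun t => by
    simp_rw [← hZ.integral_mul, Real.norm_of_nonneg (sq_nonneg _), sq]
  simp_rw [hdiag]
  exact integrable_of_continuous
    (hZ.continuous_kernel.comp (by fun_prop : Continuous fun t => (t, t)))

theorem integrable_mul (hZ : IsProcessIn W K Z) {V : Ω → ℝ} (hV : MemLp V 2 P)
    (hf : Continuous f) :
    Integrable (fun p : unitInterval × Ω => V p.2 * (Z p.1 p.2 * f p.1)) (volume.prod P) := by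
  have hV' : MemLp (fun p : unitInterval × Ω => V p.2) 2 (volume.prod P) := hV.comp_snd volume
  have hZ' : MemLp (fun p : unitInterval × Ω => Z p.1 p.2) 2 (volume.prod P) :=
    (memLp_two_iff_integrable_sq hZ.aemeasurable.aestronglyMeasurable).2 hZ.integrable_sq
  obtain ⟨C, -, hC⟩ := exists_forall_abs_le_of_continuous hf
  simp_rw [← mul_assoc]
  exact (hV'.integrable_mul hZ').mul_bdd
    (hf.comp_aestronglyMeasurable measurable_fst.aestronglyMeasurable) (.of_forall fun p => hC p.1)

theorem ae_memLp_path (hZ : IsProcessIn W K Z) :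
    ∀ᵐ ω ∂P, MemLp (fun t => Z t ω) 2 (volume : Measure unitInterval) := by
  have hmul := (hZ.integrable_mul (memLp_const 1) (f := fun _ => 1) continuous_const).prod_left_ae
  filter_upwards [hmul, hZ.integrable_sq.prod_left_ae] with ω hω hsq
  simp only [one_mul, mul_one] at hω
  exact (memLp_two_iff_integrable_sq hω.1).2 hsq

theorem memLp_pathCoord (hZ : IsProcessIn W K Z) (hf : Continuous f) :
    MemLp (pathCoord Z f) 2 P := by
  obtain ⟨C, hC0, hC⟩ := exists_forall_abs_le_of_continuous hf
  have h_int : Integrable (pathCoord Z f) P := by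
    have hprod := (hZ.integrable_mul (memLp_const 1) hf).integral_prod_right
    simp only [one_mul] at hprod
    exact hprod
  rw [memLp_two_iff_integrable_sq h_int.1]
  refine (hZ.integrable_sq.integral_prod_right.const_mul (C ^ 2)).mono' (h_int.1.pow 2) ?_
  filter_upwards [hZ.ae_memLp_path] with ω hω
  have hmul : MemLp (fun s => Z s ω * f s) 2 (volume : Measure unitInterval) := by
    refine (hω.const_mul C).mono (hω.1.mul hf.aestronglyMeasurable) (.of_forall fun s => ?_)
    rw [norm_mul, norm_mul, mul_comm, Real.norm_of_nonneg hC0]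
    exact mul_le_mul_of_nonneg_right (hC s) (norm_nonneg _)
  rw [Real.norm_of_nonneg (sq_nonneg _)]
  refine (sq_integral_le_integral_sq hmul).trans ?_
  rw [← integral_const_mul]
  refine integral_mono hmul.integrable_sq (hω.integrable_sq.const_mul _) fun s => ?_
  rw [mul_pow, mul_comm, ← sq_abs (f s)]
  gcongr
  exact hC s

theorem integral_mul_pathCoord (hZ : IsProcessIn W K Z) {V : Ω → ℝ} (hV : MemLp V 2 P)
    (hf : Continuous f) :
    ∫ ω, V ω * pathCoord Z f ω ∂P = ∫ s, (∫ ω, V ω * Z s ω ∂P) * f s := by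
  calc ∫ ω, V ω * pathCoord Z f ω ∂P = ∫ ω, (∫ s, V ω * (Z s ω * f s)) ∂P := by
        simp_rw [integral_const_mul]; rfl
    _ = ∫ s, (∫ ω, V ω * (Z s ω * f s) ∂P) :=
        (integral_integral_swap (hZ.integrable_mul hV hf)).symm
    _ = _ := by simp_rw [← mul_assoc, integral_mul_const]

/-- A vector orthogonal to all the values of the process is orthogonal to its integrals. -/
theorem pathCoord_mem (hZ : IsProcessIn W K Z) (hf : Continuous f) :
    ∃ y ∈ W, pathCoord Z f =ᵐ[P] y := by
  have hY := hZ.memLp_pathCoord hf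
  refine ⟨hY.toLp, ?_, hY.coeFn_toLp.symm⟩
  have hWW : W = Wᗮᗮ := by
    rw [Submodule.orthogonal_orthogonal_eq_closure, hZ.isClosed.submodule_topologicalClosure_eq]
  rw [hWW, Submodule.mem_orthogonal]
  intro V hV
  have horth : ∀ s, ∫ ω, V ω * Z s ω ∂P = 0 := by
    intro s
    obtain ⟨y, hy, hys⟩ := hZ.mem s
    rw [← Submodule.inner_left_of_mem_orthogonal hy hV, ← integral_mul_eq_inner]
    exact integral_congr_ae (.mul .rfl hys)
  calc inner ℝ V hY.toLp = ∫ ω, V ω * (hY.toLp : Lp ℝ 2 P) ω ∂P := (integral_mul_eq_inner _ _).symm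
    _ = ∫ ω, V ω * pathCoord Z f ω ∂P := integral_congr_ae (.mul .rfl hY.coeFn_toLp)
    _ = 0 := by
        rw [hZ.integral_mul_pathCoord (Lp.memLp V) hf]
        simp only [horth, zero_mul, integral_zero]

theorem integral_pathCoord_mul (hZ : IsProcessIn W K Z) {g : unitInterval → ℝ} {m : ℝ}
    (hg : Continuous g) (hf : Continuous f) (hfm : ∀ t, ∫ s, K t s * f s = m * f t) :
    ∫ ω, pathCoord Z g ω * pathCoord Z f ω ∂P = m * ∫ t, g t * f t := by
  have hcov : ∀ t, ∫ ω, pathCoord Z f ω * Z t ω ∂P = m * f t := fun t => by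
    simp_rw [mul_comm (pathCoord Z f _)]
    rw [hZ.integral_mul_pathCoord (hZ.memLp t) hf, ← hfm]
    simp_rw [hZ.integral_mul]
  simp_rw [mul_comm (pathCoord Z g _)]
  rw [hZ.integral_mul_pathCoord (hZ.memLp_pathCoord hf) hg, ← integral_const_mul]
  simp_rw [hcov, mul_assoc, mul_comm (g _)]

theorem integral_integral_sq (hZ : IsProcessIn W K Z) :
    ∫ ω, (∫ t, Z t ω ^ 2) ∂P = ∫ t, K t t := by
  rw [← integral_integral_swap hZ.integrable_sq]
  simp_rw [sq, hZ.integral_mul]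

end IsProcessIn

end PathCoordinates

section KarhunenLoeve

theorem sum_sq_integral_mul_le {α ι : Type*} [MeasurableSpace α] {μ : Measure α} [DecidableEq ι]
    {e : ι → α → ℝ} (he : ∀ i, MemLp (e i) 2 μ)
    (ho : ∀ i j, ∫ x, e i x * e j x ∂μ = if i = j then 1 else 0)
    {z : α → ℝ} (hz : MemLp z 2 μ) (s : Finset ι) :
    ∑ i ∈ s, (∫ x, z x * e i x ∂μ) ^ 2 ≤ ∫ x, z x ^ 2 ∂μ := by
  have hinner : ∀ {u v : α → ℝ} (hu : MemLp u 2 μ) (hv : MemLp v 2 μ),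
      inner ℝ hu.toLp hv.toLp = ∫ x, u x * v x ∂μ := fun hu hv => by
    rw [← integral_mul_eq_inner]
    exact integral_congr_ae (hu.coeFn_toLp.mul hv.coeFn_toLp)
  have hon : Orthonormal ℝ fun i => (he i).toLp :=
    orthonormal_iff_ite.2 fun i j => by rw [hinner, ho]
  have hbessel := hon.sum_inner_products_le hz.toLp (s := s)
  rw [← real_inner_self_eq_norm_sq, hinner] at hbessel
  simp_rw [hinner, Real.norm_eq_abs, sq_abs] at hbessel
  simpa only [mul_comm, sq] using hbessel

/-- An orthonormal family of continuous eigenfunctions of the integral operator with kernel `K`. -/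
structure IsEigenSystem {ι : Type*} [DecidableEq ι] (K : unitInterval → unitInterval → ℝ)
    (m : ι → ℝ) (e : ι → unitInterval → ℝ) : Prop where
  continuous : ∀ i, Continuous (e i)
  orthonormal : ∀ i j, ∫ t, e i t * e j t = if i = j then 1 else 0
  integral_mul : ∀ i t, ∫ s, K t s * e i s = m i * e i t

namespace IsEigenSystem

variable {Ω ι : Type*} [MeasurableSpace Ω] {P : Measure Ω} [IsProbabilityMeasure P]
  [DecidableEq ι] {W : Submodule ℝ (Lp ℝ 2 P)} {K : unitInterval → unitInterval → ℝ}
  {Z : unitInterval → Ω → ℝ} {m : ι → ℝ} {e : ι → unitInterval → ℝ}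

theorem integral_pathCoord_mul (he : IsEigenSystem K m e) (hZ : IsProcessIn W K Z) (i j : ι) :
    ∫ ω, pathCoord Z (e i) ω * pathCoord Z (e j) ω ∂P = if i = j then m i else 0 := by
  rw [hZ.integral_pathCoord_mul (he.continuous i) (he.continuous j) (he.integral_mul j),
    he.orthonormal]
  split_ifs with hij <;> simp [hij]

theorem integral_sq_pathCoord (he : IsEigenSystem K m e) (hZ : IsProcessIn W K Z) (i : ι) :
    ∫ ω, pathCoord Z (e i) ω ^ 2 ∂P = m i := by
  simp_rw [sq, he.integral_pathCoord_mul hZ, if_true]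

theorem eigenvalue_nonneg (he : IsEigenSystem K m e) (hZ : IsProcessIn W K Z) (i : ι) :
    0 ≤ m i := by
  rw [← he.integral_sq_pathCoord hZ]
  exact integral_nonneg fun _ => sq_nonneg _

theorem ae_sum_sq_pathCoord_le (he : IsEigenSystem K m e) (hZ : IsProcessIn W K Z) :
    ∀ᵐ ω ∂P, ∀ s : Finset ι, ∑ i ∈ s, pathCoord Z (e i) ω ^ 2 ≤ ∫ t, Z t ω ^ 2 := by
  filter_upwards [hZ.ae_memLp_path] with ω hω s
  exact sum_sq_integral_mul_le (fun i => memLp_two_of_continuous (he.continuous i))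
    he.orthonormal hω s

theorem sum_eigenvalues_le (he : IsEigenSystem K m e) (hZ : IsProcessIn W K Z) (s : Finset ι) :
    ∑ i ∈ s, m i ≤ ∫ t, K t t := by
  have h_int : ∀ i ∈ s, Integrable (fun ω => pathCoord Z (e i) ω ^ 2) P := fun i _ =>
    (hZ.memLp_pathCoord (he.continuous i)).integrable_sq
  rw [← Finset.sum_congr rfl fun i _ => he.integral_sq_pathCoord hZ i, ← integral_finsetSum _ h_int,
    ← hZ.integral_integral_sq]
  refine integral_mono_ae (integrable_finsetSum _ h_int) hZ.integrable_sq.integral_prod_right ?_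
  filter_upwards [he.ae_sum_sq_pathCoord_le hZ] with ω hω using hω s

theorem lintegral_tsum_sq_pathCoord [Countable ι] (he : IsEigenSystem K m e)
    (hZ : IsProcessIn W K Z) (hm : Summable m) :
    ∫⁻ ω, ∑' i, ENNReal.ofReal (pathCoord Z (e i) ω ^ 2) ∂P = ENNReal.ofReal (∑' i, m i) := by
  have hcoord : ∀ i, MemLp (pathCoord Z (e i)) 2 P := fun i =>
    hZ.memLp_pathCoord (he.continuous i)
  rw [lintegral_tsum fun i => ((hcoord i).1.aemeasurable.pow_const 2).ennreal_ofReal,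
    ENNReal.ofReal_tsum_of_nonneg (he.eigenvalue_nonneg hZ) hm]
  refine tsum_congr fun i => ?_
  rw [← ofReal_integral_eq_lintegral_ofReal (hcoord i).integrable_sq
    (.of_forall fun _ => sq_nonneg _), he.integral_sq_pathCoord hZ]

/-- Karhunen–Loève: Bessel's inequality for the paths must be an equality almost surely, because
both sides have the same expectation as soon as the eigenvalues exhaust the trace. -/
theorem ae_hasSum_sq_pathCoord [Countable ι] (he : IsEigenSystem K m e) (hZ : IsProcessIn W K Z)
    (hm : Summable m) (htrace : ∫ t, K t t ≤ ∑' i, m i) :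
    ∀ᵐ ω ∂P, HasSum (fun i => pathCoord Z (e i) ω ^ 2) (∫ t, Z t ω ^ 2) := by
  have hnorm : Integrable (fun ω => ∫ t, Z t ω ^ 2) P := hZ.integrable_sq.integral_prod_right
  have hnorm_nonneg : ∀ ω, 0 ≤ ∫ t, Z t ω ^ 2 := fun ω => integral_nonneg fun _ => sq_nonneg _
  have hbessel := he.ae_sum_sq_pathCoord_le hZ
  have hle : (fun ω => ∑' i, ENNReal.ofReal (pathCoord Z (e i) ω ^ 2)) ≤ᵐ[P]
      fun ω => ENNReal.ofReal (∫ t, Z t ω ^ 2) := by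
    filter_upwards [hbessel] with ω hω
    refine ENNReal.summable.tsum_le_of_sum_le fun s => ?_
    rw [← ENNReal.ofReal_sum_of_nonneg fun _ _ => sq_nonneg _]
    exact ENNReal.ofReal_le_ofReal (hω s)
  have heq := ae_eq_of_ae_le_of_lintegral_le hle
    (by rw [he.lintegral_tsum_sq_pathCoord hZ hm]; exact ENNReal.ofReal_ne_top)
    hnorm.1.aemeasurable.ennreal_ofReal (by
      rw [he.lintegral_tsum_sq_pathCoord hZ hm, ← ofReal_integral_eq_lintegral_ofReal hnorm
        (.of_forall hnorm_nonneg), hZ.integral_integral_sq]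
      exact ENNReal.ofReal_le_ofReal htrace)
  filter_upwards [heq, hbessel] with ω hω hle
  have hsum : Summable fun i => pathCoord Z (e i) ω ^ 2 :=
    summable_of_sum_le (fun _ => sq_nonneg _) hle
  rw [← ENNReal.ofReal_tsum_of_nonneg (fun _ => sq_nonneg _) hsum,
    ENNReal.ofReal_eq_ofReal_iff (tsum_nonneg fun _ => sq_nonneg _) (hnorm_nonneg ω)] at hω
  exact hω ▸ hsum.hasSum

end IsEigenSystem

end KarhunenLoeve

section GaussianBall

/-- The probability that a centered Gaussian vector with independent coordinates of variances
`v 0, …, v (n - 1)` has squared norm at most `x`. -/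
noncomputable def gaussianBall (v : ℕ → ℝ) (n : ℕ) (x : ℝ) : ℝ :=
  (Measure.pi fun k : Fin n => gaussianReal 0 (v k).toNNReal).real {z | ∑ k, z k ^ 2 ≤ x}

theorem gaussianBall_nonneg (v : ℕ → ℝ) (n : ℕ) (x : ℝ) : 0 ≤ gaussianBall v n x :=
  measureReal_nonneg

theorem gaussianBall_le_one (v : ℕ → ℝ) (n : ℕ) (x : ℝ) : gaussianBall v n x ≤ 1 :=
  measureReal_le_one

theorem gaussianBall_mono (v : ℕ → ℝ) (n : ℕ) : Monotone (gaussianBall v n) := fun _ _ hxy =>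
  measureReal_mono fun _ hz => le_trans (α := ℝ) hz hxy

theorem gaussianBall_succ_le (v : ℕ → ℝ) (n : ℕ) (x : ℝ) :
    gaussianBall v (n + 1) x ≤ gaussianBall v n x := by
  have hinit : MeasurePreserving (fun z : Fin (n + 1) → ℝ => fun k : Fin n => z k.castSucc)
      (Measure.pi fun k : Fin (n + 1) => gaussianReal 0 (v k).toNNReal)
      (Measure.pi fun k : Fin n => gaussianReal 0 (v k).toNNReal) := by
    have h := measurePreserving_snd.comp (measurePreserving_piFinSuccAbove
      (fun k : Fin (n + 1) => gaussianReal 0 (v k).toNNReal) (Fin.last n))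
    simp only [Fin.succAbove_last, Fin.val_castSucc] at h
    convert h using 1
    ext z k
    simp [MeasurableEquiv.piFinSuccAbove, Fin.insertNthEquiv, Fin.init]
  have hball : MeasurableSet {z : Fin n → ℝ | ∑ k, z k ^ 2 ≤ x} :=
    measurableSet_le (by fun_prop) measurable_const
  rw [gaussianBall, gaussianBall, ← hinit.measureReal_preimage hball.nullMeasurableSet]
  refine measureReal_mono fun z hz => ?_
  rw [Set.mem_ofPred, Fin.sum_univ_castSucc] at hz
  exact (le_add_of_nonneg_right (sq_nonneg _)).trans hz

/-- The distribution function `x ↦ ℙ (∑ k, v k * ξ k ^ 2 ≤ x)` of a weighted series of squares of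
independent standard Gaussians. The events `∑ k < n, v k * ξ k ^ 2 ≤ x` decrease in `n`, so it is
encoded as the infimum of their probabilities. -/
noncomputable def gaussianSeriesBall (v : ℕ → ℝ) (x : ℝ) : ℝ :=
  ⨅ n, gaussianBall v n x

theorem tendsto_gaussianBall (v : ℕ → ℝ) (x : ℝ) :
    Tendsto (fun n => gaussianBall v n x) atTop (𝓝 (gaussianSeriesBall v x)) :=
  tendsto_atTop_ciInf (antitone_nat_of_succ_le fun n => gaussianBall_succ_le v n x)
    ⟨0, by rintro _ ⟨n, rfl⟩; exact gaussianBall_nonneg v n x⟩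

theorem gaussianSeriesBall_nonneg (v : ℕ → ℝ) (x : ℝ) : 0 ≤ gaussianSeriesBall v x :=
  le_ciInf fun n => gaussianBall_nonneg v n x

theorem gaussianSeriesBall_mono (v : ℕ → ℝ) : Monotone (gaussianSeriesBall v) := fun x y hxy =>
  le_of_tendsto_of_tendsto' (tendsto_gaussianBall v x) (tendsto_gaussianBall v y) fun n =>
    gaussianBall_mono v n hxy

end GaussianBall

namespace IsEigenSystem

variable {Ω : Type*} [MeasurableSpace Ω] {P : Measure Ω} [IsProbabilityMeasure P]
  {W : Submodule ℝ (Lp ℝ 2 P)} {K : unitInterval → unitInterval → ℝ}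
  {Z : unitInterval → Ω → ℝ} {m : ℕ → ℝ} {e : ℕ → unitInterval → ℝ}

theorem gaussianBall_eq (he : IsEigenSystem K m e) (hW : IsGaussianHilbertSpace W)
    (hZ : IsProcessIn W K Z) (n : ℕ) (x : ℝ) :
    gaussianBall m n x = P.real {ω | ∑ k ∈ Finset.range n, pathCoord Z (e k) ω ^ 2 ≤ x} := by
  choose y hyW hy using fun i => hZ.pathCoord_mem (he.continuous i)
  have hmap := hW.map_eq_pi_gaussianReal (Y := fun k : Fin n => pathCoord Z (e k))
    (fun k => hyW k) (fun k => hy k) (fun k => he.eigenvalue_nonneg hZ k)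
    (fun i j => by rw [he.integral_pathCoord_mul hZ]; simp only [Fin.val_inj])
  have hball : MeasurableSet {z : Fin n → ℝ | ∑ k, z k ^ 2 ≤ x} :=
    measurableSet_le (by fun_prop) measurable_const
  rw [gaussianBall, ← hmap, map_measureReal_apply_of_aemeasurable (aemeasurable_pi_lambda _
    fun k : Fin n => (hZ.memLp_pathCoord (he.continuous k)).1.aemeasurable) hball]
  simp_rw [Finset.sum_range]
  rfl

theorem smallBall_eq (he : IsEigenSystem K m e) (hZ : IsProcessIn W K Z) (hm : Summable m)
    (htrace : ∫ t, K t t ≤ ∑' i, m i) {ε : ℝ} (hε : 0 ≤ ε) :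
    smallBall Z P ε =
      P.real (⋂ n, {ω | ∑ k ∈ Finset.range n, pathCoord Z (e k) ω ^ 2 ≤ ε ^ 2}) := by
  refine measureReal_congr ?_
  filter_upwards [he.ae_hasSum_sq_pathCoord hZ hm htrace] with ω hω
  refine propext ?_
  change pathNorm Z ω ≤ ε ↔ ω ∈ ⋂ n, _
  rw [pathNorm, Real.sqrt_le_left hε, Set.mem_iInter]
  exact ⟨fun h n => (sum_le_hasSum _ (fun _ _ => sq_nonneg _) hω).trans h,
    fun h => le_of_tendsto' hω.tendsto_sum_nat h⟩

theorem smallBall_eq_gaussianSeriesBall (he : IsEigenSystem K m e)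
    (hW : IsGaussianHilbertSpace W) (hZ : IsProcessIn W K Z) (hm : Summable m)
    (htrace : ∫ t, K t t ≤ ∑' i, m i) {ε : ℝ} (hε : 0 ≤ ε) :
    smallBall Z P ε = gaussianSeriesBall m (ε ^ 2) := by
  refine tendsto_nhds_unique ?_ (tendsto_gaussianBall m (ε ^ 2))
  simp_rw [he.gaussianBall_eq hW hZ, he.smallBall_eq hZ hm htrace hε]
  refine (ENNReal.tendsto_toReal (measure_ne_top _ _)).comp
    (tendsto_measure_iInter_atTop (fun n => ?_) (fun i j hij ω hω => ?_) ⟨0, measure_ne_top _ _⟩)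
  · exact nullMeasurableSet_le (Finset.aemeasurable_fun_sum _ fun k _ =>
      (hZ.memLp_pathCoord (he.continuous k)).1.aemeasurable.pow_const 2) aemeasurable_const
  · exact (Finset.sum_le_sum_of_subset_of_nonneg (Finset.range_mono hij)
      fun _ _ _ => sq_nonneg _).trans (Set.mem_ofPred.1 hω)

end IsEigenSystem

section Comparison

theorem lintegral_pi_prod {ι : Type*} [Fintype ι] {α : ι → Type*} [∀ i, MeasurableSpace (α i)]
    {ν : ∀ i, Measure (α i)} [∀ i, IsProbabilityMeasure (ν i)] {f : ∀ i, α i → ENNReal}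
    (hf : ∀ i, Measurable (f i)) :
    ∫⁻ z, ∏ i, f i (z i) ∂Measure.pi ν = ∏ i, ∫⁻ x, f i x ∂ν i := by
  refine (lintegral_prod_eq_prod_lintegral_of_indepFun Finset.univ
    (fun i (z : ∀ i, α i) => f i (z i)) (iIndepFun_pi fun i => (hf i).aemeasurable)
    fun i => (hf i).comp (measurable_pi_apply i)).trans ?_
  exact Finset.prod_congr rfl fun i _ => (measurePreserving_eval ν i).lintegral_comp (hf i)

theorem pi_withDensity {ι : Type*} [Fintype ι] {α : ι → Type*} [∀ i, MeasurableSpace (α i)]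
    {ν : ∀ i, Measure (α i)} [∀ i, IsProbabilityMeasure (ν i)] {f : ∀ i, α i → ENNReal}
    (hf : ∀ i, Measurable (f i)) [∀ i, SigmaFinite ((ν i).withDensity (f i))] :
    Measure.pi (fun i => (ν i).withDensity (f i)) =
      (Measure.pi ν).withDensity fun z => ∏ i, f i (z i) := by
  refine Measure.pi_eq fun s hs => ?_
  have hind : (Set.univ.pi s).indicator (fun z => ∏ i, f i (z i)) =
      fun z => ∏ i, (s i).indicator (f i) (z i) := by
    funext z
    by_cases hz : z ∈ Set.univ.pi s
    · rw [Set.indicator_of_mem hz]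
      exact Finset.prod_congr rfl fun i _ => (Set.indicator_of_mem (hz i trivial) _).symm
    · rw [Set.indicator_of_notMem hz]
      obtain ⟨i, hi⟩ : ∃ i, z i ∉ s i := by simpa [Set.mem_pi] using hz
      exact (Finset.prod_eq_zero (Finset.mem_univ i) (Set.indicator_of_notMem hi _)).symm
  rw [withDensity_apply _ (.univ_pi hs), ← lintegral_indicator (.univ_pi hs), hind,
    lintegral_pi_prod fun i => (hf i).indicator (hs i)]
  exact Finset.prod_congr rfl fun i _ => by
    rw [withDensity_apply _ (hs i), lintegral_indicator (hs i)]

theorem gaussianReal_eq_withDensity_gaussianReal {a b : ℝ} (ha : 0 < a) (hb : 0 < b) :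
    gaussianReal 0 a.toNNReal = (gaussianReal 0 b.toNNReal).withDensity fun z =>
      ENNReal.ofReal (√(b / a) * Real.exp ((b⁻¹ - a⁻¹) * z ^ 2 / 2)) := by
  rw [gaussianReal_of_var_ne_zero _ (by simpa using ha),
    gaussianReal_of_var_ne_zero _ (by simpa using hb),
    ← withDensity_mul _ (by fun_prop) (by fun_prop)]
  congr 1
  funext z
  simp only [Pi.mul_apply, gaussianPDF, gaussianPDFReal, sub_zero]
  rw [← ENNReal.ofReal_mul (by positivity), Real.coe_toNNReal _ ha.le, Real.coe_toNNReal _ hb.le]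
  congr 1
  have hnorm : (√(2 * Real.pi * a))⁻¹ = (√(2 * Real.pi * b))⁻¹ * √(b / a) := by
    rw [← Real.sqrt_inv, ← Real.sqrt_inv, ← Real.sqrt_mul (by positivity)]
    congr 1
    field_simp
  have hexp : Real.exp (-z ^ 2 / (2 * a)) =
      Real.exp (-z ^ 2 / (2 * b)) * Real.exp ((b⁻¹ - a⁻¹) * z ^ 2 / 2) := by
    rw [← Real.exp_add]
    congr 1
    field_simp
    ring
  rw [hnorm, hexp]
  ring

theorem prod_sqrt_mul_exp_le {ι : Type*} [Fintype ι] {r c z : ι → ℝ} (hr : ∀ i, 0 ≤ r i)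
    {M x : ℝ} (hM : 0 ≤ M) (hc : ∀ i, c i ≤ M) (hz : ∑ i, z i ^ 2 ≤ x) :
    ∏ i, (√(r i) * Real.exp (c i * z i ^ 2 / 2)) ≤ √(∏ i, r i) * Real.exp (M * x / 2) := by
  rw [Finset.prod_mul_distrib, ← Real.exp_sum, ← Real.sqrt_prod _ fun i _ => hr i]
  gcongr
  calc ∑ i, c i * z i ^ 2 / 2 ≤ ∑ i, M * z i ^ 2 / 2 := by gcongr with i; exact hc i
    _ = M * (∑ i, z i ^ 2) / 2 := by rw [Finset.mul_sum, Finset.sum_div]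
    _ ≤ M * x / 2 := by gcongr

variable {a b : ℕ → ℝ} {M : ℝ}

theorem gaussianBall_le (ha : ∀ k, 0 < a k) (hb : ∀ k, 0 < b k) (hM : 0 ≤ M)
    (hab : ∀ k, (b k)⁻¹ - (a k)⁻¹ ≤ M) (n : ℕ) (x : ℝ) :
    gaussianBall a n x ≤
      √(∏ k ∈ Finset.range n, b k / a k) * Real.exp (M * x / 2) * gaussianBall b n x := by
  set D := fun (k : Fin n) (z : ℝ) =>
    ENNReal.ofReal (√(b k / a k) * Real.exp (((b k)⁻¹ - (a k)⁻¹) * z ^ 2 / 2)) with hD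
  have hdens : ∀ k : Fin n, gaussianReal 0 (a k).toNNReal =
      (gaussianReal 0 (b k).toNNReal).withDensity (D k) := fun k =>
    gaussianReal_eq_withDensity_gaussianReal (ha k) (hb k)
  have : ∀ k : Fin n, IsProbabilityMeasure ((gaussianReal 0 (b k).toNNReal).withDensity (D k)) :=
    fun k => hdens k ▸ inferInstance
  set C := √(∏ k ∈ Finset.range n, b k / a k) * Real.exp (M * x / 2) with hC
  have hball : MeasurableSet {z : Fin n → ℝ | ∑ k, z k ^ 2 ≤ x} :=
    measurableSet_le (by fun_prop) measurable_const
  rw [gaussianBall, gaussianBall, measureReal_def, measureReal_def,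
    ← ENNReal.toReal_ofReal (show 0 ≤ C by positivity), ← ENNReal.toReal_mul]
  refine ENNReal.toReal_mono (ENNReal.mul_ne_top ENNReal.ofReal_ne_top (measure_ne_top _ _)) ?_
  simp_rw [hdens]
  rw [pi_withDensity fun k => by fun_prop, withDensity_apply _ hball, ← setLIntegral_const]
  refine setLIntegral_mono measurable_const fun z hz => ?_
  rw [hD, ← ENNReal.ofReal_prod_of_nonneg fun k _ => by positivity]
  refine ENNReal.ofReal_le_ofReal ?_
  rw [hC, Finset.prod_range fun k => b k / a k]
  exact prod_sqrt_mul_exp_le (fun k : Fin n => (div_pos (hb k) (ha k)).le) hM (fun k => hab k) hz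

theorem sqrt_mul_gaussianBall_le (ha : ∀ k, 0 < a k) (hb : ∀ k, 0 < b k) (hM : 0 ≤ M)
    (hab : ∀ k, (a k)⁻¹ - (b k)⁻¹ ≤ M) (n : ℕ) (x : ℝ) :
    √(∏ k ∈ Finset.range n, b k / a k) * gaussianBall b n x ≤
      Real.exp (M * x / 2) * gaussianBall a n x := by
  have hpos : 0 < ∏ k ∈ Finset.range n, b k / a k :=
    Finset.prod_pos fun k _ => div_pos (hb k) (ha k)
  have hinv : ∏ k ∈ Finset.range n, a k / b k = (∏ k ∈ Finset.range n, b k / a k)⁻¹ := by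
    simp_rw [← Finset.prod_inv_distrib, inv_div]
  have h := gaussianBall_le hb ha hM hab n x
  rwa [hinv, Real.sqrt_inv, mul_assoc, ← div_eq_inv_mul, le_div_iff₀' (Real.sqrt_pos.2 hpos)] at h

theorem isEquivalent_of_le_exp_mul {f g : ℝ → ℝ} (hM : 0 ≤ M) (hg : ∀ x, 0 ≤ g x)
    (hfg : ∀ x, f x ≤ Real.exp (M * x / 2) * g x) (hgf : ∀ x, g x ≤ Real.exp (M * x / 2) * f x) :
    f ~[𝓝[>] 0] g := by
  refine isLittleO_iff.2 fun c hc => ?_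
  have hlim : Tendsto (fun x : ℝ => Real.exp (M * x / 2) - 1) (𝓝[>] 0) (𝓝 0) := by
    have hcont : Continuous fun x : ℝ => Real.exp (M * x / 2) - 1 := by fun_prop
    simpa using (hcont.tendsto 0).mono_left nhdsWithin_le_nhds
  filter_upwards [hlim.eventually_lt_const hc, self_mem_nhdsWithin] with x hx hx0
  rw [Pi.sub_apply, Real.norm_eq_abs, Real.norm_of_nonneg (hg x), abs_le]
  have hone : 1 ≤ Real.exp (M * x / 2) :=
    Real.one_le_exp (div_nonneg (mul_nonneg hM (le_of_lt hx0)) two_pos.le)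
  have hxg := mul_le_mul_of_nonneg_right hx.le (hg x)
  constructor
  · nlinarith [hgf x, mul_le_mul_of_nonneg_right hone (hg x)]
  · nlinarith [hfg x]

theorem gaussianSeriesBall_isEquivalent (ha : ∀ k, 0 < a k) (hb : ∀ k, 0 < b k)
    (hab : ∀ k, |(a k)⁻¹ - (b k)⁻¹| ≤ M) {C : ℝ}
    (hC : Tendsto (fun n => ∏ k ∈ Finset.range n, b k / a k) atTop (𝓝 C)) :
    gaussianSeriesBall a ~[𝓝[>] 0] fun x => √C * gaussianSeriesBall b x := by
  have hM : 0 ≤ M := (abs_nonneg _).trans (hab 0)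
  refine isEquivalent_of_le_exp_mul hM
    (fun x => mul_nonneg (Real.sqrt_nonneg _) (gaussianSeriesBall_nonneg b x)) (fun x => ?_)
    fun x => ?_
  · rw [← mul_assoc, mul_comm (Real.exp _)]
    exact le_of_tendsto_of_tendsto' (tendsto_gaussianBall a x)
      ((hC.sqrt.mul_const _).mul (tendsto_gaussianBall b x)) fun n =>
        gaussianBall_le ha hb hM (fun k => by linarith [(abs_le.1 (hab k)).1]) n x
  · exact le_of_tendsto_of_tendsto' (hC.sqrt.mul (tendsto_gaussianBall b x))
      ((tendsto_gaussianBall a x).const_mul _) fun n =>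
        sqrt_mul_gaussianBall_le ha hb hM (fun k => (abs_le.1 (hab k)).2) n x

end Comparison

section LaplaceTransform

theorem measure_ext_of_mgf_eventuallyEq {μ ν : Measure ℝ}
    (hμ : 0 ∈ interior (integrableExpSet id μ)) (hν : 0 ∈ interior (integrableExpSet id ν))
    (h : mgf id μ =ᶠ[𝓝 0] mgf id ν) : μ = ν := by
  have hfin : ∀ {ρ : Measure ℝ}, 0 ∈ interior (integrableExpSet id ρ) → IsFiniteMeasure ρ := by
    intro ρ hρ
    have h_int : (0 : ℝ) ∈ integrableExpSet id ρ := interior_subset hρ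
    simp only [integrableExpSet, Set.mem_ofPred, zero_mul, Real.exp_zero] at h_int
    exact (integrable_const_iff_isFiniteMeasure one_ne_zero).1 h_int
  have := hfin hμ
  have := hfin hν
  set S := interior (integrableExpSet id μ) ∩ interior (integrableExpSet id ν)
  have hstrip : IsPreconnected {z : ℂ | z.re ∈ S} :=
    ((convex_integrableExpSet.interior.inter convex_integrableExpSet.interior).linear_preimage
      Complex.reLm).isPreconnected
  have hreal : Tendsto (fun t : ℝ => (t : ℂ)) (𝓝[≠] 0) (𝓝[≠] 0) :=
    tendsto_nhdsWithin_iff.2 ⟨(Complex.continuous_ofReal.tendsto' 0 0 Complex.ofReal_zero).mono_left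
      nhdsWithin_le_nhds, by filter_upwards [self_mem_nhdsWithin] with t ht using by simpa using ht⟩
  have heq : Set.EqOn (complexMGF id μ) (complexMGF id ν) {z : ℂ | z.re ∈ S} := by
    refine (analyticOnNhd_complexMGF.mono fun z hz => hz.1).eqOn_of_preconnected_of_frequently_eq
      (analyticOnNhd_complexMGF.mono fun z hz => hz.2) hstrip (z₀ := 0) ⟨hμ, hν⟩
      (hreal.frequently (Eventually.frequently ?_))
    filter_upwards [nhdsWithin_le_nhds h] with t ht
    rw [complexMGF_ofReal, complexMGF_ofReal, ht]
  refine Measure.ext_of_charFun (funext fun t => ?_)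
  rw [← complexMGF_id_mul_I, ← complexMGF_id_mul_I]
  exact heq (by simpa using ⟨hμ, hν⟩)

/-- The Laplace transform on the half-line of a nonnegative, possibly infinite, function. -/
noncomputable def laplaceTransform (f : ℝ → ENNReal) (l : ℝ) : ENNReal :=
  ∫⁻ x in Set.Ioi 0, ENNReal.ofReal (Real.exp (-l * x)) * f x

/-- The measure `exp (-x) f(x) dx` on the half-line. Its moment generating function at `t` is the
Laplace transform of `f` at `1 - t`. -/
noncomputable def expWeightedMeasure (f : ℝ → ENNReal) : Measure ℝ :=
  (volume.restrict (Set.Ioi 0)).withDensity fun x => ENNReal.ofReal (Real.exp (-1 * x)) * f x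

variable {f g : ℝ → ENNReal}

theorem lintegral_exp_mul_expWeightedMeasure (hf : AEMeasurable f (volume.restrict (Set.Ioi 0)))
    (t : ℝ) :
    ∫⁻ x, ENNReal.ofReal (Real.exp (t * x)) ∂expWeightedMeasure f =
      laplaceTransform f (1 - t) := by
  refine (lintegral_withDensity_eq_lintegral_mul₀ (.mul (by fun_prop) hf) (by fun_prop)).trans ?_
  refine lintegral_congr fun x => ?_
  simp only [Pi.mul_apply]
  rw [mul_right_comm, ← ENNReal.ofReal_mul (Real.exp_pos _).le, ← Real.exp_add]
  congr 3
  ring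

theorem mgf_expWeightedMeasure (hf : AEMeasurable f (volume.restrict (Set.Ioi 0))) (t : ℝ) :
    mgf id (expWeightedMeasure f) t = (laplaceTransform f (1 - t)).toReal := by
  rw [mgf, integral_eq_lintegral_of_nonneg_ae (.of_forall fun _ => (Real.exp_pos _).le)
    (by fun_prop)]
  exact congrArg _ (lintegral_exp_mul_expWeightedMeasure hf t)

theorem zero_mem_interior_integrableExpSet_expWeightedMeasure
    (hf : AEMeasurable f (volume.restrict (Set.Ioi 0)))
    (hfin : ∀ l, 0 < l → laplaceTransform f l ≠ ⊤) :
    0 ∈ interior (integrableExpSet id (expWeightedMeasure f)) := by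
  have hsub : Set.Iio 1 ⊆ integrableExpSet id (expWeightedMeasure f) := by
    refine fun t ht => ⟨by fun_prop, ?_⟩
    rw [hasFiniteIntegral_iff_ofReal (.of_forall fun _ => (Real.exp_pos _).le)]
    exact (lintegral_exp_mul_expWeightedMeasure hf t).trans_lt (hfin _ (sub_pos.2 ht)).lt_top
  exact interior_maximal hsub isOpen_Iio (Set.mem_Iio.2 one_pos)

theorem ae_eq_of_laplaceTransform_eq (hf : AEMeasurable f (volume.restrict (Set.Ioi 0)))
    (hg : AEMeasurable g (volume.restrict (Set.Ioi 0)))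
    (hfin : ∀ l, 0 < l → laplaceTransform f l ≠ ⊤)
    (h : ∀ l, 0 < l → laplaceTransform f l = laplaceTransform g l) :
    f =ᵐ[volume.restrict (Set.Ioi 0)] g := by
  have hmgf : mgf id (expWeightedMeasure f) =ᶠ[𝓝 0] mgf id (expWeightedMeasure g) := by
    filter_upwards [eventually_lt_nhds one_pos] with t ht
    rw [mgf_expWeightedMeasure hf, mgf_expWeightedMeasure hg, h _ (sub_pos.2 ht)]
  have hmeas : expWeightedMeasure f = expWeightedMeasure g := measure_ext_of_mgf_eventuallyEq
    (zero_mem_interior_integrableExpSet_expWeightedMeasure hf hfin)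
    (zero_mem_interior_integrableExpSet_expWeightedMeasure hg fun l hl => h l hl ▸ hfin l hl) hmgf
  filter_upwards [(withDensity_eq_iff (.mul (by fun_prop) hf) (.mul (by fun_prop) hg)
    (hfin 1 one_pos)).1 hmeas] with x hx
  exact (ENNReal.mul_right_inj (ENNReal.ofReal_pos.2 (Real.exp_pos _)).ne'
    ENNReal.ofReal_ne_top).1 hx

theorem lintegral_Ioi_exp_neg_mul {l : ℝ} (hl : 0 < l) (c : ℝ) :
    ∫⁻ x in Set.Ioi c, ENNReal.ofReal (Real.exp (-l * x)) =
      ENNReal.ofReal (l⁻¹ * Real.exp (-l * c)) := by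
  have hl' : -l < 0 := neg_lt_zero.2 hl
  rw [← ofReal_integral_eq_lintegral_ofReal (integrableOn_exp_mul_Ioi hl' c)
    (.of_forall fun _ => (Real.exp_pos _).le), integral_exp_mul_Ioi hl', neg_div_neg_eq,
    div_eq_inv_mul]

theorem laplaceTransform_const_mul (c : ENNReal)
    (hf : AEMeasurable f (volume.restrict (Set.Ioi 0))) (l : ℝ) :
    laplaceTransform (fun x => c * f x) l = c * laplaceTransform f l := by
  simp_rw [laplaceTransform, mul_left_comm _ c]
  exact lintegral_const_mul'' _ (.mul (by fun_prop) hf)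

theorem laplaceTransform_tsum {F : ℕ → ℝ → ENNReal}
    (hF : ∀ n, AEMeasurable (F n) (volume.restrict (Set.Ioi 0))) (l : ℝ) :
    laplaceTransform (fun x => ∑' n, F n x) l = ∑' n, laplaceTransform (F n) l := by
  simp_rw [laplaceTransform, ← ENNReal.tsum_mul_left]
  exact lintegral_tsum fun n => .mul (by fun_prop) (hF n)

theorem laplaceTransform_lintegral {α : Type*} [MeasurableSpace α] {μ : Measure α} [SFinite μ]
    {F : α → ℝ → ENNReal} (hF : Measurable (Function.uncurry F)) (l : ℝ) :
    laplaceTransform (fun x => ∫⁻ z, F z x ∂μ) l = ∫⁻ z, laplaceTransform (F z) l ∂μ := by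
  have hswap : Measurable fun p : ℝ × α => F p.2 p.1 := hF.comp measurable_swap
  have hinner : ∀ x, ENNReal.ofReal (Real.exp (-l * x)) * ∫⁻ z, F z x ∂μ =
      ∫⁻ z, ENNReal.ofReal (Real.exp (-l * x)) * F z x ∂μ :=
    fun x => (lintegral_const_mul _ (hF.comp (by fun_prop : Measurable fun z => (z, x)))).symm
  simp_rw [laplaceTransform, hinner]
  exact lintegral_lintegral_swap (f := fun x z => ENNReal.ofReal (Real.exp (-l * x)) * F z x)
    (Measurable.mul (by fun_prop) hswap).aemeasurable

theorem laplaceTransform_indicator_Ici {c l : ℝ} (hc : 0 ≤ c) (hl : 0 < l) :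
    laplaceTransform ((Set.Ici c).indicator 1) l =
      ENNReal.ofReal (l⁻¹ * Real.exp (-l * c)) := by
  have hset : (Set.Ici c ∩ Set.Ioi 0 : Set ℝ) =ᵐ[volume] Set.Ioi c :=
    (LE.le.eventuallyLE Set.inter_subset_left |>.trans Ioi_ae_eq_Ici.symm.le).antisymm
      (LE.le.eventuallyLE fun x hx => ⟨Set.Ioi_subset_Ici_self hx, hc.trans_lt hx⟩)
  rw [← lintegral_Ioi_exp_neg_mul hl, ← Measure.restrict_congr_set hset,
    ← Measure.restrict_restrict measurableSet_Ici, ← lintegral_indicator measurableSet_Ici]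
  refine lintegral_congr fun x => ?_
  by_cases hx : x ∈ Set.Ici c <;> simp [hx]

theorem laplaceTransform_measure_le {α : Type*} [MeasurableSpace α] {μ : Measure α} [SFinite μ]
    {N : α → ℝ} (hN : Measurable N) (hN0 : ∀ z, 0 ≤ N z) {l : ℝ} (hl : 0 < l) :
    laplaceTransform (fun x => μ {z | N z ≤ x}) l =
      ENNReal.ofReal l⁻¹ * ∫⁻ z, ENNReal.ofReal (Real.exp (-l * N z)) ∂μ := by
  have hmeas : ∀ x, μ {z | N z ≤ x} = ∫⁻ z, (Set.Ici (N z)).indicator 1 x ∂μ := fun x =>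
    (lintegral_indicator_one (measurableSet_le hN measurable_const)).symm
  have hjoint : Measurable (Function.uncurry fun z x => (Set.Ici (N z)).indicator
      (1 : ℝ → ENNReal) x) :=
    (measurable_const (a := (1 : ENNReal))).indicator
      (measurableSet_le (by fun_prop : Measurable fun p : α × ℝ => N p.1) measurable_snd)
  simp_rw [hmeas]
  rw [laplaceTransform_lintegral hjoint]
  simp_rw [laplaceTransform_indicator_Ici (hN0 _) hl, ENNReal.ofReal_mul (inv_nonneg.2 hl.le)]
  exact lintegral_const_mul _ (by fun_prop)

theorem lintegral_exp_neg_mul_sq_gaussianReal {b l : ℝ} (hb : 0 < b) (hl : 0 < l) :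
    ∫⁻ z, ENNReal.ofReal (Real.exp (-l * z ^ 2)) ∂gaussianReal 0 b.toNNReal =
      ENNReal.ofReal (√(1 + 2 * l * b))⁻¹ := by
  have htotal : gaussianReal 0 (b / (1 + 2 * l * b)).toNNReal Set.univ = 1 := measure_univ
  have hratio : b / (b / (1 + 2 * l * b)) = 1 + 2 * l * b := by field_simp
  have hexp : ∀ z : ℝ, (b⁻¹ - (b / (1 + 2 * l * b))⁻¹) * z ^ 2 / 2 = -l * z ^ 2 := fun z => by
    field_simp
    ring
  rw [gaussianReal_eq_withDensity_gaussianReal (b := b) (by positivity) hb,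
    withDensity_apply _ .univ, Measure.restrict_univ, hratio] at htotal
  simp_rw [hexp, ENNReal.ofReal_mul (Real.sqrt_nonneg _)] at htotal
  rw [lintegral_const_mul _ (by fun_prop), mul_comm] at htotal
  rw [ENNReal.ofReal_inv_of_pos (by positivity)]
  exact ENNReal.eq_inv_of_mul_eq_one_left htotal

variable {b : ℕ → ℝ} {l : ℝ}

theorem laplaceTransform_gaussianBall (hb : ∀ k, 0 < b k) (hl : 0 < l) (n : ℕ) :
    laplaceTransform (fun x => ENNReal.ofReal (gaussianBall b n x)) l =
      ENNReal.ofReal (l⁻¹ * (√(∏ k ∈ Finset.range n, (1 + 2 * l * b k)))⁻¹) := by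
  have hfactor : ∀ k, 0 ≤ 1 + 2 * l * b k := fun k => by have := hb k; positivity
  have hball : ∀ x, ENNReal.ofReal (gaussianBall b n x) =
      Measure.pi (fun k : Fin n => gaussianReal 0 (b k).toNNReal) {z | ∑ k, z k ^ 2 ≤ x} :=
    fun x => ofReal_measureReal
  simp_rw [hball]
  rw [laplaceTransform_measure_le (by fun_prop) (fun z => Finset.sum_nonneg fun _ _ => sq_nonneg _)
    hl, ENNReal.ofReal_mul (inv_nonneg.2 hl.le), Real.sqrt_prod _ fun k _ => hfactor k,
    ← Finset.prod_inv_distrib, ENNReal.ofReal_prod_of_nonneg fun k _ => by positivity,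
    Finset.prod_range]
  simp_rw [fun k : Fin n => (lintegral_exp_neg_mul_sq_gaussianReal (hb k) hl).symm]
  rw [← lintegral_pi_prod fun _ => by fun_prop]
  simp_rw [Finset.mul_sum, Real.exp_sum,
    ENNReal.ofReal_prod_of_nonneg fun _ _ => (Real.exp_pos _).le]

theorem laplaceTransform_gaussianSeriesBall (hb : ∀ k, 0 < b k) (hl : 0 < l) {c : ℝ}
    (hc : Tendsto (fun n => ∏ k ∈ Finset.range n, (1 + 2 * l * b k)) atTop (𝓝 c)) :
    laplaceTransform (fun x => ENNReal.ofReal (gaussianSeriesBall b x)) l =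
      ENNReal.ofReal (l⁻¹ * (√c)⁻¹) := by
  have hc0 : 0 < c := one_pos.trans_le (ge_of_tendsto' hc fun n => Finset.one_le_prod fun k _ => by
    have := hb k
    exact le_add_of_nonneg_right (by positivity))
  have hlim : Tendsto (fun n => laplaceTransform (fun x => ENNReal.ofReal (gaussianBall b n x)) l)
      atTop (𝓝 (laplaceTransform (fun x => ENNReal.ofReal (gaussianSeriesBall b x)) l)) := by
    refine tendsto_lintegral_of_dominated_convergence
      (fun x => ENNReal.ofReal (Real.exp (-l * x))) (fun n => ?_) (fun n => ?_) ?_ ?_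
    · exact .mul (by fun_prop) (gaussianBall_mono b n).measurable.ennreal_ofReal
    · exact .of_forall fun x => mul_le_of_le_one_right'
        (ENNReal.ofReal_le_one.2 (gaussianBall_le_one b n x))
    · rw [lintegral_Ioi_exp_neg_mul hl]
      exact ENNReal.ofReal_ne_top
    · exact .of_forall fun x => ENNReal.Tendsto.const_mul
        (ENNReal.tendsto_ofReal (tendsto_gaussianBall b x)) (.inr ENNReal.ofReal_ne_top)
  simp_rw [laplaceTransform_gaussianBall hb hl] at hlim
  exact tendsto_nhds_unique hlim (ENNReal.tendsto_ofReal
    ((hc.sqrt.inv₀ (Real.sqrt_pos.2 hc0).ne').const_mul _))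

end LaplaceTransform

section HeatKernel

theorem lintegral_Ioi_of_hasDerivAt_of_nonneg {g g' : ℝ → ℝ} {a A B : ℝ}
    (hderiv : ∀ x ∈ Set.Ioi a, HasDerivAt g (g' x) x) (hg' : ∀ x, 0 ≤ g' x)
    (hA : Tendsto g (𝓝[>] a) (𝓝 A)) (hB : Tendsto g atTop (𝓝 B)) :
    ∫⁻ x in Set.Ioi a, ENNReal.ofReal (g' x) = ENNReal.ofReal (B - A) := by
  have hcont : ContinuousWithinAt (Function.update g a A) (Set.Ici a) a := by
    rwa [continuousWithinAt_update_same, Set.Ici_sdiff_left]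
  have hderiv' : ∀ x ∈ Set.Ioi a, HasDerivAt (Function.update g a A) (g' x) x := fun x hx =>
    (hderiv x hx).congr_of_eventuallyEq <| by
      filter_upwards [isOpen_ne.mem_nhds (ne_of_gt hx)] with z hz using Function.update_of_ne hz _ _
  have hB' : Tendsto (Function.update g a A) atTop (𝓝 B) := hB.congr' <| by
    filter_upwards [eventually_gt_atTop a] with x hx using (Function.update_of_ne hx.ne' _ _).symm
  rw [← ofReal_integral_eq_lintegral_ofReal
    (integrableOn_Ioi_deriv_of_nonneg hcont hderiv' (fun x _ => hg' x) hB') (.of_forall hg'),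
    integral_Ioi_of_hasDerivAt_of_nonneg hcont hderiv' (fun x _ => hg' x) hB',
    Function.update_self]

/-- The Gaussian density `(2πx)^(-1/2) exp (-a²/(2x))` at `a`, as a function of the variance `x`. -/
noncomputable def heatKernel (a x : ℝ) : ℝ :=
  (√(2 * Real.pi * x))⁻¹ * Real.exp (-(a ^ 2) / (2 * x))

theorem heatKernel_nonneg (a x : ℝ) : 0 ≤ heatKernel a x := by
  rw [heatKernel]
  positivity

theorem measurable_heatKernel : Measurable fun p : ℝ × ℝ => heatKernel p.1 p.2 := by
  unfold heatKernel
  fun_prop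

theorem heatKernel_add {x : ℝ} (hx : x ≠ 0) (a r : ℝ) : heatKernel (a + r) x =
    heatKernel a x * (Real.exp (-(a / x * r)) * Real.exp (-((2 * x)⁻¹ * r ^ 2))) := by
  have hexp : -((a + r) ^ 2) / (2 * x) =
      -(a ^ 2) / (2 * x) + (-(a / x * r) + -((2 * x)⁻¹ * r ^ 2)) := by
    field_simp
    ring
  rw [heatKernel, heatKernel, hexp, Real.exp_add, Real.exp_add, ← mul_assoc]

/-- The integral of the unnormalised Gaussian density `exp (-v²/2)` from `0` to `u`. -/
noncomputable def gaussianPrimitive (u : ℝ) : ℝ :=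
  ∫ v in (0 : ℝ)..u, Real.exp (-(1 / 2) * v ^ 2)

theorem hasDerivAt_gaussianPrimitive (u : ℝ) :
    HasDerivAt gaussianPrimitive (Real.exp (-(1 / 2) * u ^ 2)) u := by
  have hcont : Continuous fun v : ℝ => Real.exp (-(1 / 2) * v ^ 2) := by fun_prop
  exact intervalIntegral.integral_hasDerivAt_right (hcont.intervalIntegrable _ _)
    hcont.stronglyMeasurable.stronglyMeasurableAtFilter hcont.continuousAt

theorem gaussianPrimitive_neg (u : ℝ) : gaussianPrimitive (-u) = -gaussianPrimitive u := by
  have h := intervalIntegral.integral_comp_neg (a := 0) (b := u)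
    fun v : ℝ => Real.exp (-(1 / 2) * v ^ 2)
  simp only [neg_sq, neg_zero] at h
  rw [gaussianPrimitive, intervalIntegral.integral_symm, ← h, gaussianPrimitive]

theorem tendsto_gaussianPrimitive_atTop :
    Tendsto gaussianPrimitive atTop (𝓝 (√(2 * Real.pi) / 2)) := by
  have h := intervalIntegral_tendsto_integral_Ioi 0
    (integrable_exp_neg_mul_sq (b := 1 / 2) (by norm_num)).integrableOn tendsto_id
  rw [integral_gaussian_Ioi] at h
  convert! h using 4
  ring

theorem tendsto_gaussianPrimitive_atBot :
    Tendsto gaussianPrimitive atBot (𝓝 (-(√(2 * Real.pi) / 2))) :=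
  (tendsto_gaussianPrimitive_atTop.comp tendsto_neg_atBot_atTop).neg.congr fun u => by
    rw [Function.comp_apply, gaussianPrimitive_neg, neg_neg]

/-- An antiderivative in `x` of `exp (-(y²/2) x) * heatKernel a x`, found by completing the squares
`(y√x ± a/√x)²`. -/
noncomputable def heatPrimitive (a y x : ℝ) : ℝ :=
  (√(2 * Real.pi) * y)⁻¹ * (Real.exp (-(a * y)) * gaussianPrimitive (y * √x - a / √x) +
    Real.exp (a * y) * gaussianPrimitive (y * √x + a / √x))

variable {a y x : ℝ}

theorem exp_neg_half_mul_sq_add (hx : 0 < x) (a y : ℝ) :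
    Real.exp (-(1 / 2) * (y * √x + a / √x) ^ 2) = Real.exp (-(a * y)) *
      (Real.exp (-(y ^ 2 / 2) * x) * Real.exp (-(a ^ 2) / (2 * x))) := by
  have hr : √x ≠ 0 := (Real.sqrt_pos.2 hx).ne'
  have hsq : (y * √x + a / √x) ^ 2 = y ^ 2 * x + 2 * (a * y) + a ^ 2 / x := by
    rw [add_sq, mul_pow, div_pow, Real.sq_sqrt hx.le]
    field_simp
  rw [← Real.exp_add, ← Real.exp_add, hsq]
  congr 1
  field_simp
  ring

theorem hasDerivAt_heatPrimitive (hy : y ≠ 0) (hx : 0 < x) (a : ℝ) :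
    HasDerivAt (heatPrimitive a y) (Real.exp (-(y ^ 2 / 2) * x) * heatKernel a x) x := by
  have hsqrt : HasDerivAt (fun x => √x) (1 / (2 * √x)) x := Real.hasDerivAt_sqrt hx.ne'
  have hr : 0 < √x := Real.sqrt_pos.2 hx
  have hinv := (hasDerivAt_const x a).div hsqrt hr.ne'
  have hminus := (hasDerivAt_gaussianPrimitive _).comp x ((hsqrt.const_mul y).sub hinv)
  have hplus := (hasDerivAt_gaussianPrimitive _).comp x ((hsqrt.const_mul y).add hinv)
  refine (((hminus.const_mul (Real.exp (-(a * y)))).add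
    (hplus.const_mul (Real.exp (a * y)))).const_mul (√(2 * Real.pi) * y)⁻¹).congr_deriv ?_
  have hsq_minus := exp_neg_half_mul_sq_add hx (-a) y
  rw [neg_div, ← sub_eq_add_neg, neg_mul a, neg_neg, neg_sq a] at hsq_minus
  have hexp : Real.exp (-(a * y)) * Real.exp (a * y) = 1 := by
    rw [← Real.exp_add, neg_add_cancel, Real.exp_zero]
  have : 0 < √(2 * Real.pi) := by positivity
  simp only [Pi.sub_apply, Pi.add_apply, Pi.div_apply]
  rw [hsq_minus, exp_neg_half_mul_sq_add hx, heatKernel,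
    Real.sqrt_mul (x := 2 * Real.pi) (by positivity)]
  generalize Real.exp (-(a * y)) = U at hexp ⊢
  generalize Real.exp (a * y) = V at hexp ⊢
  field_simp
  linear_combination (2 * y * √x ^ 2) * hexp

theorem tendsto_heatPrimitive_nhdsGT_zero (ha : 0 < a) (y : ℝ) :
    Tendsto (heatPrimitive a y) (𝓝[>] 0) (𝓝 ((√(2 * Real.pi) * y)⁻¹ *
      (Real.exp (-(a * y)) * -(√(2 * Real.pi) / 2) +
        Real.exp (a * y) * (√(2 * Real.pi) / 2)))) := by
  have hsqrt : Tendsto (fun x : ℝ => √x) (𝓝[>] 0) (𝓝[>] 0) :=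
    tendsto_nhdsWithin_iff.2 ⟨(Real.continuous_sqrt.tendsto' 0 0 Real.sqrt_zero).mono_left
      nhdsWithin_le_nhds, eventually_mem_nhdsWithin.mono fun x hx => Real.sqrt_pos.2 hx⟩
  have hdiv : Tendsto (fun x : ℝ => a / √x) (𝓝[>] 0) atTop := by
    simp_rw [div_eq_mul_inv]
    exact (tendsto_inv_nhdsGT_zero.comp hsqrt).const_mul_atTop ha
  have hmul : Tendsto (fun x : ℝ => y * √x) (𝓝[>] 0) (𝓝 (y * 0)) :=
    (hsqrt.mono_right nhdsWithin_le_nhds).const_mul y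
  have hminus : Tendsto (fun x : ℝ => y * √x - a / √x) (𝓝[>] 0) atBot := by
    simp_rw [sub_eq_add_neg]
    exact hmul.add_atBot (tendsto_neg_atTop_atBot.comp hdiv)
  exact (((tendsto_gaussianPrimitive_atBot.comp hminus).const_mul _).add
    ((tendsto_gaussianPrimitive_atTop.comp (hmul.add_atTop hdiv)).const_mul _)).const_mul _

theorem tendsto_heatPrimitive_atTop (hy : 0 < y) (a : ℝ) :
    Tendsto (heatPrimitive a y) atTop (𝓝 ((√(2 * Real.pi) * y)⁻¹ *
      (Real.exp (-(a * y)) * (√(2 * Real.pi) / 2) +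
        Real.exp (a * y) * (√(2 * Real.pi) / 2)))) := by
  have hdiv : Tendsto (fun x : ℝ => a / √x) atTop (𝓝 0) :=
    Tendsto.div_atTop tendsto_const_nhds Real.tendsto_sqrt_atTop
  have hmul : Tendsto (fun x : ℝ => y * √x) atTop atTop :=
    Real.tendsto_sqrt_atTop.const_mul_atTop hy
  have hminus : Tendsto (fun x : ℝ => y * √x - a / √x) atTop atTop := by
    simp_rw [sub_eq_add_neg]
    exact hmul.atTop_add hdiv.neg
  exact (((tendsto_gaussianPrimitive_atTop.comp hminus).const_mul _).add
    ((tendsto_gaussianPrimitive_atTop.comp (hmul.atTop_add hdiv)).const_mul _)).const_mul _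

theorem laplaceTransform_heatKernel (ha : 0 < a) (hy : 0 < y) :
    laplaceTransform (fun x => ENNReal.ofReal (heatKernel a x)) (y ^ 2 / 2) =
      ENNReal.ofReal (Real.exp (-(a * y)) / y) := by
  simp_rw [laplaceTransform, ← ENNReal.ofReal_mul (Real.exp_pos _).le]
  rw [lintegral_Ioi_of_hasDerivAt_of_nonneg (fun x hx => hasDerivAt_heatPrimitive hy.ne' hx a)
    (fun x => mul_nonneg (Real.exp_pos _).le (heatKernel_nonneg a x))
    (tendsto_heatPrimitive_nhdsGT_zero ha y) (tendsto_heatPrimitive_atTop hy a)]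
  congr 1
  field_simp
  ring

end HeatKernel

section HeatMixture

theorem lintegral_rpow_mul_exp_neg_mul_Ioi {s c : ℝ} (hs : 0 < s) (hc : 0 < c) :
    ∫⁻ r in Set.Ioi 0, ENNReal.ofReal (r ^ (s - 1) * Real.exp (-(c * r))) =
      ENNReal.ofReal ((1 / c) ^ s * Real.Gamma s) := by
  have h := Real.integral_rpow_mul_exp_neg_mul_Ioi hs hc
  have hpos : 0 < (1 / c) ^ s * Real.Gamma s := mul_pos (by positivity) (Real.Gamma_pos_of_pos hs)
  rw [← ofReal_integral_eq_lintegral_ofReal (Integrable.of_integral_ne_zero (h ▸ hpos.ne')), h]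
  filter_upwards [ae_restrict_mem measurableSet_Ioi] with r (hr : 0 < r)
  positivity

theorem lintegral_rpow_mul_exp_mul_exp_neg_mul_sq_le {s c δ : ℝ} (hs : 0 < s) (hc : 0 < c)
    (hδ : 0 ≤ δ) :
    ∫⁻ r in Set.Ioi 0, ENNReal.ofReal (r ^ (s - 1) *
        (Real.exp (-(c * r)) * Real.exp (-(δ * r ^ 2)))) ≤
      ENNReal.ofReal ((1 / c) ^ s * Real.Gamma s) := by
  rw [← lintegral_rpow_mul_exp_neg_mul_Ioi hs hc]
  refine setLIntegral_mono (by fun_prop) fun r (hr : 0 < r) => ENNReal.ofReal_le_ofReal ?_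
  have hexp : Real.exp (-(δ * r ^ 2)) ≤ 1 := Real.exp_le_one_iff.2 (neg_nonpos.2 (by positivity))
  gcongr
  exact mul_le_of_le_one_right (Real.exp_pos _).le hexp

theorem le_lintegral_rpow_mul_exp_mul_exp_neg_mul_sq {s c δ : ℝ} (hs : 0 < s) (hc : 0 < c)
    (hδ : 0 ≤ δ) :
    ENNReal.ofReal ((1 / c) ^ s * Real.Gamma s * (1 - δ * (s * (s + 1)) / c ^ 2)) ≤
      ∫⁻ r in Set.Ioi 0, ENNReal.ofReal (r ^ (s - 1) *
        (Real.exp (-(c * r)) * Real.exp (-(δ * r ^ 2)))) := by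
  have hΓ : Real.Gamma (s + 2) = s * (s + 1) * Real.Gamma s := by
    rw [show s + 2 = s + 1 + 1 by ring, Real.Gamma_add_one (by positivity),
      Real.Gamma_add_one hs.ne']
    ring
  have hpow : (1 / c) ^ (s + 2) = (1 / c) ^ s * (1 / c) ^ 2 := by
    rw [← Real.rpow_add_natCast (by positivity)]
    norm_num
  have hsub : (1 / c) ^ s * Real.Gamma s * (1 - δ * (s * (s + 1)) / c ^ 2) =
      (1 / c) ^ s * Real.Gamma s - δ * ((1 / c) ^ (s + 2) * Real.Gamma (s + 2)) := by
    rw [hΓ, hpow]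
    field_simp
  have : 0 ≤ Real.Gamma (s + 2) := (Real.Gamma_pos_of_pos (by positivity)).le
  rw [hsub, ENNReal.ofReal_sub _ (by positivity), tsub_le_iff_right, ENNReal.ofReal_mul hδ,
    ← lintegral_rpow_mul_exp_neg_mul_Ioi hs hc,
    ← lintegral_rpow_mul_exp_neg_mul_Ioi (add_pos hs two_pos) hc,
    ← lintegral_const_mul _ (by fun_prop), ← lintegral_add_left (by fun_prop)]
  refine setLIntegral_mono (by fun_prop) fun r (hr : 0 < r) => ?_
  have hr_pow : r ^ (s + 2 - 1) = r ^ (s - 1) * r ^ 2 := by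
    rw [← Real.rpow_add_natCast hr.ne']
    push_cast
    ring_nf
  rw [hr_pow, ← ENNReal.ofReal_mul hδ, ← ENNReal.ofReal_add (by positivity) (by positivity)]
  refine ENNReal.ofReal_le_ofReal ?_
  have hexp : 1 ≤ Real.exp (-(δ * r ^ 2)) + δ * r ^ 2 := by
    linarith [Real.add_one_le_exp (-(δ * r ^ 2))]
  calc r ^ (s - 1) * Real.exp (-(c * r))
      ≤ r ^ (s - 1) * Real.exp (-(c * r)) * (Real.exp (-(δ * r ^ 2)) + δ * r ^ 2) :=
        le_mul_of_one_le_right (by positivity) hexp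
    _ = _ := by ring

/-- The function with the Laplace transform `y^(-3/2) exp (-a y)`, where `y` is the square root of
twice the argument: the factor `y^(-1/2)` is a mixture of the exponentials `exp (-r y)`, each of
which shifts the heat kernel. -/
noncomputable def heatMixture (a x : ℝ) : ENNReal :=
  ENNReal.ofReal (√Real.pi)⁻¹ * ∫⁻ r in Set.Ioi 0, ENNReal.ofReal (r ^ ((1 / 2 : ℝ) - 1)) *
    ENNReal.ofReal (heatKernel (a + r) x)

variable {a x y : ℝ}

theorem measurable_uncurry_heatMixture_integrand (a : ℝ) :
    Measurable (Function.uncurry fun r x : ℝ =>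
      ENNReal.ofReal (r ^ ((1 / 2 : ℝ) - 1)) * ENNReal.ofReal (heatKernel (a + r) x)) := by
  have : Measurable fun p : ℝ × ℝ => heatKernel (a + p.1) p.2 :=
    measurable_heatKernel.comp (by fun_prop : Measurable fun p : ℝ × ℝ => (a + p.1, p.2))
  unfold Function.uncurry
  fun_prop

theorem measurable_heatMixture (a : ℝ) : Measurable (heatMixture a) :=
  (measurable_uncurry_heatMixture_integrand a).lintegral_prod_left'.const_mul _

theorem laplaceTransform_heatMixture (ha : 0 < a) (hy : 0 < y) :
    laplaceTransform (heatMixture a) (y ^ 2 / 2) =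
      ENNReal.ofReal (Real.exp (-(a * y)) / (y * √y)) := by
  have hshift : ∀ r ∈ Set.Ioi (0 : ℝ), laplaceTransform (fun x =>
      ENNReal.ofReal (r ^ ((1 / 2 : ℝ) - 1)) * ENNReal.ofReal (heatKernel (a + r) x)) (y ^ 2 / 2) =
      ENNReal.ofReal (Real.exp (-(a * y)) / y) *
        ENNReal.ofReal (r ^ ((1 / 2 : ℝ) - 1) * Real.exp (-(y * r))) := by
    intro r (hr : 0 < r)
    have hmeas : Measurable (heatKernel (a + r)) := measurable_heatKernel.of_uncurry_left
    rw [laplaceTransform_const_mul _ hmeas.ennreal_ofReal.aemeasurable,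
      laplaceTransform_heatKernel (by positivity) hy, ← ENNReal.ofReal_mul (by positivity),
      ← ENNReal.ofReal_mul (by positivity),
      show -((a + r) * y) = -(a * y) + -(y * r) by ring, Real.exp_add]
    ring_nf
  have hmeas := measurable_uncurry_heatMixture_integrand a
  unfold heatMixture
  rw [laplaceTransform_const_mul (f := fun x => ∫⁻ r in Set.Ioi 0, _ * _) _
      hmeas.lintegral_prod_left'.aemeasurable,
    laplaceTransform_lintegral hmeas, setLIntegral_congr_fun measurableSet_Ioi hshift,
    lintegral_const_mul _ (by fun_prop), lintegral_rpow_mul_exp_neg_mul_Ioi (by norm_num) hy,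
    ← ENNReal.ofReal_mul (by positivity), ← ENNReal.ofReal_mul (by positivity),
    Real.Gamma_one_half_eq, ← Real.sqrt_eq_rpow, Real.sqrt_div zero_le_one, Real.sqrt_one]
  have : 0 < √y := Real.sqrt_pos.2 hy
  congr 1
  field_simp

theorem heatMixture_eq (hx : x ≠ 0) (a : ℝ) :
    heatMixture a x = ENNReal.ofReal ((√Real.pi)⁻¹ * heatKernel a x) *
      ∫⁻ r in Set.Ioi 0, ENNReal.ofReal (r ^ ((1 / 2 : ℝ) - 1) *
        (Real.exp (-(a / x * r)) * Real.exp (-((2 * x)⁻¹ * r ^ 2)))) := by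
  rw [ENNReal.ofReal_mul (by positivity), mul_assoc, heatMixture,
    ← lintegral_const_mul (ENNReal.ofReal (heatKernel a x)) (by fun_prop)]
  congr 1
  refine setLIntegral_congr_fun measurableSet_Ioi fun r (hr : 0 < r) => ?_
  rw [heatKernel_add hx, ENNReal.ofReal_mul (heatKernel_nonneg a x), mul_left_comm,
    ← ENNReal.ofReal_mul (by positivity)]

theorem inv_sqrt_pi_mul_heatKernel_mul_Gamma (ha : 0 < a) (hx : 0 < x) :
    (√Real.pi)⁻¹ * heatKernel a x * ((1 / (a / x)) ^ (1 / 2 : ℝ) * Real.Gamma (1 / 2)) =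
      (√(2 * Real.pi * a))⁻¹ * Real.exp (-(a ^ 2) / (2 * x)) := by
  have : 0 < √x := Real.sqrt_pos.2 hx
  have : 0 < √a := Real.sqrt_pos.2 ha
  rw [heatKernel, Real.Gamma_one_half_eq, ← Real.sqrt_eq_rpow, one_div_div, Real.sqrt_div hx.le,
    Real.sqrt_mul (x := 2 * Real.pi) (by positivity) x,
    Real.sqrt_mul (x := 2 * Real.pi) (by positivity) a]
  field_simp

theorem heatMixture_le (ha : 0 < a) (hx : 0 < x) : heatMixture a x ≤
    ENNReal.ofReal ((√(2 * Real.pi * a))⁻¹ * Real.exp (-(a ^ 2) / (2 * x))) := by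
  have := heatKernel_nonneg a x
  rw [heatMixture_eq hx.ne', ← inv_sqrt_pi_mul_heatKernel_mul_Gamma ha hx,
    ENNReal.ofReal_mul (p := (√Real.pi)⁻¹ * heatKernel a x) (by positivity)]
  gcongr
  exact lintegral_rpow_mul_exp_mul_exp_neg_mul_sq_le (by norm_num) (by positivity) (by positivity)

theorem le_heatMixture (ha : 0 < a) (hx : 0 < x) :
    ENNReal.ofReal ((√(2 * Real.pi * a))⁻¹ * Real.exp (-(a ^ 2) / (2 * x)) *
      (1 - 3 * x / (8 * a ^ 2))) ≤ heatMixture a x := by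
  have := heatKernel_nonneg a x
  have hfactor : 1 - (2 * x)⁻¹ * (1 / 2 * (1 / 2 + 1)) / (a / x) ^ 2 = 1 - 3 * x / (8 * a ^ 2) := by
    field_simp
    ring
  rw [heatMixture_eq hx.ne', ← inv_sqrt_pi_mul_heatKernel_mul_Gamma ha hx, mul_assoc _ _ (_ - _),
    ENNReal.ofReal_mul (p := (√Real.pi)⁻¹ * heatKernel a x) (by positivity), ← hfactor]
  gcongr
  exact le_lintegral_rpow_mul_exp_mul_exp_neg_mul_sq (by norm_num) (by positivity) (by positivity)

end HeatMixture

section BridgeSeries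

/-- The coefficients of the binomial series of `(1 - q)^(-1/2)`. -/
noncomputable def invSqrtCoeff (n : ℕ) : ℝ := Ring.choose ((1 / 2 : ℝ) + n - 1) n

theorem factorial_mul_invSqrtCoeff (n : ℕ) :
    (n.factorial : ℝ) * invSqrtCoeff n = ∏ j ∈ Finset.range n, ((1 / 2 : ℝ) + n - 1 - j) := by
  rw [invSqrtCoeff, ← nsmul_eq_mul, ← Ring.descPochhammer_eq_factorial_smul_choose,
    ← descPochhammer_eval_eq_prod_range, Polynomial.descPochhammer_smeval_eq_ascPochhammer,
    Polynomial.ascPochhammer_smeval_eq_eval, descPochhammer_eval_eq_ascPochhammer]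

theorem invSqrtCoeff_zero : invSqrtCoeff 0 = 1 := by
  simpa using factorial_mul_invSqrtCoeff 0

theorem invSqrtCoeff_nonneg (n : ℕ) : 0 ≤ invSqrtCoeff n := by
  have h : 0 ≤ (n.factorial : ℝ) * invSqrtCoeff n := by
    rw [factorial_mul_invSqrtCoeff]
    refine Finset.prod_nonneg fun j hj => ?_
    have hjn : (j : ℝ) + 1 ≤ n := by exact_mod_cast Finset.mem_range.1 hj
    linarith
  exact nonneg_of_mul_nonneg_right h (by positivity)

theorem invSqrtCoeff_le_one (n : ℕ) : invSqrtCoeff n ≤ 1 := by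
  suffices h : (n.factorial : ℝ) * invSqrtCoeff n ≤ n.factorial * 1 from
    le_of_mul_le_mul_left h (by positivity)
  rw [factorial_mul_invSqrtCoeff, mul_one]
  calc ∏ j ∈ Finset.range n, ((1 / 2 : ℝ) + n - 1 - j)
      ≤ ∏ j ∈ Finset.range n, (((n - 1 - j : ℕ) + 1 : ℕ) : ℝ) := by
        refine Finset.prod_le_prod (fun j hj => ?_) fun j hj => ?_
        all_goals have hjn : (j : ℝ) + 1 ≤ n := by exact_mod_cast Finset.mem_range.1 hj
        · linarith
        · rw [show n - 1 - j + 1 = n - j by grind, Nat.cast_sub (by grind)]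
          linarith
    _ = n.factorial := by
        rw [Finset.prod_range_reflect (fun k => ((k + 1 : ℕ) : ℝ)) n, ← Nat.cast_prod,
          Finset.prod_range_add_one_eq_factorial]

theorem hasSum_invSqrtCoeff {q : ℝ} (h0 : 0 ≤ q) (h1 : q < 1) :
    HasSum (fun n => invSqrtCoeff n * q ^ n) (√(1 - q))⁻¹ := by
  have h := (Real.one_div_one_sub_rpow_hasFPowerSeriesOnBall_zero (1 / 2)).hasSum (y := q)
    (by simpa [abs_of_nonneg h0, enorm_eq_nnnorm, ← NNReal.coe_lt_coe] using h1)
  simp only [zero_add, FormalMultilinearSeries.ofScalars_apply_eq] at h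
  rw [Real.sqrt_eq_rpow, ← one_div]
  simpa [invSqrtCoeff] using h

/-- The distribution function of the squared norm of the Brownian bridge, as a series. It inverts
term by term the expansion of `(sinh y / y)^(-1/2)` in powers of `exp (-2y)`. -/
noncomputable def bridgeSeries (x : ℝ) : ENNReal :=
  ∑' n : ℕ, ENNReal.ofReal (2 * √2 * invSqrtCoeff n) * heatMixture (2 * n + 1 / 2) x

theorem measurable_bridgeSeries : Measurable bridgeSeries :=
  Measurable.tsum fun _ => (measurable_heatMixture _).const_mul _

variable {x y : ℝ}

theorem inv_half_sq_mul_inv_sqrt_sinh_div (hy : 0 < y) :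
    (y ^ 2 / 2)⁻¹ * (√(Real.sinh y / y))⁻¹ =
      2 * √2 * Real.exp (-(y / 2)) / (y * √y) * (√(1 - Real.exp (-(2 * y))))⁻¹ := by
  have hq : 0 < 1 - Real.exp (-(2 * y)) := sub_pos.2 (Real.exp_lt_one_iff.2 (by linarith))
  have hsinh : Real.sinh y / y =
      Real.exp (y / 2) ^ 2 * ((1 - Real.exp (-(2 * y))) / (2 * y)) := by
    rw [← Real.exp_nat_mul, Real.sinh_eq, mul_div_assoc', mul_sub, ← Real.exp_add]
    field_simp
    ring_nf
  rw [hsinh, Real.sqrt_mul (by positivity), Real.sqrt_sq (by positivity), Real.sqrt_div hq.le,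
    Real.sqrt_mul zero_le_two, Real.exp_neg (y / 2)]
  have : 0 < √y := Real.sqrt_pos.2 hy
  have : 0 < √(1 - Real.exp (-(2 * y))) := Real.sqrt_pos.2 hq
  field_simp
  rw [Real.sq_sqrt hy.le]

theorem laplaceTransform_bridgeSeries (hy : 0 < y) :
    laplaceTransform bridgeSeries (y ^ 2 / 2) =
      ENNReal.ofReal ((y ^ 2 / 2)⁻¹ * (√(Real.sinh y / y))⁻¹) := by
  have hterm : ∀ n : ℕ, ENNReal.ofReal (2 * √2 * invSqrtCoeff n) *
      laplaceTransform (heatMixture (2 * n + 1 / 2)) (y ^ 2 / 2) =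
      ENNReal.ofReal (2 * √2 * Real.exp (-(y / 2)) / (y * √y) *
        (invSqrtCoeff n * Real.exp (-(2 * y)) ^ n)) := by
    intro n
    have := invSqrtCoeff_nonneg n
    rw [laplaceTransform_heatMixture (by positivity) hy, ← ENNReal.ofReal_mul (by positivity),
      ← Real.exp_nat_mul, show -((2 * (n : ℝ) + 1 / 2) * y) = -(y / 2) + n * -(2 * y) by ring,
      Real.exp_add]
    ring_nf
  have hsum := (hasSum_invSqrtCoeff (q := Real.exp (-(2 * y))) (Real.exp_pos _).le
    (Real.exp_lt_one_iff.2 (by linarith))).mul_left (2 * √2 * Real.exp (-(y / 2)) / (y * √y))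
  unfold bridgeSeries
  rw [laplaceTransform_tsum fun n => ((measurable_heatMixture _).const_mul _).aemeasurable]
  simp_rw [fun n : ℕ => laplaceTransform_const_mul (ENNReal.ofReal (2 * √2 * invSqrtCoeff n))
    (measurable_heatMixture (2 * n + 1 / 2)).aemeasurable, hterm]
  rw [← ENNReal.ofReal_tsum_of_nonneg (fun n => mul_nonneg (by positivity)
    (mul_nonneg (invSqrtCoeff_nonneg n) (by positivity))) hsum.summable, hsum.tsum_eq,
    inv_half_sq_mul_inv_sqrt_sinh_div hy]

theorem sqrt_eight_div_pi : √(8 / Real.pi) = 2 * √2 * (√Real.pi)⁻¹ := by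
  rw [Real.sqrt_div (by norm_num), show (8 : ℝ) = 2 ^ 2 * 2 by norm_num,
    Real.sqrt_mul (by norm_num), Real.sqrt_sq (by norm_num), div_eq_mul_inv]

theorem le_bridgeSeries (hx : 0 < x) :
    ENNReal.ofReal (√(8 / Real.pi) * Real.exp (-(1 / 8) * x⁻¹) * (1 - 3 / 2 * x)) ≤
      bridgeSeries x := by
  have hfirst := (mul_le_mul_right (le_heatMixture (a := 2 * (0 : ℕ) + 1 / 2) (by norm_num) hx)
    (ENNReal.ofReal (2 * √2 * invSqrtCoeff 0))).trans (ENNReal.le_tsum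
      (f := fun n : ℕ => ENNReal.ofReal (2 * √2 * invSqrtCoeff n) *
        heatMixture (2 * n + 1 / 2) x) 0)
  rw [invSqrtCoeff_zero, ← ENNReal.ofReal_mul (by positivity)] at hfirst
  refine (ENNReal.ofReal_le_ofReal (le_of_eq ?_)).trans hfirst
  rw [sqrt_eight_div_pi, Nat.cast_zero, mul_zero, zero_add,
    show 2 * Real.pi * (1 / 2) = Real.pi by ring,
    show -((1 / 2 : ℝ) ^ 2) / (2 * x) = -(1 / 8) * x⁻¹ by field_simp; norm_num]
  ring

theorem exp_neg_two_mul_add_half_sq_div_le (hx : 0 < x) (n : ℕ) :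
    Real.exp (-((2 * n + 1 / 2 : ℝ) ^ 2) / (2 * x)) ≤ Real.exp (-(1 / 8) * x⁻¹) * x ^ n := by
  have hexp : Real.exp (-x⁻¹) ≤ x := by
    rw [Real.exp_neg, inv_le_comm₀ (Real.exp_pos _) hx]
    linarith [Real.add_one_le_exp x⁻¹]
  have hsq : -((2 * n + 1 / 2 : ℝ) ^ 2) / (2 * x) =
      -(1 / 8) * x⁻¹ + n * -x⁻¹ - 2 * n ^ 2 * x⁻¹ := by
    field_simp
    ring
  calc Real.exp (-((2 * n + 1 / 2 : ℝ) ^ 2) / (2 * x))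
      ≤ Real.exp (-(1 / 8) * x⁻¹ + n * -x⁻¹) := by
        rw [hsq]
        exact Real.exp_le_exp.2 (sub_le_self _ (by positivity))
    _ = Real.exp (-(1 / 8) * x⁻¹) * Real.exp (-x⁻¹) ^ n := by
        rw [Real.exp_add, Real.exp_nat_mul]
    _ ≤ Real.exp (-(1 / 8) * x⁻¹) * x ^ n := by gcongr

theorem bridgeSeries_le (hx : 0 < x) (hx1 : x < 1) :
    bridgeSeries x ≤
      ENNReal.ofReal (√(8 / Real.pi) * Real.exp (-(1 / 8) * x⁻¹) * (1 - x)⁻¹) := by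
  have hsum := (hasSum_geometric_of_lt_one hx.le hx1).mul_left
    (√(8 / Real.pi) * Real.exp (-(1 / 8) * x⁻¹))
  rw [← hsum.tsum_eq, ENNReal.ofReal_tsum_of_nonneg (fun n => by positivity) hsum.summable]
  refine ENNReal.tsum_le_tsum fun n => ?_
  have hcoeff0 := invSqrtCoeff_nonneg n
  refine (mul_le_mul_right (heatMixture_le (by positivity) hx) _).trans ?_
  rw [← ENNReal.ofReal_mul (by positivity)]
  refine ENNReal.ofReal_le_ofReal ?_
  have hcoeff1 := invSqrtCoeff_le_one n
  have hexp := exp_neg_two_mul_add_half_sq_div_le hx n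
  have hsqrt : (√(2 * Real.pi * (2 * n + 1 / 2)))⁻¹ ≤ (√Real.pi)⁻¹ := by
    gcongr
    linarith [show 0 ≤ Real.pi * n by positivity]
  calc 2 * √2 * invSqrtCoeff n * ((√(2 * Real.pi * (2 * n + 1 / 2)))⁻¹ *
        Real.exp (-((2 * n + 1 / 2 : ℝ) ^ 2) / (2 * x)))
      ≤ 2 * √2 * 1 * ((√Real.pi)⁻¹ * (Real.exp (-(1 / 8) * x⁻¹) * x ^ n)) := by gcongr
    _ = √(8 / Real.pi) * Real.exp (-(1 / 8) * x⁻¹) * x ^ n := by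
        rw [sqrt_eight_div_pi]
        ring

theorem laplaceTransform_gaussianSeriesBall_inv_dirichletEigenvalue (hy : 0 < y) :
    laplaceTransform (fun x => ENNReal.ofReal
        (gaussianSeriesBall (fun k => (dirichletEigenvalue k)⁻¹) x)) (y ^ 2 / 2) =
      ENNReal.ofReal ((y ^ 2 / 2)⁻¹ * (√(Real.sinh y / y))⁻¹) := by
  refine laplaceTransform_gaussianSeriesBall (fun k => inv_pos.2 (dirichletEigenvalue_pos k))
    (by positivity) ((tendsto_prod_one_add_div_dirichletEigenvalue hy.ne').congr fun n => ?_)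
  refine Finset.prod_congr rfl fun k _ => ?_
  ring

theorem ofReal_gaussianSeriesBall_inv_dirichletEigenvalue_ae_eq :
    (fun x => ENNReal.ofReal (gaussianSeriesBall (fun k => (dirichletEigenvalue k)⁻¹) x))
      =ᵐ[volume.restrict (Set.Ioi 0)] bridgeSeries := by
  have hparam : ∀ l : ℝ, 0 < l → ∃ y, 0 < y ∧ y ^ 2 / 2 = l := fun l hl =>
    ⟨√(2 * l), by positivity, by rw [Real.sq_sqrt (by positivity)]; ring⟩
  refine ae_eq_of_laplaceTransform_eq
    (gaussianSeriesBall_mono _).measurable.ennreal_ofReal.aemeasurable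
    measurable_bridgeSeries.aemeasurable (fun l hl => ?_) fun l hl => ?_
  all_goals obtain ⟨y, hy, rfl⟩ := hparam l hl
  · rw [laplaceTransform_gaussianSeriesBall_inv_dirichletEigenvalue hy]
    exact ENNReal.ofReal_ne_top
  · rw [laplaceTransform_gaussianSeriesBall_inv_dirichletEigenvalue hy,
      laplaceTransform_bridgeSeries hy]

end BridgeSeries

section BridgeAsymptotics

theorem frequently_nhdsGT_of_ae {q : ℝ → Prop} (h : ∀ᵐ z, q z) (x : ℝ) : ∃ᶠ z in 𝓝[>] x, q z := by
  have hsub := (Measure.dense_of_ae h).open_subset_closure_inter (isOpen_Ioi (a := x))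
  have hx : x ∈ closure (Set.Ioi x ∩ {z | q z}) :=
    closure_minimal hsub isClosed_closure (by simp)
  exact frequently_nhdsWithin_iff.2 ((mem_closure_iff_frequently.1 hx).mono fun z hz => hz.symm)

theorem frequently_nhdsLT_of_ae {q : ℝ → Prop} (h : ∀ᵐ z, q z) (x : ℝ) : ∃ᶠ z in 𝓝[<] x, q z := by
  have hsub := (Measure.dense_of_ae h).open_subset_closure_inter (isOpen_Iio (a := x))
  have hx : x ∈ closure (Set.Iio x ∩ {z | q z}) :=
    closure_minimal hsub isClosed_closure (by simp)
  exact frequently_nhdsWithin_iff.2 ((mem_closure_iff_frequently.1 hx).mono fun z hz => hz.symm)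

/-- The small ball asymptotics of the squared norm of the Brownian bridge. -/
noncomputable def bridgeAsymptotic (x : ℝ) : ℝ := √(8 / Real.pi) * Real.exp (-(1 / 8) * x⁻¹)

variable {x : ℝ}

theorem bridgeAsymptotic_pos (x : ℝ) : 0 < bridgeAsymptotic x := by
  rw [bridgeAsymptotic]
  positivity

theorem continuousAt_bridgeAsymptotic (hx : x ≠ 0) : ContinuousAt bridgeAsymptotic x := by
  unfold bridgeAsymptotic
  fun_prop (disch := assumption)

theorem gaussianSeriesBall_inv_dirichletEigenvalue_le (hx : x ∈ Set.Ioo 0 1) :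
    gaussianSeriesBall (fun k => (dirichletEigenvalue k)⁻¹) x ≤
      bridgeAsymptotic x * (1 - x)⁻¹ := by
  have hcont : ContinuousAt (fun z => bridgeAsymptotic z * (1 - z)⁻¹) x :=
    (continuousAt_bridgeAsymptotic hx.1.ne').mul
      (.inv₀ (by fun_prop) (sub_pos.2 hx.2).ne')
  refine ge_of_tendsto_of_frequently (hcont.tendsto.mono_left (nhdsWithin_le_nhds (s := Set.Ioi x)))
    (((frequently_nhdsGT_of_ae ((ae_restrict_iff' measurableSet_Ioi).1
      ofReal_gaussianSeriesBall_inv_dirichletEigenvalue_ae_eq) x).and_eventually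
      (Ioo_mem_nhdsGT hx.2)).mono ?_)
  rintro z ⟨hz, hxz, hz1⟩
  have hz0 : 0 < z := hx.1.trans hxz
  have hseries := bridgeSeries_le hz0 hz1
  rw [← hz hz0] at hseries
  exact (gaussianSeriesBall_mono _ hxz.le).trans ((ENNReal.ofReal_le_ofReal_iff
    (mul_nonneg (bridgeAsymptotic_pos z).le (inv_nonneg.2 (sub_pos.2 hz1).le))).1 hseries)

theorem le_gaussianSeriesBall_inv_dirichletEigenvalue (hx : 0 < x) :
    bridgeAsymptotic x * (1 - 3 / 2 * x) ≤
      gaussianSeriesBall (fun k => (dirichletEigenvalue k)⁻¹) x := by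
  have hcont : ContinuousAt (fun z => bridgeAsymptotic z * (1 - 3 / 2 * z)) x :=
    (continuousAt_bridgeAsymptotic hx.ne').mul (by fun_prop)
  refine le_of_tendsto_of_frequently (hcont.tendsto.mono_left (nhdsWithin_le_nhds (s := Set.Iio x)))
    (((frequently_nhdsLT_of_ae ((ae_restrict_iff' measurableSet_Ioi).1
      ofReal_gaussianSeriesBall_inv_dirichletEigenvalue_ae_eq) x).and_eventually
      (Ioo_mem_nhdsLT hx)).mono ?_)
  rintro z ⟨hz, hz0, hzx⟩
  have hseries := le_bridgeSeries hz0
  rw [← hz hz0] at hseries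
  exact ((ENNReal.ofReal_le_ofReal_iff (gaussianSeriesBall_nonneg _ _)).1 hseries).trans
    (gaussianSeriesBall_mono _ hzx.le)

theorem gaussianSeriesBall_inv_dirichletEigenvalue_isEquivalent :
    gaussianSeriesBall (fun k => (dirichletEigenvalue k)⁻¹) ~[𝓝[>] 0] bridgeAsymptotic := by
  have hlower : ContinuousAt (fun x : ℝ => 1 - 3 / 2 * x) 0 := by fun_prop
  have hupper : ContinuousAt (fun x : ℝ => (1 - x)⁻¹) 0 := .inv₀ (by fun_prop) (by norm_num)
  refine isEquivalent_of_tendsto_one (tendsto_of_tendsto_of_tendsto_of_le_of_le'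
    ((hlower.tendsto.mono_left nhdsWithin_le_nhds).trans_eq (by norm_num))
    ((hupper.tendsto.mono_left nhdsWithin_le_nhds).trans_eq (by norm_num)) ?_ ?_)
  · filter_upwards [self_mem_nhdsWithin] with x hx
    rw [Pi.div_apply, le_div_iff₀ (bridgeAsymptotic_pos x), mul_comm]
    exact le_gaussianSeriesBall_inv_dirichletEigenvalue hx
  · filter_upwards [Ioo_mem_nhdsGT one_pos] with x hx
    rw [Pi.div_apply, div_le_iff₀ (bridgeAsymptotic_pos x), mul_comm]
    exact gaussianSeriesBall_inv_dirichletEigenvalue_le hx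

end BridgeAsymptotics

namespace IsCenteredGaussianProcess

variable {Ω : Type*} [MeasurableSpace Ω] {P : Measure Ω} {K : unitInterval → unitInterval → ℝ}
  {X : unitInterval → Ω → ℝ}

theorem memLp (hX : IsCenteredGaussianProcess K X P) (t : unitInterval) : MemLp (X t) 2 P :=
  (hX.gaussian.hasGaussianLaw_eval t).memLp_two

variable [IsProbabilityMeasure P]

theorem integral_mul (hX : IsCenteredGaussianProcess K X P) (t s : unitInterval) :
    ∫ ω, X t ω * X s ω ∂P = K t s := by
  have hcov := covariance_eq_sub (hX.memLp t) (hX.memLp s)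
  rw [hX.mean_zero, zero_mul, sub_zero, hX.covariance] at hcov
  exact hcov.symm

theorem isGaussianHilbertSpace (hX : IsCenteredGaussianProcess K X P) :
    IsGaussianHilbertSpace (gaussianSpace X P) :=
  isGaussianHilbertSpace_gaussianSpace hX.gaussian hX.mean_zero

theorem isProcessIn (hX : IsCenteredGaussianProcess K X P)
    (hK : Continuous fun p : unitInterval × unitInterval => K p.1 p.2) :
    IsProcessIn (gaussianSpace X P) K X where
  isClosed := Submodule.isClosed_topologicalClosure _
  aemeasurable := hX.aemeasurable
  mem t := ⟨(hX.memLp t).toLp,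
    Submodule.le_topologicalClosure _ (Submodule.subset_span ⟨t, (hX.memLp t).coeFn_toLp⟩),
    (hX.memLp t).coeFn_toLp.symm⟩
  continuous_kernel := hK
  integral_mul := hX.integral_mul

end IsCenteredGaussianProcess

section Demean

variable {Ω : Type*} [MeasurableSpace Ω] {P : Measure Ω} {W : Submodule ℝ (Lp ℝ 2 P)}
  {K : unitInterval → unitInterval → ℝ} {Z : unitInterval → Ω → ℝ}

theorem demean_eq_sub_pathCoord {Ω : Type*} (Z : unitInterval → Ω → ℝ) (t : unitInterval) (ω : Ω) :
    demean Z t ω = Z t ω - pathCoord Z (fun _ => 1) ω := by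
  simp [demean, pathCoord]

namespace IsProcessIn

variable [IsProbabilityMeasure P]

theorem integral_demean_mul (hZ : IsProcessIn W K Z) (t s : unitInterval) :
    ∫ ω, demean Z t ω * demean Z s ω ∂P = centerKernel K t s := by
  set Y := pathCoord Z fun _ => 1
  have hY : MemLp Y 2 P := hZ.memLp_pathCoord continuous_const
  have hZY : ∀ t, ∫ ω, Z t ω * Y ω ∂P = ∫ r, K t r := fun t => by
    rw [hZ.integral_mul_pathCoord (hZ.memLp t) continuous_const]
    simp_rw [hZ.integral_mul, mul_one]
  have hYY : ∫ ω, Y ω * Y ω ∂P = ∫ r, ∫ q, K r q := by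
    rw [hZ.integral_mul_pathCoord hY continuous_const]
    simp_rw [mul_comm (Y _), hZY, mul_one]
  have hZtZs := (hZ.memLp t).integrable_mul (hZ.memLp s)
  have hZtY := (hZ.memLp t).integrable_mul hY
  have hZsY := (hZ.memLp s).integrable_mul hY
  calc ∫ ω, demean Z t ω * demean Z s ω ∂P
      = ∫ ω, (Z t ω * Z s ω - Z t ω * Y ω - Z s ω * Y ω + Y ω * Y ω) ∂P := by
        refine integral_congr_ae (.of_forall fun ω => ?_)
        simp only [demean_eq_sub_pathCoord, Y]
        ring
    _ = (∫ ω, Z t ω * Z s ω ∂P) - (∫ ω, Z t ω * Y ω ∂P) - (∫ ω, Z s ω * Y ω ∂P) +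
          ∫ ω, Y ω * Y ω ∂P :=
        (integral_add ((hZtZs.sub hZtY).sub hZsY) (hY.integrable_mul hY)).trans (congrArg (· + _)
          ((integral_sub (hZtZs.sub hZtY) hZsY).trans
            (congrArg (· - _) (integral_sub hZtZs hZtY))))
    _ = centerKernel K t s := by rw [hZ.integral_mul, hZY, hZY, hYY, centerKernel]

protected theorem demean (hZ : IsProcessIn W K Z) :
    IsProcessIn W (centerKernel K) (demean Z) where
  isClosed := hZ.isClosed
  aemeasurable := by
    have hmean := (hZ.memLp_pathCoord (f := fun _ => 1)
      continuous_const).1.aemeasurable.comp_snd (μ := (volume : Measure unitInterval))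
    simp_rw [demean_eq_sub_pathCoord]
    exact hZ.aemeasurable.sub hmean
  mem t := by
    obtain ⟨x, hx, hxZ⟩ := hZ.mem t
    obtain ⟨y, hy, hyZ⟩ := hZ.pathCoord_mem (f := fun _ => 1) continuous_const
    refine ⟨x - y, sub_mem hx hy, ?_⟩
    filter_upwards [hxZ, hyZ, Lp.coeFn_sub x y] with ω hω₁ hω₂ hω
    rw [demean_eq_sub_pathCoord, hω, Pi.sub_apply, hω₁, hω₂]
  continuous_kernel := continuous_centerKernel hZ.continuous_kernel
  integral_mul := hZ.integral_demean_mul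

theorem integral_demean (hZ : IsProcessIn W K Z) (h0 : ∀ t, ∫ ω, Z t ω ∂P = 0)
    (t : unitInterval) : ∫ ω, demean Z t ω ∂P = 0 := by
  have hmean := hZ.integral_mul_pathCoord (memLp_const (1 : ℝ)) (f := fun _ => 1) continuous_const
  simp only [one_mul, mul_one, h0, integral_zero] at hmean
  simp_rw [demean_eq_sub_pathCoord]
  rw [integral_sub ((hZ.memLp t).integrable one_le_two)
    ((hZ.memLp_pathCoord continuous_const).integrable one_le_two), hmean, h0, sub_zero]

end IsProcessIn

theorem IsCenteredGaussianProcess.covariance_demean [IsProbabilityMeasure P]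
    {X : unitInterval → Ω → ℝ} (hX : IsCenteredGaussianProcess K X P)
    (hK : Continuous fun p : unitInterval × unitInterval => K p.1 p.2) :
    (fun t s => cov[demean X t, demean X s; P]) = centerKernel K := by
  have hZ := hX.isProcessIn hK
  funext t s
  rw [covariance_eq_sub (hZ.demean.memLp t) (hZ.demean.memLp s),
    hZ.integral_demean hX.mean_zero, zero_mul, sub_zero]
  exact hZ.integral_demean_mul t s

end Demean

section Eigenfunctions

variable {K : unitInterval → unitInterval → ℝ} {u v : unitInterval → ℝ} {a b : ℝ}

theorem mul_integral_mul_comm_of_eigen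
    (hK : Continuous fun p : unitInterval × unitInterval => K p.1 p.2)
    (hsymm : ∀ t s, K t s = K s t) (hu : Continuous u) (hv : Continuous v)
    (hKu : ∀ t, ∫ s, K t s * u s = a * u t) (hKv : ∀ t, ∫ s, K t s * v s = b * v t) :
    a * ∫ t, u t * v t = b * ∫ t, u t * v t := by
  have hcont : Continuous fun p : unitInterval × unitInterval => v p.1 * (K p.1 p.2 * u p.2) := by
    fun_prop
  calc a * ∫ t, u t * v t = ∫ t, ∫ s, v t * (K t s * u s) := by
        simp_rw [integral_const_mul, hKu, ← integral_const_mul]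
        exact integral_congr_ae (.of_forall fun t => by ring)
    _ = ∫ s, ∫ t, v t * (K t s * u s) :=
        integral_integral_swap (integrable_of_continuous hcont)
    _ = ∫ s, ∫ t, u s * (K s t * v t) := by
        refine integral_congr_ae (.of_forall fun s => integral_congr_ae (.of_forall fun t => ?_))
        simp only [hsymm t s]
        ring
    _ = b * ∫ t, u t * v t := by
        simp_rw [integral_const_mul, hKv, mul_left_comm _ b, integral_const_mul]

theorem integral_mul_eq_zero_of_eigen
    (hK : Continuous fun p : unitInterval × unitInterval => K p.1 p.2)
    (hsymm : ∀ t s, K t s = K s t) (hu : Continuous u) (hv : Continuous v)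
    (hKu : ∀ t, ∫ s, K t s * u s = a * u t) (hKv : ∀ t, ∫ s, K t s * v s = b * v t)
    (hab : a ≠ b) : ∫ t, u t * v t = 0 := by
  have hcomm := mul_integral_mul_comm_of_eigen hK hsymm hu hv hKu hKv
  rw [← sub_eq_zero, ← sub_mul] at hcomm
  exact (mul_eq_zero.1 hcomm).resolve_left (sub_ne_zero.2 hab)

theorem integral_mul_self_pos (hu : Continuous u) (hu0 : u ≠ 0) : 0 < ∫ t, u t * u t := by
  obtain ⟨t, ht⟩ := Function.ne_iff.1 hu0
  have hcont : Continuous (Set.IccExtend (zero_le_one' ℝ) u) := hu.Icc_extend'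
  have hext : ∀ t : unitInterval, u t = Set.IccExtend (zero_le_one' ℝ) u t := fun t =>
    (Set.IccExtend_val (zero_le_one' ℝ) u t).symm
  simp_rw [hext]
  rw [integral_unitInterval fun t => Set.IccExtend (zero_le_one' ℝ) u t *
    Set.IccExtend (zero_le_one' ℝ) u t]
  refine intervalIntegral.integral_pos one_pos (hcont.mul hcont).continuousOn
    (fun _ _ => mul_self_nonneg _) ⟨t, t.2, ?_⟩
  rw [← hext]
  exact mul_self_pos.2 ht

/-- The normalization of `u` in `L²[0,1]`, equal to the junk value `0` when `u` vanishes. -/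
noncomputable def l2Normalize (u : unitInterval → ℝ) (t : unitInterval) : ℝ :=
  (√(∫ s, u s * u s))⁻¹ * u t

theorem continuous_l2Normalize (hu : Continuous u) : Continuous (l2Normalize u) :=
  hu.const_mul _

theorem integral_mul_l2Normalize (f u : unitInterval → ℝ) :
    ∫ t, f t * l2Normalize u t = (√(∫ s, u s * u s))⁻¹ * ∫ t, f t * u t := by
  simp_rw [l2Normalize, mul_left_comm (f _), integral_const_mul]

theorem integral_l2Normalize_mul_self (hu : Continuous u) (hu0 : u ≠ 0) :
    ∫ t, l2Normalize u t * l2Normalize u t = 1 := by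
  have hpos := integral_mul_self_pos hu hu0
  rw [integral_mul_l2Normalize]
  simp_rw [mul_comm (l2Normalize u _)]
  rw [integral_mul_l2Normalize, ← mul_assoc, ← mul_inv, Real.mul_self_sqrt hpos.le,
    inv_mul_cancel₀ hpos.ne']

theorem integral_mul_l2Normalize_of_eigen (hKu : ∀ t, ∫ s, K t s * u s = a * u t)
    (t : unitInterval) : ∫ s, K t s * l2Normalize u s = a * l2Normalize u t := by
  rw [integral_mul_l2Normalize, hKu, l2Normalize, mul_left_comm]

theorem isEigenSystem_l2Normalize {ι : Type*} [DecidableEq ι] {m : ι → ℝ}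
    {u : ι → unitInterval → ℝ}
    (hK : Continuous fun p : unitInterval × unitInterval => K p.1 p.2)
    (hsymm : ∀ t s, K t s = K s t) (hm : Function.Injective m) (hu : ∀ i, Continuous (u i))
    (hu0 : ∀ i, u i ≠ 0) (hKu : ∀ i t, ∫ s, K t s * u i s = m i * u i t) :
    IsEigenSystem K m fun i => l2Normalize (u i) where
  continuous i := continuous_l2Normalize (hu i)
  orthonormal i j := by
    split_ifs with hij
    · rw [hij, integral_l2Normalize_mul_self (hu j) (hu0 j)]
    · exact integral_mul_eq_zero_of_eigen hK hsymm (continuous_l2Normalize (hu i))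
        (continuous_l2Normalize (hu j)) (integral_mul_l2Normalize_of_eigen (hKu i))
        (integral_mul_l2Normalize_of_eigen (hKu j)) (hm.ne hij)
  integral_mul i := integral_mul_l2Normalize_of_eigen (hKu i)

theorem continuous_of_mem_kernelEigenspace
    (hK : Continuous fun p : unitInterval × unitInterval => K p.1 p.2) (ha : a ≠ 0)
    (hu : u ∈ kernelEigenspace K a) : Continuous u := by
  obtain ⟨hu2, hKu⟩ := hu
  obtain ⟨C, -, hC⟩ := exists_forall_abs_le_of_continuous hK
  have hcont : Continuous fun t => ∫ s, K t s * u s := by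
    refine continuous_of_dominated (bound := fun s => C * |u s|) (fun t => (hKu t).1.1)
      (fun t => .of_forall fun s => ?_) ((hu2.integrable one_le_two).abs.const_mul C)
      (.of_forall fun s => ?_)
    · rw [norm_mul]
      exact mul_le_mul_of_nonneg_right (hC (t, s)) (abs_nonneg _)
    · exact (hK.comp (continuous_id.prodMk continuous_const)).mul continuous_const
  have hu_eq : u = fun t => a⁻¹ * ∫ s, K t s * u s := by
    funext t
    rw [(hKu t).2, inv_mul_cancel_left₀ ha]
  rw [hu_eq]
  exact hcont.const_mul _

theorem mem_kernelEigenspace_of_continuous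
    (hK : Continuous fun p : unitInterval × unitInterval => K p.1 p.2) (hu : Continuous u)
    (hKu : ∀ t, ∫ s, K t s * u s = a * u t) : u ∈ kernelEigenspace K a :=
  ⟨memLp_two_of_continuous hu, fun t => ⟨integrable_of_continuous
    ((hK.comp (continuous_const.prodMk continuous_id)).mul hu), hKu t⟩⟩

end Eigenfunctions

section EigenvalueSequence

variable {K : unitInterval → unitInterval → ℝ}

namespace IsEigenSystem

section

variable {ι : Type*} [DecidableEq ι] {m : ι → ℝ} {e : ι → unitInterval → ℝ} {u : unitInterval → ℝ}
  {a : ℝ}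

theorem adjoin (he : IsEigenSystem K m e) (hu : Continuous u) (hu1 : ∫ t, u t * u t = 1)
    (heu : ∀ i, ∫ t, e i t * u t = 0) (hKu : ∀ t, ∫ s, K t s * u s = a * u t) :
    IsEigenSystem K (fun o : Option ι => o.elim a m) fun o => o.elim u e where
  continuous
    | none => hu
    | some i => he.continuous i
  orthonormal
    | none, none => by simpa using hu1
    | none, some i => by simpa [mul_comm] using heu i
    | some i, none => heu i
    | some i, some j => by simpa using he.orthonormal i j
  integral_mul
    | none => hKu
    | some i => he.integral_mul i

/-- Adjoining `u / ‖u‖` to the system would raise the sum of the eigenvalues above the trace. -/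
theorem eq_zero_of_orthogonal {Ω : Type*} [MeasurableSpace Ω] {P : Measure Ω}
    [IsProbabilityMeasure P] {W : Submodule ℝ (Lp ℝ 2 P)} {Z : unitInterval → Ω → ℝ}
    (he : IsEigenSystem K m e) (hZ : IsProcessIn W K Z) (hm : Summable m)
    (htrace : ∫ t, K t t ≤ ∑' i, m i) (ha : 0 < a) (hu : Continuous u)
    (hKu : ∀ t, ∫ s, K t s * u s = a * u t) (heu : ∀ i, ∫ t, e i t * u t = 0) : u = 0 := by
  by_contra hu0
  have hadjoin := he.adjoin (continuous_l2Normalize hu) (integral_l2Normalize_mul_self hu hu0)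
    (fun i => by rw [integral_mul_l2Normalize, heu, mul_zero])
    (integral_mul_l2Normalize_of_eigen hKu)
  have hle : ∀ s : Finset ι, ∑ i ∈ s, m i ≤ ∑' i, m i - a := fun s => by
    have hsum := hadjoin.sum_eigenvalues_le hZ (Finset.insertNone s)
    rw [Finset.sum_insertNone] at hsum
    exact le_sub_iff_add_le'.2 (hsum.trans htrace)
  linarith [hm.tsum_le_of_sum_le hle]

theorem mem_kernelEigenspace (he : IsEigenSystem K m e)
    (hK : Continuous fun p : unitInterval × unitInterval => K p.1 p.2) (i : ι) :
    e i ∈ kernelEigenspace K (m i) :=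
  mem_kernelEigenspace_of_continuous hK (he.continuous i) (he.integral_mul i)

theorem integral_mul_sum (he : IsEigenSystem K m e) (s : Finset ι) (c : ι → ℝ) (j : ι) :
    ∫ t, e j t * ∑ i ∈ s, c i * e i t = if j ∈ s then c j else 0 := by
  have h_int : ∀ i ∈ s, Integrable (fun t => c i * (e j t * e i t)) := fun i _ =>
    integrable_of_continuous (((he.continuous j).mul (he.continuous i)).const_mul _)
  simp_rw [Finset.mul_sum, mul_left_comm (e j _)]
  rw [integral_finsetSum _ h_int]
  simp only [integral_const_mul, he.orthonormal, mul_ite, mul_one, mul_zero, Finset.sum_ite_eq]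

theorem linearIndependent (he : IsEigenSystem K m e) : LinearIndependent ℝ e := by
  rw [linearIndependent_iff']
  intro s c hc j hj
  have hzero : ∀ t, ∑ i ∈ s, c i * e i t = 0 := fun t => by simpa using congrFun hc t
  simpa [hzero, hj] using (he.integral_mul_sum s c j).symm

theorem mem_span_of_mem_kernelEigenspace {Ω : Type*} [MeasurableSpace Ω] {P : Measure Ω}
    [IsProbabilityMeasure P] {W : Submodule ℝ (Lp ℝ 2 P)} {Z : unitInterval → Ω → ℝ}
    (he : IsEigenSystem K m e) (hZ : IsProcessIn W K Z) (hm : Summable m)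
    (htrace : ∫ t, K t t ≤ ∑' i, m i) (ha : 0 < a) (hu : u ∈ kernelEigenspace K a) :
    u ∈ Submodule.span ℝ (e '' {i | m i = a}) := by
  have hK := hZ.continuous_kernel
  have hfin : {i | m i = a}.Finite :=
    Set.Finite.subset (hm.tendsto_cofinite_zero.eventually_lt_const ha) fun i hi => not_lt.2 hi.ge
  set c : ι → ℝ := fun i => ∫ t, e i t * u t
  set p : unitInterval → ℝ := ∑ i ∈ hfin.toFinset, c i • e i with hp
  have hpspan : p ∈ Submodule.span ℝ (e '' {i | m i = a}) := Submodule.sum_mem _ fun i hi =>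
    Submodule.smul_mem _ _ (Submodule.subset_span ⟨i, hfin.mem_toFinset.1 hi, rfl⟩)
  have hpeigen : p ∈ kernelEigenspace K a := Submodule.sum_mem _ fun i hi =>
    Submodule.smul_mem _ _ (hfin.mem_toFinset.1 hi ▸ he.mem_kernelEigenspace hK i)
  have hucont := continuous_of_mem_kernelEigenspace hK ha.ne' hu
  have hpcont := continuous_of_mem_kernelEigenspace hK ha.ne' hpeigen
  have horth : ∀ j, ∫ t, e j t * (u - p) t = 0 := by
    intro j
    have hej := he.continuous j
    have heu : Integrable fun t => e j t * u t := integrable_of_continuous (hej.mul hucont)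
    have hep : Integrable fun t => e j t * p t := integrable_of_continuous (hej.mul hpcont)
    simp_rw [Pi.sub_apply, mul_sub]
    rw [integral_sub heu hep, hp]
    simp only [Finset.sum_apply, Pi.smul_apply, smul_eq_mul]
    rw [he.integral_mul_sum]
    split_ifs with hj
    · exact sub_self _
    · rw [sub_zero]
      exact integral_mul_eq_zero_of_eigen hK hZ.kernel_comm hej hucont (he.integral_mul j)
        (fun t => (hu.2 t).2) fun hja => hj (hfin.mem_toFinset.2 hja)
  have heq := he.eq_zero_of_orthogonal hZ hm htrace ha (hucont.sub hpcont)
    (fun t => ((Submodule.sub_mem _ hu hpeigen).2 t).2) horth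
  rwa [sub_eq_zero.1 heq]

end

variable {Ω : Type*} [MeasurableSpace Ω] {P : Measure Ω} [IsProbabilityMeasure P]
  {W : Submodule ℝ (Lp ℝ 2 P)} {Z : unitInterval → Ω → ℝ} {m : ℕ → ℝ}
  {e : ℕ → unitInterval → ℝ}

theorem rank_kernelEigenspace (he : IsEigenSystem K m e) (hZ : IsProcessIn W K Z)
    (hm : Summable m) (htrace : ∫ t, K t t ≤ ∑' k, m k) {a : ℝ} (ha : 0 < a) :
    Module.rank ℝ (kernelEigenspace K a) = Cardinal.mk {k // m k = a} := by
  have hspan : kernelEigenspace K a = Submodule.span ℝ (e '' {k | m k = a}) := by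
    refine le_antisymm (fun u => he.mem_span_of_mem_kernelEigenspace hZ hm htrace ha)
      (Submodule.span_le.2 ?_)
    rintro _ ⟨k, rfl, rfl⟩
    exact he.mem_kernelEigenspace hZ.continuous_kernel k
  rw [hspan, Set.image_eq_range]
  have hind := he.linearIndependent.comp (Subtype.val : {k // m k = a} → ℕ) Subtype.val_injective
  exact (rank_span hind).trans (Cardinal.mk_range_eq _ hind.injective)

theorem isEigenvalueSequence (he : IsEigenSystem K m e) (hZ : IsProcessIn W K Z)
    (hm : Summable m) (htrace : ∫ t, K t t ≤ ∑' k, m k) (hpos : ∀ k, 0 < m k)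
    (hanti : Antitone m) : IsEigenvalueSequence K m :=
  ⟨hpos, hanti, fun _ ha => (he.rank_kernelEigenspace hZ hm htrace ha).symm⟩

end IsEigenSystem

theorem IsEigenvalueSequence.eq_of_strictAnti {μ ν : ℕ → ℝ} (hμ : IsEigenvalueSequence K μ)
    (hν : IsEigenvalueSequence K ν) (hanti : StrictAnti ν) : μ = ν := by
  have hequiv : ∀ c, 0 < c → Nonempty ({k // μ k = c} ≃ {k // ν k = c}) := fun c hc =>
    Cardinal.eq.1 ((hμ.multiplicity c hc).trans (hν.multiplicity c hc).symm)
  have hinj : Function.Injective μ := fun i j hij => by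
    obtain ⟨φ⟩ := hequiv (μ j) (hμ.pos j)
    have hφ : φ ⟨i, hij⟩ = φ ⟨j, rfl⟩ :=
      Subtype.ext (hanti.injective ((φ ⟨i, hij⟩).2.trans (φ ⟨j, rfl⟩).2.symm))
    exact congrArg Subtype.val (φ.injective hφ)
  have hrange : Set.range μ = Set.range ν := by
    refine Set.Subset.antisymm ?_ ?_
    · rintro _ ⟨k, rfl⟩
      obtain ⟨φ⟩ := hequiv (μ k) (hμ.pos k)
      exact ⟨φ ⟨k, rfl⟩, (φ ⟨k, rfl⟩).2⟩
    · rintro _ ⟨k, rfl⟩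
      obtain ⟨φ⟩ := hequiv (ν k) (hν.pos k)
      exact ⟨φ.symm ⟨k, rfl⟩, (φ.symm ⟨k, rfl⟩).2⟩
  have hdual := (StrictMono.range_inj (hμ.antitone.strictAnti_of_injective hinj).dual_right
    hanti.dual_right).1 (by rw [Set.range_comp, Set.range_comp, hrange])
  exact funext fun k => congrFun hdual k

end EigenvalueSequence

section Bridge

theorem bridgeKernel_comm (t s : unitInterval) : bridgeKernel t s = bridgeKernel s t := by
  unfold bridgeKernel; rw [min_comm, mul_comm]

theorem sin_pi_mul_add_one_mul_ne_zero (k : ℕ) :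
    (fun t : unitInterval => Real.sin (Real.pi * (k + 1) * t)) ≠ 0 := by
  intro h
  have ht : (1 / (2 * (k + 1)) : ℝ) ∈ unitInterval := by
    refine ⟨by positivity, ?_⟩
    rw [div_le_one (by positivity)]
    linarith [(Nat.cast_nonneg k : (0 : ℝ) ≤ k)]
  have hzero := congrFun h ⟨_, ht⟩
  have harg : Real.pi * (k + 1) * (1 / (2 * (k + 1))) = Real.pi / 2 := by field_simp
  simp only [harg, Real.sin_pi_div_two, Pi.zero_apply, one_ne_zero] at hzero

theorem isEigenSystem_bridgeKernel :
    IsEigenSystem bridgeKernel (fun k : ℕ => (dirichletEigenvalue k)⁻¹)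
      fun k => l2Normalize fun t => Real.sin (Real.pi * (k + 1) * t) :=
  isEigenSystem_l2Normalize continuous_bridgeKernel bridgeKernel_comm
    (inv_injective.comp dirichletEigenvalue_strictMono.injective) (fun k => by fun_prop)
    sin_pi_mul_add_one_mul_ne_zero integral_bridgeKernel_mul_sin

theorem smallBall_bridge {Ω : Type*} [MeasurableSpace Ω] {P : Measure Ω} [IsProbabilityMeasure P]
    {B : unitInterval → Ω → ℝ} (hB : IsCenteredGaussianProcess bridgeKernel B P) {ε : ℝ}
    (hε : 0 ≤ ε) :
    smallBall B P ε = gaussianSeriesBall (fun k => (dirichletEigenvalue k)⁻¹) (ε ^ 2) :=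
  isEigenSystem_bridgeKernel.smallBall_eq_gaussianSeriesBall hB.isGaussianHilbertSpace
    (hB.isProcessIn continuous_bridgeKernel) summable_inv_dirichletEigenvalue
    (by rw [integral_bridgeKernel_diag, hasSum_inv_dirichletEigenvalue.tsum_eq]) hε

end Bridge

theorem tendsto_sq_nhdsGT_zero : Tendsto (fun ε : ℝ => ε ^ 2) (𝓝[>] 0) (𝓝[>] 0) := by
  refine tendsto_nhdsWithin_iff.2 ⟨?_, ?_⟩
  · exact ((continuous_pow 2).tendsto' (0 : ℝ) 0 (by simp)).mono_left nhdsWithin_le_nhds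
  · filter_upwards [self_mem_nhdsWithin] with x hx using pow_pos (Set.mem_Ioi.1 hx) 2

theorem exp_half_mul_bridgeAsymptotic (β x : ℝ) :
    Real.exp (β / 2) * bridgeAsymptotic x =
      (8 * Real.exp β / Real.pi) ^ (1 / 2 : ℝ) * Real.exp (-(1 / 8) * x⁻¹) := by
  rw [bridgeAsymptotic, Real.exp_half, ← mul_assoc, ← Real.sqrt_mul (Real.exp_pos β).le,
    ← Real.sqrt_eq_rpow, mul_div_assoc', mul_comm (Real.exp β)]

namespace IsOUFrequencySequence

variable {Ω : Type*} [MeasurableSpace Ω] {P : Measure Ω} [IsProbabilityMeasure P]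
  {X : unitInterval → Ω → ℝ} {β : ℝ} {ω : ℕ → ℝ}

theorem inv_sq_add_sq_pos (hω : IsOUFrequencySequence β ω) (k : ℕ) : 0 < (ω k ^ 2 + β ^ 2)⁻¹ :=
  inv_pos.2 (add_pos_of_pos_of_nonneg (pow_pos (hω.pos k) 2) (sq_nonneg β))

theorem strictAnti_inv_sq_add_sq (hω : IsOUFrequencySequence β ω) :
    StrictAnti fun k => (ω k ^ 2 + β ^ 2)⁻¹ := fun i _ hij =>
  inv_strictAnti₀ (inv_pos.1 (hω.inv_sq_add_sq_pos i))
    (add_lt_add_left (pow_lt_pow_left₀ (hω.strictMono hij) (hω.pos i).le two_ne_zero) _)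

theorem isEigenSystem (hω : IsOUFrequencySequence β ω) (hβ : 0 < β) :
    IsEigenSystem (centerKernel (ouZeroKernel β)) (fun k => (ω k ^ 2 + β ^ 2)⁻¹)
      fun k => l2Normalize fun t => ouEigenfunction β (ω k) t :=
  isEigenSystem_l2Normalize (continuous_centerKernel (continuous_ouZeroKernel β))
    (fun t s => by simp only [centerKernel, ouZeroKernel_comm β t s]; ring)
    hω.strictAnti_inv_sq_add_sq.injective
    (fun k => (continuous_ouEigenfunction β (ω k)).comp continuous_subtype_val)
    (fun k => ouEigenfunction_ne_zero (hω.sin_ne_zero k))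
    fun k => integral_centerKernel_mul_ouEigenfunction hβ.ne' (hω.pos k).ne'
      (hω.ouCharFun_eq_zero k)

theorem integral_centerKernel_diag_le (hω : IsOUFrequencySequence β ω) (hβ : 0 < β) :
    ∫ t, centerKernel (ouZeroKernel β) t t ≤ ∑' k, (ω k ^ 2 + β ^ 2)⁻¹ :=
  (integral_centerKernel_ouZeroKernel_diag hβ.ne').trans_le (hω.ouTrace_le_tsum hβ)

theorem isEigenvalueSequence (hω : IsOUFrequencySequence β ω) (hβ : 0 < β)
    (hX : IsCenteredGaussianProcess (ouZeroKernel β) X P) :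
    IsEigenvalueSequence (centerKernel (ouZeroKernel β)) fun k => (ω k ^ 2 + β ^ 2)⁻¹ :=
  (hω.isEigenSystem hβ).isEigenvalueSequence (hX.isProcessIn (continuous_ouZeroKernel β)).demean
    hω.summable_inv_sq_add_sq (hω.integral_centerKernel_diag_le hβ) hω.inv_sq_add_sq_pos
    hω.strictAnti_inv_sq_add_sq.antitone

theorem tendsto_prod_inv_dirichletEigenvalue_div (hω : IsOUFrequencySequence β ω) (hβ : 0 < β) :
    Tendsto (fun n => ∏ k ∈ Finset.range n, (dirichletEigenvalue k)⁻¹ / (ω k ^ 2 + β ^ 2)⁻¹) atTop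
      (𝓝 (Real.exp β)) := by
  rw [← ouDet_self hβ.ne']
  refine (hω.tendsto_prod hβ hβ.ne').congr fun n => Finset.prod_congr rfl fun k _ => ?_
  rw [div_inv_eq_mul, mul_comm, ← div_eq_mul_inv]

theorem smallBall_demean_isEquivalent (hω : IsOUFrequencySequence β ω) (hβ : 0 < β)
    (hX : IsCenteredGaussianProcess (ouZeroKernel β) X P) :
    smallBall (demean X) P ~[𝓝[>] 0] fun ε =>
      Real.exp (β / 2) * gaussianSeriesBall (fun k => (dirichletEigenvalue k)⁻¹) (ε ^ 2) := by
  have hseries := gaussianSeriesBall_isEquivalent hω.inv_sq_add_sq_pos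
    (fun k => inv_pos.2 (dirichletEigenvalue_pos k))
    (fun k => by simpa only [inv_inv] using hω.abs_sq_add_sq_sub_dirichletEigenvalue_le hβ k)
    (hω.tendsto_prod_inv_dirichletEigenvalue_div hβ)
  rw [← Real.exp_half] at hseries
  refine (hseries.comp_tendsto tendsto_sq_nhdsGT_zero).congr_left ?_
  filter_upwards [self_mem_nhdsWithin] with ε hε
  exact ((hω.isEigenSystem hβ).smallBall_eq_gaussianSeriesBall hX.isGaussianHilbertSpace
    (hX.isProcessIn (continuous_ouZeroKernel β)).demean hω.summable_inv_sq_add_sq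
    (hω.integral_centerKernel_diag_le hβ) (Set.mem_Ioi.1 hε).le).symm

end IsOUFrequencySequence

theorem mainTheorem5 {Ω : Type*} [MeasurableSpace Ω] (P : Measure Ω) [IsProbabilityMeasure P]
    (β : ℝ) (hβ : 0 < β) (X : unitInterval → Ω → ℝ)
    (hX : IsCenteredGaussianProcess (ouZeroKernel β) X P) :
    (∃ μ : ℕ → ℝ, IsEigenvalueSequence (fun t s => cov[demean X t, demean X s; P]) μ) ∧
    (∀ μ : ℕ → ℝ, IsEigenvalueSequence (fun t s => cov[demean X t, demean X s; P]) μ →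
      Tendsto (fun n : ℕ => ∏ k ∈ Finset.range n, ((Real.pi * ((k : ℝ) + 1)) ^ 2)⁻¹ / μ k)
        atTop (𝓝 (Real.exp β))) ∧
    (∀ {Ω' : Type*} [MeasurableSpace Ω'] (P' : Measure Ω') [IsProbabilityMeasure P']
      (B : unitInterval → Ω' → ℝ), IsCenteredGaussianProcess bridgeKernel B P' →
      smallBall (demean X) P ~[𝓝[>] 0] fun ε => Real.exp (β / 2) * smallBall B P' ε) ∧
    smallBall (demean X) P ~[𝓝[>] 0]
      fun ε => (8 * Real.exp β / Real.pi) ^ (1 / 2 : ℝ) * Real.exp (-(1 / 8) * (ε ^ 2)⁻¹) := by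
  obtain ⟨ω, hω⟩ := exists_isOUFrequencySequence hβ
  have hμω := hω.isEigenvalueSequence hβ hX
  have hball := hω.smallBall_demean_isEquivalent hβ hX
  rw [hX.covariance_demean (continuous_ouZeroKernel β)]
  refine ⟨⟨_, hμω⟩, fun μ hμ => ?_, fun P' _ B hB => hball.congr_right ?_, hball.trans ?_⟩
  · rw [hμ.eq_of_strictAnti hμω hω.strictAnti_inv_sq_add_sq]
    exact hω.tendsto_prod_inv_dirichletEigenvalue_div hβ
  · filter_upwards [self_mem_nhdsWithin] with ε hε
    rw [smallBall_bridge hB (Set.mem_Ioi.1 hε).le]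
  · have hbridge := gaussianSeriesBall_inv_dirichletEigenvalue_isEquivalent.comp_tendsto
      tendsto_sq_nhdsGT_zero
    simp_rw [← exp_half_mul_bridgeAsymptotic]
    exact IsEquivalent.refl.mul hbridge
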